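/- For integers $0<k<n$ and a prime power $q$ let $\hat g(n,k,q)$ be the least integer $g\ge 0$ with $\binom{n}{g}/q^{\,g-k}<1$. A Reed-Solomon code $[n,k]_q$ is given by a field $\mathbf F_q$ with $q$ elements, a set $S\subseteq\mathbf F_q$ of $n$ evaluation points, and $k$; its codewords are the vectors $(m(a))_{a\in S}$ with $m\in\mathbf F_q[x]$, $\deg m<k$. Let $\mathcal C$ be any family of Reed-Solomon codes (with varying $q$, $n$, $k$, $S$). Consider the following two problems. (1) List decoding at radius $n-\hat g(n,k,q)$: given a code of $\mathcal C$ (that is, the addition and multiplication tables of $\mathbf F_q$, the points of $S$, and $k$) and a received word $y\in\mathbf F_q^{\,n}$, output a list of all codewords at Hamming distance at most $n-\hat g(n,k,q)$ from $y$ (and of no other words). (2) Discrete logarithms in $\mathbf F_{q^{h}}$, $h=\hat g(n,k,q)-k$: given a code of $\mathcal C$, a monic irreducible polynomial $h(x)\in\mathbf F_q[x]$ of degree $h$, and polynomials of degree less than $h$ that represent a nonzero element $b$ of $\mathbf F_{q^h}=\mathbf F_q[x]/(h(x))$ and an element $t$ of the multiplicative group generated by $b$, output an integer $0\le x<q^h-1$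 with $b^x=t$. If problem (1) can be solved in time $q^{O(1)}$, then problem (2) can be solved in time $q^{O(1)}$. Here "solved in time $q^{O(1)}$" means: there are one algorithm (for all codes of $\mathcal C$) and constants $c,d$ such that on every instance over $\mathbf F_q$ the algorithm uses a string of $q^{d}$ fair coin tosses, halts within time $q^{c}$ for every outcome of them, and gives a correct output with probability at least $2/3$. Time is the bit cost of a program built from elementary operations on pairs and binary natural numbers by composition, pairing, branching and while loops, each operation costing the total size of its argument and result; up to a polynomial this is Turing machine time. -/

import Mathlib

open Polynomial

namespace RSDlog

/-! ## A programming language with a bit-cost time measure -/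

/-- Data: natural numbers and pairs. -/
inductive Val : Type
  | num (n : ℕ) : Val
  | pair (a b : Val) : Val

namespace Val

/-- The number of symbols needed to write a value down, numbers being written in binary. -/
def size : Val → ℕ
  | num n => Nat.size n + 1
  | pair a b => size a + size b + 1

/-- Lists as iterated pairs, the empty list being `0`. -/
def ofList : List Val → Val
  | [] => num 0
  | v :: l => pair v (ofList l)

end Val

/-- The elementary operations. -/
inductive Atom : Type
  | id
  | fst
  | snd
  | isPair
  | const (n : ℕ)
  | add
  | sub
  | mul
  | div

/-- A binary operation on numbers, with the value `0` on ill-formed arguments. -/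
def Val.binop (f : ℕ → ℕ → ℕ) : Val → Val
  | .pair (.num a) (.num b) => .num (f a b)
  | _ => .num 0

/-- The function computed by an elementary operation.
Subtraction is truncated, and division is division with remainder (`a / 0 = 0`). -/
def Atom.apply : Atom → Val → Val
  | .id, x => x
  | .fst, .pair a _ => a
  | .fst, .num _ => .num 0
  | .snd, .pair _ b => b
  | .snd, .num _ => .num 0
  | .isPair, .pair _ _ => .num 1
  | .isPair, .num _ => .num 0
  | .const n, _ => .num n
  | .add, x => x.binop (· + ·)
  | .sub, x => x.binop (· - ·)
  | .mul, x => x.binop (· * ·)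
  | .div, x => x.binop (· / ·)

/-- Programs: elementary operations, closed under sequential composition, pairing of results,
branching, and `while` loops (`loop c f` is "while `c` holds, apply `f`").
A test succeeds if its result is anything but the number `0`. -/
inductive Prog : Type
  | atom (a : Atom) : Prog
  | seq (f g : Prog) : Prog
  | pair (f g : Prog) : Prog
  | ite (c f g : Prog) : Prog
  | loop (c f : Prog) : Prog

/-- `p.Runs x y t`: on input `x` the program `p` halts with output `y` after time `t`.
Every elementary operation costs the size of its argument plus the size of its result, so that
all values that occur in a run have size at most the running time, and running times agree with
those of Turing machines up to a polynomial. A run that does not halt has no `y` and `t`. -/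
inductive Prog.Runs : Prog → Val → Val → ℕ → Prop
  | atom (a : Atom) (x : Val) :
      Runs (.atom a) x (a.apply x) (x.size + (a.apply x).size)
  | seq {f g : Prog} {x y z : Val} {s t : ℕ} :
      Runs f x y s → Runs g y z t → Runs (.seq f g) x z (s + t)
  | pair {f g : Prog} {x y z : Val} {s t : ℕ} :
      Runs f x y s → Runs g x z t → Runs (.pair f g) x (.pair y z) (s + t + 1)
  | iteTrue {c f g : Prog} {x v y : Val} {s t : ℕ} :
      Runs c x v s → v ≠ .num 0 → Runs f x y t → Runs (.ite c f g) x y (s + t)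
  | iteFalse {c f g : Prog} {x y : Val} {s t : ℕ} :
      Runs c x (.num 0) s → Runs g x y t → Runs (.ite c f g) x y (s + t)
  | loopStop {c f : Prog} {x : Val} {s : ℕ} :
      Runs c x (.num 0) s → Runs (.loop c f) x x s
  | loopStep {c f : Prog} {x v y z : Val} {s t u : ℕ} :
      Runs c x v s → v ≠ .num 0 → Runs f x y t → Runs (.loop c f) y z u →
        Runs (.loop c f) x z (s + t + u)

/-! ## Problems and randomized algorithms -/

/-- A computational (search) problem: its instances, the parameter in which running times are
measured, the encoding of instances, and the correct outputs for each instance. -/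
structure Problem where
  Inst : Type*
  param : Inst → ℕ
  input : Inst → Val
  Correct : Inst → Val → Prop

open Classical in
/-- The problem can be solved in time `param ^ O(1)`, by a randomized algorithm: there are a
single program `p` and exponents `c`, `d` such that on every instance with parameter `q`, and for
every string of `q ^ d` coin tosses (given to `p` as a number `r < 2 ^ (q ^ d)` next to the
instance), `p` halts within time `q ^ c`, and its output is correct for at least two thirds of
the strings. -/
def Problem.SolvableInPolyTime (P : Problem) : Prop :=
  ∃ (p : Prog) (c d : ℕ), ∀ i : P.Inst,
    (∀ r < 2 ^ (P.param i ^ d), ∃ (y : Val) (t : ℕ),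
      p.Runs (.pair (P.input i) (.num r)) y t ∧ t ≤ P.param i ^ c) ∧
    2 * 2 ^ (P.param i ^ d) ≤
      3 * ((Finset.range (2 ^ (P.param i ^ d))).filter fun r =>
        ∃ (y : Val) (t : ℕ),
          p.Runs (.pair (P.input i) (.num r)) y t ∧ P.Correct i y).card

/-! ## Reed-Solomon codes -/

/-- The least `g` such that `C(n, g) / q ^ (g - k) < 1`, the exponent `g - k` being an integer. -/
noncomputable def gHat (n k q : ℕ) : ℕ :=
  sInf {g : ℕ | (n.choose g : ℚ) / (q : ℚ) ^ ((g : ℤ) - (k : ℤ)) < 1}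

/-- A Reed-Solomon code `[n, k]_q`: a field `F` whose elements are labelled by `0, …, q - 1`, the
`n` distinct evaluation points (the elements of the set `S`), and the dimension `k`. -/
structure RSCode : Type 1 where
  q : ℕ
  F : Type
  [field : Field F]
  label : F ≃ Fin q
  n : ℕ
  point : Fin n ↪ F
  k : ℕ
  k_pos : 0 < k
  k_lt : k < n

attribute [instance] RSCode.field

namespace RSCode

variable (C : RSCode)

/-- The number `ĝ(n, k, q)` of the code. -/
noncomputable def gHat : ℕ := RSDlog.gHat C.n C.k C.q

/-- The codewords: the evaluations of the polynomials `a₀ + a₁ x + ⋯ + a_{k-1} x^{k-1}`. -/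
def IsCodeword (w : Fin C.n → C.F) : Prop :=
  ∃ m : C.F[X], m.degree < C.k ∧ ∀ i, w i = m.eval (C.point i)

/-- A field element, written as its label. -/
def elem (a : C.F) : Val := .num (C.label a)

/-- A vector of field elements, written as the list of its entries. -/
def vec {m : ℕ} (w : Fin m → C.F) : Val := .ofList (List.ofFn fun i => C.elem (w i))

/-- The table of a binary operation on the field, row by row. -/
def table (op : C.F → C.F → C.F) : Val :=
  .ofList (List.ofFn fun i : Fin C.q =>
    C.vec fun j : Fin C.q => op (C.label.symm i) (C.label.symm j))

/-- The description of the code: `q`, the addition and the multiplication table of the field, the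
list of evaluation points, and `k`. -/
def enc : Val :=
  .pair (.num C.q) (.pair (C.table (· + ·)) (.pair (C.table (· * ·))
    (.pair (C.vec C.point) (.num C.k))))

end RSCode

/-! ## The two problems -/

open Classical in
/-- List decoding of the Reed-Solomon codes in the family `𝒞` at radius `n - ĝ(n, k, q)`: given a
code in the family and a received word, output a list of all codewords that have Hamming distance
at most `n - ĝ(n, k, q)` from the received word (and of no other words). -/
noncomputable def listDecoding (𝒞 : Set RSCode) : Problem where
  Inst := Σ C : 𝒞, (Fin C.1.n → C.1.F)
  param := fun i => i.1.1.q
  input := fun i => .pair i.1.1.enc (i.1.1.vec i.2)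
  Correct := fun i y => ∃ L : List (Fin i.1.1.n → i.1.1.F),
    y = .ofList (L.map i.1.1.vec) ∧
    ∀ w, w ∈ L ↔ i.1.1.IsCodeword w ∧ hammingDist w i.2 ≤ i.1.1.n - i.1.1.gHat

/-- An instance of the discrete logarithm problem in the field with `q ^ (ĝ(n, k, q) - k)`
elements, presented as `F[x] / (h)` with `h` a monic irreducible polynomial: a base `b ≠ 0` and an
element `t` of the subgroup generated by `b`, both given by their representatives of degree less
than `deg h`. -/
structure DLInst (C : RSCode) where
  h : C.F[X]
  monic : h.Monic
  irreducible : Irreducible h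
  natDegree_h : h.natDegree = C.gHat - C.k
  b : C.F[X]
  t : C.F[X]
  degree_b : b.degree < h.degree
  degree_t : t.degree < h.degree
  b_ne_zero : b ≠ 0
  exists_log : ∃ x : ℕ, AdjoinRoot.mk h b ^ x = AdjoinRoot.mk h t

/-- Discrete logarithms over the fields with `q ^ (ĝ(n, k, q) - k)` elements, for the codes in the
family `𝒞`: given a code in the family, `h`, `b` and `t` (the coefficient vectors, from the
constant term upwards), output an exponent `x < q ^ (ĝ(n, k, q) - k) - 1` with `b ^ x = t`. -/
noncomputable def discreteLog (𝒞 : Set RSCode) : Problem where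
  Inst := Σ C : 𝒞, DLInst C.1
  param := fun i => i.1.1.q
  input := fun i => .pair i.1.1.enc
    (.pair (i.1.1.vec fun j : Fin (i.2.h.natDegree + 1) => i.2.h.coeff j)
      (.pair (i.1.1.vec fun j : Fin i.2.h.natDegree => i.2.b.coeff j)
        (i.1.1.vec fun j : Fin i.2.h.natDegree => i.2.t.coeff j)))
  Correct := fun i y => ∃ x : ℕ, y = .num x ∧
    x < i.1.1.q ^ (i.1.1.gHat - i.1.1.k) - 1 ∧
    AdjoinRoot.mk i.2.h i.2.b ^ x = AdjoinRoot.mk i.2.h i.2.t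

end RSDlog

namespace RSDlog

/-! ## Runs of programs -/

/-! The reduction is an index calculus in which the list decoder factors elements. Let `K =
F[x]/(h)`, let `α` be the class of `x`, and let `N = q ^ deg h - 1` be the order of the unit group.
The factor base consists of the elements `α - a` for the evaluation points `a`. Here `ĝ = k + deg
h`. If `f` is the product of `α - a` over a set `A` of `ĝ` points, division by `h` gives `∏ (x - a)
= f(x) + h(x) Q(x)` with `Q` monic of degree `k`. So `Q - x ^ k` is a message polynomial, and its
codeword agrees with the word `a ↦ -f(a)/h(a) - a ^ k` exactly on `A` (`wordOf_eq_received_iff`).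
The decoder at radius `n - ĝ` therefore lists it. Every candidate is tested by multiplying out, so
no false relation enters.

Such elements `f` are frequent. A list is no longer than the running time of the decoder, so each
`f` has at most `q ^ c` factorizations, and minimality of `ĝ` gives `C(n, ĝ) ≥ q ^ (deg h - 2)`;
hence a fraction `q ^ (-O(1))` of `K` factors (`card_smooth`). A product of powers of the factor
base, of `b` and of `t`, with random exponents modulo `N`, is a random value of a homomorphism, so
polynomially many attempts give more than `n` relations with probability at least `q ^ (-O(1))`
(`card_sample_le`, `card_le_card_enough`).

Since `N` is composite in general and its factorization is not available, the `n` columns of the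
factor base are cleared by Euclid's algorithm on rows over `ZMod N`, at the price of one row per
column. A relation `b ^ x * t ^ y = 1` remains, which yields the logarithm if `y` is a unit
(`isLog_logOf`). Given enough relations, `y` is uniform. Indeed, let `w` be the relation `t = b ^
log`. It vanishes on the factor base, so adding multiples of `w` to the random exponents changes
neither what the decoder sees nor any quotient in the elimination. As the row operations are
invertible, some such change adds `w` to the last row and replaces `y` by `y + 1`
(`exists_shift_lastExp`, `card_endsWith_le_succ`). Units have density `φ(N) / N ≥ q ^ (-2)`
(`le_totient_mul`). Answers can be checked, so polynomially many independent trials suffice. If `deg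
h = 1`, exhaustive search is used instead.

The running time is handled by the relation `Comp` between families of values: it is closed under
the constructions of the algorithm, and `for_loop` reduces a loop to its body together with a bound
on the size of its states. -/

theorem Val.one_le_size (v : Val) : 1 ≤ v.size := by
  cases v <;> simp [Val.size]

/-- Every elementary operation is charged for its argument and its result. Applied to the decoder,
this bounds the length of the decoded list, and hence the number of factorizations of an element. -/
theorem Prog.Runs.size_le {p : Prog} {x y : Val} {t : ℕ} (h : p.Runs x y t) :
    x.size ≤ t ∧ y.size ≤ t := by
  induction h with
  | atom a x => omega
  | seq _ _ h1 h2 => omega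
  | pair _ _ h1 h2 => simp only [Val.size]; omega
  | iteTrue _ _ _ h1 h2 => omega
  | iteFalse _ _ h1 h2 => omega
  | loopStop _ h1 => omega
  | loopStep _ _ _ _ h1 h2 h3 => omega

/-- Identifies the output chosen for the decoder as a function with the output whose correctness is
assumed. -/
theorem Prog.Runs.det {p : Prog} {x y y' : Val} {t t' : ℕ} (h : p.Runs x y t)
    (h' : p.Runs x y' t') : y = y' := by
  induction h generalizing y' t' with
  | atom a x => cases h'; rfl
  | seq _ _ ih1 ih2 => cases h' with | seq h1 h2 => cases ih1 h1; exact ih2 h2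
  | pair _ _ ih1 ih2 => cases h' with | pair h1 h2 => rw [ih1 h1, ih2 h2]
  | iteTrue _ hv _ ih1 ih2 =>
    cases h' with
    | iteTrue h1 hv' h2 => exact ih2 h2
    | iteFalse h1 h2 => exact absurd (ih1 h1) hv
  | iteFalse _ _ ih1 ih2 =>
    cases h' with
    | iteTrue h1 hv' h2 => exact absurd (ih1 h1).symm hv'
    | iteFalse h1 h2 => exact ih2 h2
  | loopStop _ ih1 =>
    cases h' with
    | loopStop h1 => rfl
    | loopStep h1 hv' h2 h3 => exact absurd (ih1 h1).symm hv'
  | loopStep _ hv _ _ ih1 ih2 ih3 =>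
    cases h' with
    | loopStop h1 => exact absurd (ih1 h1) hv
    | loopStep h1 hv' h2 h3 => cases ih2 h2; exact ih3 h3

theorem Prog.Runs.loop_iterate {c f : Prog} {T : ℕ} {s v : ℕ → Val} {A B : ℕ}
    (hc : ∀ j < T, v j ≠ .num 0 ∧ ∃ t ≤ A, c.Runs (s j) (v j) t)
    (hT : ∃ t ≤ A, c.Runs (s T) (.num 0) t)
    (hf : ∀ j < T, ∃ t ≤ B, f.Runs (s j) (s (j + 1)) t) :
    ∃ t ≤ T * (A + B) + A, (Prog.loop c f).Runs (s 0) (s T) t := by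
  induction T generalizing s v with
  | zero =>
    obtain ⟨t, ht, h⟩ := hT
    exact ⟨t, by omega, .loopStop h⟩
  | succ T ih =>
    obtain ⟨t, ht, h⟩ := ih (s := fun j => s (j + 1)) (v := fun j => v (j + 1))
      (fun j hj => hc (j + 1) (by omega)) hT (fun j hj => hf (j + 1) (by omega))
    obtain ⟨hv, t1, ht1, h1⟩ := hc 0 (by omega)
    obtain ⟨t2, ht2, h2⟩ := hf 0 (by omega)
    exact ⟨t1 + t2 + t, by rw [Nat.succ_mul]; omega, .loopStep h1 hv h2 h⟩

/-- One operation increases the size by at most a constant. Iterated operations may still grow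
exponentially, which is why `for_loop` asks for a bound on all its states. -/
theorem Atom.exists_size_apply_le (a : Atom) :
    ∃ m, ∀ v : Val, (a.apply v).size ≤ v.size + m := by
  have hbin : ∀ f : ℕ → ℕ → ℕ, (∀ a b, Nat.size (f a b) ≤ Nat.size a + Nat.size b + 1) →
      ∀ v : Val, (v.binop f).size ≤ v.size + 1 := by
    intro f hf v
    rcases v with _ | ⟨⟨a⟩ | _, ⟨b⟩ | _⟩ <;> simp only [Val.binop, Val.size, Nat.size_zero]
    · omega
    · have := hf a b; omega
    all_goals omega
  have hle : ∀ a b c : ℕ, c ≤ a → Nat.size c ≤ Nat.size a + Nat.size b + 1 := fun a b c h =>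
    (Nat.size_le_size h).trans (by omega)
  cases a with
  | id => exact ⟨0, fun v => by simp [Atom.apply]⟩
  | fst => exact ⟨1, fun v => by cases v <;> simp only [Atom.apply, Val.size, Nat.size_zero] <;> omega⟩
  | snd => exact ⟨1, fun v => by cases v <;> simp only [Atom.apply, Val.size, Nat.size_zero] <;> omega⟩
  | isPair =>
    exact ⟨2, fun v => by cases v <;> simp only [Atom.apply, Val.size, Nat.size_zero, Nat.size_one] <;> omega⟩
  | const n => exact ⟨Nat.size n + 1, fun v => by simp [Atom.apply, Val.size]⟩
  | add =>
    refine ⟨1, hbin _ fun a b => Nat.size_le.2 ?_⟩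
    have h1 := Nat.lt_size_self a
    have h2 := Nat.lt_size_self b
    have h3 : 2 ^ a.size ≤ 2 ^ (a.size + b.size) := Nat.pow_le_pow_right (by norm_num) (by omega)
    have h4 : 2 ^ b.size ≤ 2 ^ (a.size + b.size) := Nat.pow_le_pow_right (by norm_num) (by omega)
    rw [pow_succ]; omega
  | sub => exact ⟨1, hbin _ fun a b => hle _ _ _ (Nat.sub_le a b)⟩
  | mul =>
    refine ⟨1, hbin _ fun a b => (Nat.size_le.2 ?_).trans (Nat.le_succ _)⟩
    rw [pow_add]
    exact Nat.mul_lt_mul'' (Nat.lt_size_self a) (Nat.lt_size_self b)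
  | div => exact ⟨1, hbin _ fun a b => hle _ _ _ (Nat.div_le_self a b)⟩

/-! ## Polynomially bounded families -/

/-- The family of numbers `f` is bounded by a power of the parameter `q` (increased by `2`). -/
def PolyBdd {I : Type*} (q f : I → ℕ) : Prop := ∃ c, ∀ i, f i ≤ (q i + 2) ^ c

namespace PolyBdd

variable {I J : Type*} {q f g : I → ℕ}

theorem mono (hg : PolyBdd q g) (h : ∀ i, f i ≤ g i) : PolyBdd q f :=
  hg.imp fun _ hc i => (h i).trans (hc i)

theorem const (m : ℕ) : PolyBdd q fun _ => m :=
  ⟨m, fun i => (Nat.lt_two_pow_self).le.trans (Nat.pow_le_pow_left (by omega) m)⟩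

theorem param : PolyBdd q q := ⟨1, fun i => by rw [pow_one]; omega⟩

theorem mul (hf : PolyBdd q f) (hg : PolyBdd q g) : PolyBdd q fun i => f i * g i := by
  obtain ⟨a, ha⟩ := hf
  obtain ⟨b, hb⟩ := hg
  exact ⟨a + b, fun i => by rw [pow_add]; exact Nat.mul_le_mul (ha i) (hb i)⟩

theorem add (hf : PolyBdd q f) (hg : PolyBdd q g) : PolyBdd q fun i => f i + g i := by
  obtain ⟨a, ha⟩ := hf
  obtain ⟨b, hb⟩ := hg
  refine ⟨a + b + 1, fun i => ?_⟩
  have h1 : (q i + 2) ^ a ≤ (q i + 2) ^ (a + b) := Nat.pow_le_pow_right (by omega) (by omega)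
  have h2 : (q i + 2) ^ b ≤ (q i + 2) ^ (a + b) := Nat.pow_le_pow_right (by omega) (by omega)
  have h3 : (q i + 2) ^ (a + b) * 2 ≤ (q i + 2) ^ (a + b) * (q i + 2) :=
    Nat.mul_le_mul_left _ (by omega)
  have := ha i
  have := hb i
  rw [pow_succ]
  change f i + g i ≤ _
  omega

theorem pow (hf : PolyBdd q f) (m : ℕ) : PolyBdd q fun i => f i ^ m := by
  obtain ⟨a, ha⟩ := hf
  exact ⟨a * m, fun i => by rw [pow_mul]; exact Nat.pow_le_pow_left (ha i) m⟩

theorem reindex (hf : PolyBdd q f) (π : J → I) :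
    PolyBdd (fun j => q (π j)) (fun j => f (π j)) :=
  hf.imp fun _ hc j => hc (π j)

end PolyBdd

/-! ## Feasible families of values -/

/-- From the values `x i`, a single program computes the values `y i` in polynomial time. -/
def Comp {I : Type*} (q : I → ℕ) (x y : I → Val) : Prop :=
  ∃ (p : Prog) (t : I → ℕ), PolyBdd q t ∧ ∀ i, p.Runs (x i) (y i) (t i)

namespace Comp

variable {I J : Type*} {q : I → ℕ} {x y z : I → Val}

theorem of_exists_le {p : Prog} {b : I → ℕ} (hb : PolyBdd q b)
    (h : ∀ i, ∃ t ≤ b i, p.Runs (x i) (y i) t) : Comp q x y := by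
  choose t ht h using h
  exact ⟨p, t, hb.mono ht, h⟩

theorem bdd_left (h : Comp q x y) : PolyBdd q fun i => (x i).size := by
  obtain ⟨p, t, ht, h⟩ := h
  exact ht.mono fun i => (h i).size_le.1

theorem bdd (h : Comp q x y) : PolyBdd q fun i => (y i).size := by
  obtain ⟨p, t, ht, h⟩ := h
  exact ht.mono fun i => (h i).size_le.2

/-- The program does not depend on the index. A loop body is a family indexed by pairs of an
instance and a round, and facts about the instance are transported to it along `Sigma.fst`. -/
theorem reindex (h : Comp q x y) (π : J → I) :
    Comp (fun j => q (π j)) (fun j => x (π j)) (fun j => y (π j)) := by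
  obtain ⟨p, t, ht, h⟩ := h
  exact ⟨p, _, ht.reindex π, fun j => h (π j)⟩

theorem trans (h : Comp q x y) (h' : Comp q y z) : Comp q x z := by
  obtain ⟨p, t, ht, h⟩ := h
  obtain ⟨p', t', ht', h'⟩ := h'
  exact ⟨.seq p p', _, ht.add ht', fun i => .seq (h i) (h' i)⟩

theorem atom (a : Atom) (hx : PolyBdd q fun i => (x i).size) :
    Comp q x fun i => a.apply (x i) := by
  obtain ⟨m, hm⟩ := a.exists_size_apply_le
  exact ⟨.atom a, _, hx.add ((hx.add (.const m)).mono fun i => hm (x i)), fun i => .atom a (x i)⟩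

theorem refl (hx : PolyBdd q fun i => (x i).size) : Comp q x x := atom .id hx

theorem app (a : Atom) (h : Comp q x y) : Comp q x fun i => a.apply (y i) :=
  h.trans (atom a h.bdd)

theorem pair (h : Comp q x y) (h' : Comp q x z) : Comp q x fun i => .pair (y i) (z i) := by
  obtain ⟨p, t, ht, h⟩ := h
  obtain ⟨p', t', ht', h'⟩ := h'
  exact ⟨.pair p p', _, (ht.add ht').add (.const 1), fun i => .pair (h i) (h' i)⟩

theorem fst (h : Comp q x fun i => .pair (y i) (z i)) : Comp q x y := h.app .fst

theorem snd (h : Comp q x fun i => .pair (y i) (z i)) : Comp q x z := h.app .snd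

theorem congr (h : Comp q x y) (e : ∀ i, y i = z i) : Comp q x z := by
  obtain rfl : y = z := funext e
  exact h

theorem const (h : Comp q x y) (n : ℕ) : Comp q x fun _ => .num n := h.app (.const n)

variable {a b : I → ℕ}

theorem add (ha : Comp q x fun i => .num (a i)) (hb : Comp q x fun i => .num (b i)) :
    Comp q x fun i => .num (a i + b i) := (ha.pair hb).app .add

theorem sub (ha : Comp q x fun i => .num (a i)) (hb : Comp q x fun i => .num (b i)) :
    Comp q x fun i => .num (a i - b i) := (ha.pair hb).app .sub

theorem mul (ha : Comp q x fun i => .num (a i)) (hb : Comp q x fun i => .num (b i)) :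
    Comp q x fun i => .num (a i * b i) := (ha.pair hb).app .mul

theorem div (ha : Comp q x fun i => .num (a i)) (hb : Comp q x fun i => .num (b i)) :
    Comp q x fun i => .num (a i / b i) := (ha.pair hb).app .div

theorem mod (ha : Comp q x fun i => .num (a i)) (hb : Comp q x fun i => .num (b i)) :
    Comp q x fun i => .num (a i % b i) :=
  (ha.sub (hb.mul (ha.div hb))).congr fun i => by rw [Nat.mod_eq_sub]

theorem pow_const (ha : Comp q x fun i => .num (a i)) (m : ℕ) :
    Comp q x fun i => .num (a i ^ m) := by
  induction m with
  | zero => exact (ha.const 1).congr fun i => by rw [pow_zero]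
  | succ m ih => exact (ih.mul ha).congr fun i => by rw [pow_succ]

/-- Branching on a numerical test. -/
theorem branch {P : I → Prop} [∀ i, Decidable (P i)] (ha : Comp q x fun i => .num (a i))
    (hP : ∀ i, P i ↔ a i ≠ 0) (hy : Comp q x y) (hz : Comp q x z) :
    Comp q x fun i => if P i then y i else z i := by
  obtain ⟨p, t, ht, h⟩ := ha
  obtain ⟨p1, t1, ht1, h1⟩ := hy
  obtain ⟨p2, t2, ht2, h2⟩ := hz
  refine of_exists_le (p := .ite p p1 p2) ((ht.add ht1).add ht2) fun i => ?_
  by_cases hi : P i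
  · refine ⟨t i + t1 i, by omega, ?_⟩
    rw [if_pos hi]
    exact .iteTrue (h i) (by simpa using (hP i).1 hi) (h1 i)
  · refine ⟨t i + t2 i, by omega, ?_⟩
    rw [if_neg hi]
    have h0 : a i = 0 := by
      by_contra h0
      exact hi ((hP i).2 h0)
    exact .iteFalse (h0 ▸ h i) (h2 i)

end Comp

open Classical in
/-- The truth value of a proposition, as a number. -/
noncomputable def bit (P : Prop) : ℕ := if P then 1 else 0

theorem bit_ne_zero {P : Prop} : bit P ≠ 0 ↔ P := by
  unfold bit; split_ifs <;> simp [*]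

theorem bit_le_one (P : Prop) : bit P ≤ 1 := by unfold bit; split_ifs <;> simp

theorem eq_bit {P : Prop} {n : ℕ} (h1 : n ≤ 1) (h : n ≠ 0 ↔ P) : n = bit P := by
  unfold bit; split_ifs with hP
  · have := h.2 hP; omega
  · by_contra h0; exact hP (h.1 h0)

/-- `1` for pairs, `0` for numbers. -/
def Val.pairBit : Val → ℕ
  | .num _ => 0
  | .pair _ _ => 1

/-- The propositions `P i` are decided in polynomial time from the values `x i`. -/
def Decides {I : Type*} (q : I → ℕ) (x : I → Val) (P : I → Prop) : Prop :=
  Comp q x fun i => .num (bit (P i))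

/-! ### Tests and decisions. -/

namespace Comp

variable {I J : Type*} {q : I → ℕ} {x y z : I → Val} {P Q : I → Prop} {a b : I → ℕ}

theorem ite [∀ i, Decidable (P i)] (hP : Decides q x P) (hy : Comp q x y) (hz : Comp q x z) :
    Comp q x fun i => if P i then y i else z i :=
  branch hP (fun _ => bit_ne_zero.symm) hy hz

theorem decides (ha : Comp q x fun i => .num (a i)) (h : ∀ i, P i ↔ a i ≠ 0) : Decides q x P := by
  classical
  exact (branch ha h (ha.const 1) (ha.const 0)).congr fun i => by
    unfold bit; split_ifs <;> rfl

theorem lt (ha : Comp q x fun i => .num (a i)) (hb : Comp q x fun i => .num (b i)) :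
    Decides q x fun i => a i < b i :=
  (hb.sub ha).decides fun i => by omega

theorem eq (ha : Comp q x fun i => .num (a i)) (hb : Comp q x fun i => .num (b i)) :
    Decides q x fun i => a i = b i :=
  ((ha.const 1).sub ((ha.sub hb).add (hb.sub ha))).decides fun i => by omega

/-- Comparing an arbitrary value with a number. -/
theorem eq_num (hy : Comp q x y) (hb : Comp q x fun i => .num (b i)) :
    Decides q x fun i => y i = .num (b i) := by
  have h1 : Comp q x fun i => .num (y i).pairBit := (hy.app .isPair).congr fun i => by
    cases y i <;> rfl
  have h2 := (hb.const 1).sub h1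
  have h3 : Comp q x fun i =>
      Val.binop (· + ·) (.pair (Val.binop (· - ·) (.pair (y i) (.num (b i))))
        (Val.binop (· - ·) (.pair (.num (b i)) (y i)))) :=
    (((hy.pair hb).app .sub).pair ((hb.pair hy).app .sub)).app .add
  have h4 := (h2.pair (((hb.const 1).pair h3).app .sub)).app .mul
  refine h4.congr fun i => ?_
  cases hyi : y i with
  | pair u v => simp [Atom.apply, Val.binop, bit, Val.pairBit, hyi]
  | num n =>
    simp only [Atom.apply, Val.binop, Val.num.injEq, Val.pairBit, hyi, Nat.sub_zero, one_mul]
    exact eq_bit (by omega) (by omega)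

end Comp

namespace Decides

variable {I J : Type*} {q : I → ℕ} {x y z : I → Val} {P Q : I → Prop}

theorem congr (h : Decides q x P) (e : ∀ i, P i ↔ Q i) : Decides q x Q :=
  Comp.congr h fun i => by rw [propext (e i)]

theorem and (h : Decides q x P) (h' : Decides q x Q) : Decides q x fun i => P i ∧ Q i :=
  (Comp.mul h h').decides fun i => by
    rw [mul_ne_zero_iff, bit_ne_zero, bit_ne_zero]

theorem not (h : Decides q x P) : Decides q x fun i => ¬ P i :=
  (Comp.sub (Comp.const h 1) h).decides fun i => by
    have h1 := bit_le_one (P i)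
    have h2 := @bit_ne_zero (P i)
    constructor
    · intro hP h0
      exact hP (h2.1 (by omega))
    · intro h0 hP
      have := h2.2 hP
      omega

end Decides

/-! ## Loops -/

namespace Comp

variable {I J : Type*} {q : I → ℕ} {x y z : I → Val} {P Q : I → Prop} {a b : I → ℕ}

/-- The family of all rounds of a loop with `T i` rounds. -/
abbrev Rounds (T : I → ℕ) := (i : I) × Fin (T i)

theorem bdd_pair (hy : PolyBdd q fun i => (y i).size) (hz : PolyBdd q fun i => (z i).size) :
    PolyBdd q fun i => (Val.pair (y i) (z i)).size := (hy.add hz).add (.const 1)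

theorem size_num_le (n : ℕ) : (Val.num n).size ≤ n + 1 := by
  have : Nat.size n ≤ n := Nat.size_le.2 Nat.lt_two_pow_self
  simp only [Val.size]; omega

/-- Loops with a given number of rounds. -/
theorem for_loop {T : I → ℕ} {s : I → ℕ → Val} {B : I → ℕ}
    (hT : Comp q x fun i => .num (T i)) (hTb : PolyBdd q T)
    (hB : PolyBdd q B) (hs : ∀ i, ∀ j ≤ T i, (s i j).size ≤ B i)
    (h0 : Comp q x fun i => s i 0)
    (body : ∀ X : Rounds T → Val,
      Comp (fun j : Rounds T => q j.1) X (fun j => x j.1) →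
      Comp (fun j : Rounds T => q j.1) X (fun j => .num j.2) →
      Comp (fun j : Rounds T => q j.1) X (fun j => s j.1 j.2) →
      Comp (fun j : Rounds T => q j.1) X (fun j => s j.1 (j.2 + 1))) :
    Comp q x fun i => s i (T i) := by
  have hxb := hT.bdd_left
  -- The state of the loop: the fixed context and number of rounds, then the counter and the
  -- variable part. The hypothesis `body` is quantified over all contexts so that its users need not
  -- know this layout.
  let X : Rounds T → Val := fun j => .pair (.pair (x j.1) (.num (T j.1)))
    (.pair (.num j.2) (s j.1 j.2))
  have hX : PolyBdd (fun j : Rounds T => q j.1) fun j => (X j).size := by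
    refine bdd_pair (bdd_pair (hxb.reindex _) (hT.bdd.reindex _)) (bdd_pair ?_ ?_)
    · exact ((hTb.add (.const 1)).reindex _).mono fun j =>
        (size_num_le _).trans (Nat.add_le_add_right j.2.2.le 1)
    · exact (hB.reindex _).mono fun j => hs _ _ j.2.2.le
  have hXX := refl hX
  have hbody := body X hXX.fst.fst hXX.snd.fst hXX.snd.snd
  obtain ⟨f, tf, ⟨cf, htf⟩, hf⟩ :=
    hXX.fst.pair ((hXX.snd.fst.add (hXX.const 1)).pair hbody)
  -- The test runs once more than the body, so its family of states also contains the counter value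
  -- `T i`.
  let X' : Rounds (fun i => T i + 1) → Val := fun j => .pair (.pair (x j.1) (.num (T j.1)))
    (.pair (.num j.2) (s j.1 j.2))
  have hX' : PolyBdd (fun j : Rounds (fun i => T i + 1) => q j.1) fun j => (X' j).size := by
    refine bdd_pair (bdd_pair (hxb.reindex _) (hT.bdd.reindex _)) (bdd_pair ?_ ?_)
    · exact ((hTb.add (.const 1)).reindex _).mono fun j =>
        (size_num_le _).trans (Nat.add_le_add_right (Nat.lt_succ_iff.1 j.2.2) 1)
    · exact (hB.reindex _).mono fun j => hs _ _ (Nat.lt_succ_iff.1 j.2.2)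
  have hXX' := refl hX'
  obtain ⟨c, tc, ⟨cc, htc⟩, hc⟩ := hXX'.fst.snd.sub hXX'.snd.fst
  have hloop : Comp q
      (fun i => .pair (.pair (x i) (.num (T i))) (.pair (.num 0) (s i 0)))
      (fun i => .pair (.pair (x i) (.num (T i))) (.pair (.num (T i)) (s i (T i)))) := by
    refine of_exists_le (p := .loop c f)
      (b := fun i => T i * ((q i + 2) ^ cc + (q i + 2) ^ cf) + (q i + 2) ^ cc) ?_ fun i => ?_
    · have hp : ∀ m, PolyBdd q fun i => (q i + 2) ^ m := fun m => (PolyBdd.param.add (.const 2)).pow m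
      exact (hTb.mul ((hp _).add (hp _))).add (hp _)
    · refine Prog.Runs.loop_iterate (T := T i)
        (s := fun j => .pair (.pair (x i) (.num (T i))) (.pair (.num j) (s i j)))
        (v := fun j => .num (T i - j)) (fun j hj => ⟨?_, ?_⟩) ?_ (fun j hj => ?_)
      · simp only [ne_eq, Val.num.injEq]; omega
      · exact ⟨_, htc ⟨i, ⟨j, Nat.lt_succ_of_lt hj⟩⟩, hc ⟨i, ⟨j, Nat.lt_succ_of_lt hj⟩⟩⟩
      · have := hc ⟨i, ⟨T i, Nat.lt_succ_self _⟩⟩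
        simp only [Nat.sub_self] at this
        exact ⟨_, htc ⟨i, ⟨T i, Nat.lt_succ_self _⟩⟩, this⟩
      · exact ⟨_, htf ⟨i, ⟨j, hj⟩⟩, hf ⟨i, ⟨j, hj⟩⟩⟩
  exact ((((refl hxb).pair hT).pair ((hT.const 0).pair h0)).trans hloop).snd.snd

end Comp

/-! ## Lists and arrays -/

namespace Val

/-- The array with the entries `u 0, …, u (m - 1)`. -/
def arr {m : ℕ} (u : Fin m → Val) : Val := ofList (List.ofFn u)

/-- The value that remains after removing `k` entries from a list. -/
def rest (v : Val) (k : ℕ) : Val := (Atom.snd.apply)^[k] v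

/-- The entry with index `k` of a list. -/
def entry (v : Val) (k : ℕ) : Val := Atom.fst.apply (v.rest k)

theorem rest_succ (v : Val) (k : ℕ) : v.rest (k + 1) = Atom.snd.apply (v.rest k) :=
  Function.iterate_succ_apply' _ _ _

theorem size_rest_le (v : Val) (k : ℕ) : (v.rest k).size ≤ v.size := by
  induction k with
  | zero => exact le_rfl
  | succ k ih =>
    rw [rest_succ]
    refine le_trans ?_ ih
    cases v.rest k <;> simp only [Atom.apply, Val.size, Nat.size_zero] <;> omega

theorem rest_ofList (l : List Val) (k : ℕ) : (ofList l).rest k = ofList (l.drop k) := by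
  induction k with
  | zero => rfl
  | succ k ih =>
    rw [rest_succ, ih, ← List.tail_drop]
    cases l.drop k <;> rfl

theorem entry_ofList (l : List Val) (k : ℕ) (hk : k < l.length) : (ofList l).entry k = l[k] := by
  rw [entry, rest_ofList, List.drop_eq_getElem_cons hk]
  rfl

theorem entry_arr {m : ℕ} (u : Fin m → Val) (k : Fin m) : (arr u).entry k = u k := by
  rw [arr, entry_ofList _ _ (by simp)]
  simp

theorem length_lt_size_ofList (l : List Val) : l.length < (ofList l).size := by
  induction l with
  | nil => simp [ofList, size]
  | cons a l ih =>
    simp only [ofList, size, List.length_cons]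
    have := a.one_le_size
    omega

theorem size_ofList_le {l : List Val} {B : ℕ} (h : ∀ v ∈ l, v.size ≤ B) :
    (ofList l).size ≤ l.length * (B + 1) + 1 := by
  induction l with
  | nil => simp [ofList, size]
  | cons a l ih =>
    simp only [ofList, size, List.length_cons]
    have h1 := h a (by simp)
    have h2 := ih fun v hv => h v (by simp [hv])
    rw [Nat.succ_mul]
    omega

theorem size_arr_le {m : ℕ} {u : Fin m → Val} {B : ℕ} (h : ∀ j, (u j).size ≤ B) :
    (arr u).size ≤ m * (B + 1) + 1 := by
  have := size_ofList_le (l := List.ofFn u) (B := B) fun v hv => by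
    obtain ⟨j, rfl⟩ := (List.mem_ofFn' u v).1 hv
    exact h j
  rwa [List.length_ofFn] at this

theorem lt_size_arr {m : ℕ} (u : Fin m → Val) : m < (arr u).size := by
  have := length_lt_size_ofList (List.ofFn u)
  rwa [List.length_ofFn] at this

end Val

/-! ### Programs on lists and arrays. -/

namespace Comp

variable {I J : Type*} {q : I → ℕ} {x y z : I → Val} {P Q : I → Prop} {a b : I → ℕ}

/-- Passing to a context that extends the given one. -/
theorem up {π : J → I} {X : J → Val} (h : Comp q x y)
    (hX : Comp (fun j => q (π j)) X (fun j => x (π j))) :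
    Comp (fun j => q (π j)) X (fun j => y (π j)) := hX.trans (h.reindex π)

theorem rest (hy : Comp q x y) (ha : Comp q x fun i => .num (a i)) (hab : PolyBdd q a) :
    Comp q x fun i => (y i).rest (a i) :=
  for_loop (s := fun i j => (y i).rest j) ha hab hy.bdd (fun i j _ => (y i).size_rest_le j) hy
    fun _ _ _ hs => (hs.app .snd).congr fun j => ((y j.1).rest_succ j.2).symm

theorem entry (hy : Comp q x y) (ha : Comp q x fun i => .num (a i)) (hab : PolyBdd q a) :
    Comp q x fun i => (y i).entry (a i) := (hy.rest ha hab).app .fst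

theorem arr_get {m : I → ℕ} {u : ∀ i, Fin (m i) → Val} {j : ∀ i, Fin (m i)}
    (hu : Comp q x fun i => Val.arr (u i)) (hj : Comp q x fun i => .num (j i)) :
    Comp q x fun i => u i (j i) :=
  (hu.entry hj (hu.bdd.mono fun _ => ((j _).2.trans (Val.lt_size_arr _)).le)).congr fun _ =>
    Val.entry_arr _ _

theorem bdd_of_rounds {m : I → ℕ} {f : Rounds m → ℕ}
    (h : PolyBdd (fun j : Rounds m => q j.1) f) : ∃ B : I → ℕ, PolyBdd q B ∧ ∀ i j, f ⟨i, j⟩ ≤ B i := by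
  obtain ⟨c, hc⟩ := h
  exact ⟨fun i => (q i + 2) ^ c, ⟨c, fun _ => le_rfl⟩, fun i j => hc ⟨i, j⟩⟩

theorem canonical_round {m : I → ℕ} (hx : PolyBdd q fun i => (x i).size) (hm : PolyBdd q m) :
    ∃ X : Rounds m → Val, Comp (fun j : Rounds m => q j.1) X (fun j => x j.1) ∧
      Comp (fun j : Rounds m => q j.1) X (fun j => .num j.2) := by
  have hX : Comp (fun j : Rounds m => q j.1) (fun j : Rounds m => .pair (x j.1) (.num j.2))
      (fun j : Rounds m => .pair (x j.1) (.num j.2)) := by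
    refine refl (bdd_pair (hx.reindex _) ?_)
    exact ((hm.add (.const 1)).reindex _).mono fun j =>
        (size_num_le _).trans (Nat.add_le_add_right j.2.2.le 1)
  exact ⟨_, hX.fst, hX.snd⟩

/-- A list grows only at its front, so the array is built from its last entry backwards: round `j`
computes the entry `m - 1 - j`. -/
theorem arr_build {m : I → ℕ} {u : ∀ i, Fin (m i) → Val}
    (hm : Comp q x fun i => .num (m i)) (hmb : PolyBdd q m)
    (body : ∀ X : Rounds m → Val,
      Comp (fun j : Rounds m => q j.1) X (fun j => x j.1) →
      Comp (fun j : Rounds m => q j.1) X (fun j => .num j.2) →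
      Comp (fun j : Rounds m => q j.1) X (fun j => u j.1 j.2)) :
    Comp q x fun i => Val.arr (u i) := by
  obtain ⟨X, hX, hj⟩ := canonical_round hm.bdd_left hmb
  have hu := body X hX hj
  obtain ⟨B, hB, huB⟩ := bdd_of_rounds hu.bdd
  have := for_loop (q := q) (x := x) (s := fun i j => .ofList ((List.ofFn (u i)).drop (m i - j)))
    (B := fun i => m i * (B i + 1) + 1) hm hmb ((hmb.mul (hB.add (.const 1))).add (.const 1))
    (fun i j hj => ?_) ((hm.const 0).congr fun i => ?_) fun Y hY hjY hs => ?_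
  · exact this.congr fun i => by simp [Val.arr]
  · refine (Val.size_ofList_le (B := B i) fun v hv => ?_).trans ?_
    · obtain ⟨j, rfl⟩ := (List.mem_ofFn' _ v).1 (List.mem_of_mem_drop hv)
      exact huB i j
    · gcongr
      simp
  · rw [Nat.sub_zero, List.drop_eq_nil_of_le (by simp)]
    rfl
  · have h1 : Comp (fun j : Rounds m => q j.1) Y
        fun j => .num ((⟨m j.1 - 1 - j.2, by omega⟩ : Fin (m j.1)) : ℕ) :=
      (((hm.up (π := Sigma.fst) hY).sub (hY.const 1)).sub hjY)
    have h2 : Comp (fun j : Rounds m => q j.1) Y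
        fun j => u j.1 ⟨m j.1 - 1 - j.2, by omega⟩ := by
      refine (hY.pair h1).trans ?_
      -- One program computes the entries at all indices, so it may be run at the mirrored index.
      obtain ⟨p, t, ht, h⟩ := body (fun j => .pair (x j.1) (.num j.2))
        (refl (bdd_pair (hm.bdd_left.reindex _) (hj.bdd))).fst
        (refl (bdd_pair (hm.bdd_left.reindex _) (hj.bdd))).snd
      exact ⟨p, _, ht.reindex (fun j : Rounds m => (⟨j.1, ⟨m j.1 - 1 - j.2, by omega⟩⟩ : Rounds m)),
        fun j => h ⟨j.1, ⟨m j.1 - 1 - j.2, by omega⟩⟩⟩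
    refine (h2.pair hs).congr fun j => ?_
    obtain ⟨i, j⟩ := j
    have hj := j.2
    have e1 : m i - j = (m i - (j + 1)) + 1 := by omega
    simp only
    rw [List.drop_eq_getElem_cons (i := m i - (j + 1)) (by simp; omega), List.getElem_ofFn, ← e1]
    simp only [Val.ofList, Nat.sub_sub, Nat.add_comm 1]

theorem decides_forall {m : I → ℕ} {P : ∀ i, Fin (m i) → Prop}
    (hm : Comp q x fun i => .num (m i)) (hmb : PolyBdd q m)
    (body : ∀ X : Rounds m → Val,
      Comp (fun j : Rounds m => q j.1) X (fun j => x j.1) →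
      Comp (fun j : Rounds m => q j.1) X (fun j => .num j.2) →
      Decides (fun j : Rounds m => q j.1) X (fun j => P j.1 j.2)) :
    Decides q x fun i => ∀ j, P i j := by
  have := for_loop (q := q) (x := x)
    (s := fun i k => .num (bit (∀ j : Fin (m i), j < k → P i j)))
    (B := fun i => 2) hm hmb (.const 2)
    (fun _ j hj => ?_) ((hm.const 1).congr fun i => ?_) fun Y hY hjY hs => ?_
  · exact Decides.congr this fun i => ⟨fun h j => h j j.2, fun h j _ => h j⟩
  · exact (size_num_le _).trans (Nat.succ_le_succ (bit_le_one _))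
  · simp [bit]
  · refine (Decides.and (P := fun j : Rounds m => ∀ j' : Fin (m j.1), j' < (j.2 : ℕ) → P j.1 j') hs
      (body Y hY hjY)).congr fun j => ⟨fun h j' hj' => ?_, fun h => ⟨fun j' hj' => ?_, ?_⟩⟩
    · rcases Nat.lt_succ_iff_lt_or_eq.1 hj' with h1 | h1
      · exact h.1 j' h1
      · rw [Fin.ext h1]; exact h.2
    · exact h j' (Nat.lt_succ_of_lt hj')
    · exact h j.2 (Nat.lt_succ_self _)

theorem find {m : I → ℕ} {u : ∀ i, Fin (m i)}
    (hm : Comp q x fun i => .num (m i)) (hmb : PolyBdd q m)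
    (body : ∀ X : Rounds m → Val,
      Comp (fun j : Rounds m => q j.1) X (fun j => x j.1) →
      Comp (fun j : Rounds m => q j.1) X (fun j => .num j.2) →
      Decides (fun j : Rounds m => q j.1) X (fun j => j.2 = u j.1)) :
    Comp q x fun i => .num (u i) := by
  have := for_loop (q := q) (x := x)
    (s := fun i k => .num (if u i < k then u i else 0))
    (B := fun i => m i + 1) hm hmb (hmb.add (.const 1))
    (fun i j hj => ?_) ((hm.const 0).congr fun i => ?_) fun Y hY hjY hs => ?_
  · exact this.congr fun i => by rw [if_pos (u i).2]
  · refine (size_num_le _).trans (Nat.succ_le_succ ?_)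
    split_ifs
    · exact (u i).2.le
    · exact Nat.zero_le _
  · simp
  · classical
    refine (ite (body Y hY hjY) hjY hs).congr fun j => ?_
    by_cases h : j.2 = u j.1
    · rw [if_pos h, if_pos (by rw [h]; exact Nat.lt_succ_self _), h]
    · rw [if_neg h]
      have h' : (j.2 : ℕ) ≠ u j.1 := fun h' => h (Fin.ext h')
      congr 1
      split_ifs <;> first | rfl | omega

/-! ### Arithmetic of large numbers -/

/-- Numbers of polynomial size as bounds for loops. -/
theorem poly_num (hq : Comp q x fun i => .num (q i)) (c : ℕ) :
    Comp q x fun i => .num ((q i + 2) ^ c) := (hq.add (hq.const 2)).pow_const c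

theorem bdd_pow (c : ℕ) : PolyBdd q fun i => (q i + 2) ^ c := ⟨c, fun _ => le_rfl⟩

theorem lt_two_pow_size (n : ℕ) : n < 2 ^ (Val.num n).size :=
  (Nat.lt_size_self n).trans_le (Nat.pow_le_pow_right (by norm_num) (Nat.le_succ _))

/-- Powers with an exponent of polynomial size. -/
theorem pow_num (ha : Comp q x fun i => .num (a i)) (hb : Comp q x fun i => .num (b i))
    (hbb : PolyBdd q b) : Comp q x fun i => .num (a i ^ b i) := by
  refine for_loop (s := fun i k => .num (a i ^ k)) hb hbb
    (B := fun i => (Val.num (a i)).size * b i + 2)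
    ((ha.bdd.mul hbb).add (.const 2)) (fun i j hj => ?_) ((ha.const 1).congr fun i => by simp)
    fun X hX hj hs => (hs.mul (ha.up (π := Sigma.fst) hX)).congr fun j => by rw [pow_succ]
  have h1 : a i ^ j ≤ (2 ^ (Val.num (a i)).size) ^ b i :=
    (Nat.pow_le_pow_left (lt_two_pow_size _).le j).trans
      (Nat.pow_le_pow_right (by positivity) hj)
  rw [← pow_mul] at h1
  have h2 : Nat.size (a i ^ j) ≤ (Val.num (a i)).size * b i + 1 :=
    Nat.size_le.2 (h1.trans_lt (Nat.pow_lt_pow_right (by norm_num) (Nat.lt_succ_self _)))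
  simp only [Val.size] at h2 ⊢
  omega

/-- The length of a list. -/
theorem length {l : I → List Val} (hl : Comp q x fun i => .ofList (l i))
    (hq : Comp q x fun i => .num (q i)) : Comp q x fun i => .num (l i).length := by
  have hlen : PolyBdd q fun i => (l i).length :=
    hl.bdd.mono fun i => (Val.length_lt_size_ofList (l i)).le
  obtain ⟨c, hc⟩ := hlen
  -- The loop runs for a polynomial bound on the length. Each round adds the `isPair` bit of the
  -- remaining list, which is `0` once the list is exhausted.
  have hT := poly_num hq c
  have := for_loop (q := q) (x := x) (s := fun i k => .num (min k (l i).length)) hT (bdd_pow c)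
    (B := fun i => (q i + 2) ^ c + 1) ((bdd_pow c).add (.const 1))
    (fun i j hj => (size_num_le _).trans (Nat.succ_le_succ ((min_le_left _ _).trans hj)))
    ((hq.const 0).congr fun i => by simp) fun X hX hj hs => ?_
  · exact this.congr fun i => by rw [min_eq_right (hc i)]
  · have h1 := ((hl.up (π := Sigma.fst) hX).rest hj
      (((bdd_pow c).reindex _).mono fun j => j.2.2.le)).app .isPair
    have h2 : Comp (fun j : Rounds (fun i => (q i + 2) ^ c) => q j.1) X fun j =>
        .num (((Val.ofList (l j.1)).rest j.2).pairBit) := h1.congr fun j => by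
      cases (Val.ofList (l j.1)).rest j.2 <;> rfl
    refine (hs.add h2).congr fun j => ?_
    rw [Val.rest_ofList]
    rcases lt_or_ge (j.2 : ℕ) (l j.1).length with h | h
    · rw [List.drop_eq_getElem_cons h]
      simp only [Val.ofList, Val.pairBit, min_eq_left h.le, min_eq_left (Nat.succ_le_of_lt h)]
    · rw [List.drop_eq_nil_of_le h]
      simp only [Val.ofList, Val.pairBit, min_eq_right h, min_eq_right (h.trans (Nat.le_succ _))]
      rfl

/-- Folding a list. -/
theorem foldl {α β : I → Type*} {eα : ∀ i, α i → Val} {eβ : ∀ i, β i → Val}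
    {l : ∀ i, List (α i)} {f : ∀ i, β i → α i → β i} {b₀ : ∀ i, β i} {B : I → ℕ}
    (hl : Comp q x fun i => .ofList ((l i).map (eα i))) (h0 : Comp q x fun i => eβ i (b₀ i))
    (hq : Comp q x fun i => .num (q i)) (hB : PolyBdd q B)
    (hs : ∀ i k, (eβ i (((l i).take k).foldl (f i) (b₀ i))).size ≤ B i)
    (body : ∀ X : Rounds (fun i => (l i).length) → Val,
      Comp (fun j : Rounds (fun i => (l i).length) => q j.1) X (fun j => x j.1) →
      Comp (fun j : Rounds (fun i => (l i).length) => q j.1) X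
        (fun j => eβ j.1 (((l j.1).take j.2).foldl (f j.1) (b₀ j.1))) →
      Comp (fun j : Rounds (fun i => (l i).length) => q j.1) X (fun j => eα j.1 (l j.1)[j.2]) →
      Comp (fun j : Rounds (fun i => (l i).length) => q j.1) X
        (fun j => eβ j.1 (f j.1 (((l j.1).take j.2).foldl (f j.1) (b₀ j.1)) (l j.1)[j.2]))) :
    Comp q x fun i => eβ i ((l i).foldl (f i) (b₀ i)) := by
  have hlen : PolyBdd q fun i => (l i).length := hl.bdd.mono fun i => by
    have := Val.length_lt_size_ofList ((l i).map (eα i))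
    rw [List.length_map] at this
    exact this.le
  have hlen' : Comp q x fun i => .num (l i).length :=
    (length hl hq).congr fun i => by rw [List.length_map]
  have := for_loop (q := q) (x := x)
    (s := fun i k => eβ i (((l i).take k).foldl (f i) (b₀ i))) hlen' hlen hB (fun i k _ => hs i k)
    h0 fun X hX hj hs' => ?_
  · exact this.congr fun i => by rw [List.take_length]
  · have h1 := (hl.up (π := Sigma.fst) hX).entry hj (((hlen).reindex _).mono fun j => j.2.2.le)
    have h2 : Comp (fun j : Rounds (fun i => (l i).length) => q j.1) X
        (fun j => eα j.1 (l j.1)[j.2]) := h1.congr fun j => by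
      rw [Val.entry_ofList _ _ (by simp)]
      simp
    refine (body X hX hs' h2).congr fun j => ?_
    rw [List.take_succ_eq_append_getElem j.2.2, List.foldl_append]
    rfl

end Comp

/-! ## Arithmetic in the field of a code -/

namespace Comp

universe u
variable {I : Type u} {x : I → Val} {C : I → RSCode}

/-- Vectors of field elements. -/
theorem _root_.RSDlog.RSCode.vec_eq_arr (C : RSCode) {m : ℕ} (w : Fin m → C.F) :
    C.vec w = Val.arr fun j => C.elem (w j) := rfl

theorem _root_.RSDlog.RSCode.size_elem_le (C : RSCode) (a : C.F) : (C.elem a).size ≤ C.q :=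
  (size_num_le _).trans (C.label a).2

theorem _root_.RSDlog.RSCode.size_vec_le (C : RSCode) {m : ℕ} (w : Fin m → C.F) :
    (C.vec w).size ≤ m * (C.q + 1) + 1 :=
  Val.size_arr_le fun j => C.size_elem_le (w j)

/-- The code is known in the context `x`. -/
abbrev KnowsCode (C : I → RSCode) (x : I → Val) : Prop :=
  Comp (fun i => (C i).q) x fun i => (C i).enc

section

variable (hC : KnowsCode C x)

include hC

theorem code_q : Comp (fun i => (C i).q) x fun i => .num (C i).q := hC.fst

theorem code_k : Comp (fun i => (C i).q) x fun i => .num (C i).k := hC.snd.snd.snd.snd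

theorem code_points : Comp (fun i => (C i).q) x fun i => (C i).vec (C i).point :=
  hC.snd.snd.snd.fst

end

theorem table_get {op : ∀ i, (C i).F → (C i).F → (C i).F} {a b : ∀ i, (C i).F}
    (hop : Comp (fun i => (C i).q) x fun i => (C i).table (op i))
    (ha : Comp (fun i => (C i).q) x fun i => (C i).elem (a i))
    (hb : Comp (fun i => (C i).q) x fun i => (C i).elem (b i)) :
    Comp (fun i => (C i).q) x fun i => (C i).elem (op i (a i) (b i)) := by
  have h1 := arr_get (u := fun i (j : Fin (C i).q) =>
    (C i).vec fun j' : Fin (C i).q => op i ((C i).label.symm j) ((C i).label.symm j'))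
    (j := fun i => (C i).label (a i)) hop ha
  have h2 := arr_get (u := fun i (j' : Fin (C i).q) =>
    (C i).elem (op i ((C i).label.symm ((C i).label (a i))) ((C i).label.symm j')))
    (j := fun i => (C i).label (b i)) h1 hb
  exact h2.congr fun i => by simp

/-- A field element is found by testing all elements. -/
theorem elem_find {a : ∀ i, (C i).F} (hC : KnowsCode C x)
    (body : ∀ (X : (i : I) × (C i).F → Val),
      Comp (fun j : (i : I) × (C i).F => (C j.1).q) X (fun j => x j.1) →
      Comp (fun j : (i : I) × (C i).F => (C j.1).q) X (fun j => (C j.1).elem j.2) →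
      Decides (fun j : (i : I) × (C i).F => (C j.1).q) X (fun j => j.2 = a j.1)) :
    Comp (fun i => (C i).q) x fun i => (C i).elem (a i) := by
  have hX : Comp (fun j : (i : I) × (C i).F => (C j.1).q)
      (fun j => .pair (x j.1) ((C j.1).elem j.2)) (fun j => .pair (x j.1) ((C j.1).elem j.2)) :=
    refl (bdd_pair (hC.bdd_left.reindex Sigma.fst) (PolyBdd.param.mono fun j => (C j.1).size_elem_le j.2))
  have h := body _ hX.fst hX.snd
  refine find (u := fun i => (C i).label (a i)) (code_q hC) .param fun X hXx hj => ?_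
  have h1 : Decides (fun j : Rounds (fun i => (C i).q) => (C j.1).q)
      (fun j => .pair (x j.1) (.num j.2)) (fun j => (C j.1).label.symm j.2 = a j.1) := by
    obtain ⟨p, t, ht, h⟩ := h
    let π : Rounds (fun i => (C i).q) → (i : I) × (C i).F := fun j => ⟨j.1, (C j.1).label.symm j.2⟩
    refine ⟨p, _, ht.reindex π, fun j => ?_⟩
    have e : (C j.1).elem ((C j.1).label.symm j.2) = .num j.2 := by simp [RSCode.elem]
    have := h (π j)
    simp only [π, e] at this
    exact this
  exact Decides.congr ((hXx.pair hj).trans h1) fun j => by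
    rw [Equiv.symm_apply_eq]

theorem elem_eq {a b : ∀ i, (C i).F}
    (ha : Comp (fun i => (C i).q) x fun i => (C i).elem (a i))
    (hb : Comp (fun i => (C i).q) x fun i => (C i).elem (b i)) :
    Decides (fun i => (C i).q) x fun i => a i = b i :=
  Decides.congr (ha.eq hb) fun i => by
    rw [Fin.val_inj, (C i).label.injective.eq_iff]

section

variable {a b : ∀ i, (C i).F} (hC : KnowsCode C x)
  (ha : Comp (fun i => (C i).q) x fun i => (C i).elem (a i))
  (hb : Comp (fun i => (C i).q) x fun i => (C i).elem (b i))

include hC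

/-- The labels of `0` and `1` are not part of the input. They are recognised as the solution of `z +
z = z` and the nonzero solution of `z * z = z`. -/
theorem elem_zero : Comp (fun i => (C i).q) x fun i => (C i).elem 0 :=
  elem_find hC fun X hX ha =>
    (elem_eq (table_get (hC.snd.fst.up (π := Sigma.fst) hX) ha ha) ha).congr fun j => by simp

theorem elem_one : Comp (fun i => (C i).q) x fun i => (C i).elem 1 :=
  elem_find hC fun X hX ha =>
    ((elem_eq (table_get (hC.snd.snd.fst.up (π := Sigma.fst) hX) ha ha) ha).and
      (elem_eq ha (elem_zero (hC.up (π := Sigma.fst) hX))).not).congr fun j => by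
        constructor
        · rintro ⟨h1, h2⟩
          exact mul_left_cancel₀ h2 (by rw [h1, mul_one])
        · intro h
          simp [h]

include ha

theorem elem_add (hb : Comp (fun i => (C i).q) x fun i => (C i).elem (b i)) :
    Comp (fun i => (C i).q) x fun i => (C i).elem (a i + b i) :=
  table_get hC.snd.fst ha hb

theorem elem_mul (hb : Comp (fun i => (C i).q) x fun i => (C i).elem (b i)) :
    Comp (fun i => (C i).q) x fun i => (C i).elem (a i * b i) :=
  table_get hC.snd.snd.fst ha hb

theorem elem_neg : Comp (fun i => (C i).q) x fun i => (C i).elem (-a i) :=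
  elem_find hC fun X hX hz =>
    (elem_eq (elem_add (hC.up (π := Sigma.fst) hX) (ha.up (π := Sigma.fst) hX) hz)
      (elem_zero (hC.up (π := Sigma.fst) hX))).congr fun j => by
        rw [add_eq_zero_iff_neg_eq, eq_comm]

theorem elem_sub (hb : Comp (fun i => (C i).q) x fun i => (C i).elem (b i)) :
    Comp (fun i => (C i).q) x fun i => (C i).elem (a i - b i) :=
  (elem_add hC ha (elem_neg hC hb)).congr fun i => by rw [sub_eq_add_neg]

theorem elem_inv : Comp (fun i => (C i).q) x fun i => (C i).elem (a i)⁻¹ := by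
  classical
  have h0 : Comp (fun i => (C i).q) x fun i => (C i).elem (a i) := ha
  refine elem_find hC fun X hX hz => ?_
  have hC' := hC.up (π := Sigma.fst) hX
  have ha' := ha.up (π := Sigma.fst) hX
  -- `z` is the inverse of `a` if `a z a = a` and `z a z = z`
  refine ((elem_eq (elem_mul hC' (elem_mul hC' ha' hz) ha') ha').and
    (elem_eq (elem_mul hC' (elem_mul hC' hz ha') hz) hz)).congr fun j => ?_
  by_cases h : a j.1 = 0
  · simp [h, eq_comm]
  · constructor
    · rintro ⟨h1, -⟩
      have : a j.1 * j.2 = 1 := mul_right_cancel₀ h (by rw [h1, one_mul])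
      exact eq_inv_of_mul_eq_one_right this
    · intro h1
      rw [h1]
      simp [h]

theorem elem_div (hb : Comp (fun i => (C i).q) x fun i => (C i).elem (b i)) :
    Comp (fun i => (C i).q) x fun i => (C i).elem (a i / b i) :=
  (elem_mul hC ha (elem_inv hC hb)).congr fun i => by rw [div_eq_mul_inv]

theorem elem_pow {e : I → ℕ} (he : Comp (fun i => (C i).q) x fun i => .num (e i))
    (heb : PolyBdd (fun i => (C i).q) e) :
    Comp (fun i => (C i).q) x fun i => (C i).elem (a i ^ e i) :=
  for_loop (s := fun i k => (C i).elem (a i ^ k)) he heb .param (fun i j _ => (C i).size_elem_le _)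
    ((elem_one hC).congr fun i => by simp) fun X hX _ hs =>
      (elem_mul (hC.up (π := Sigma.fst) hX) hs (ha.up (π := Sigma.fst) hX)).congr fun j => by
        rw [pow_succ]

end

/-- Finite sums of field elements. -/
theorem elem_sum {m : I → ℕ} {u : ∀ i, Fin (m i) → (C i).F} (hC : KnowsCode C x)
    (hm : Comp (fun i => (C i).q) x fun i => .num (m i)) (hmb : PolyBdd (fun i => (C i).q) m)
    (body : ∀ X : Rounds m → Val,
      Comp (fun j : Rounds m => (C j.1).q) X (fun j => x j.1) →
      Comp (fun j : Rounds m => (C j.1).q) X (fun j => .num j.2) →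
      Comp (fun j : Rounds m => (C j.1).q) X (fun j => (C j.1).elem (u j.1 j.2))) :
    Comp (fun i => (C i).q) x fun i => (C i).elem (∑ j, u i j) := by
  classical
  have := for_loop (q := fun i => (C i).q) (x := x)
    (s := fun i k => (C i).elem (∑ j : Fin (m i), if j < k then u i j else 0)) hm hmb .param
    (fun i j _ => (C i).size_elem_le _) ((elem_zero hC).congr fun i => by simp)
    fun X hX hj hs => (elem_add (hC.up (π := Sigma.fst) hX) hs (body X hX hj)).congr fun j => ?_
  · exact this.congr fun i => by simp
  · congr 1
    have h : ∀ j' : Fin (m j.1), (if (j' : ℕ) < (j.2 : ℕ) + 1 then u j.1 j' else 0) =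
        (if (j' : ℕ) < (j.2 : ℕ) then u j.1 j' else 0) + (if j' = j.2 then u j.1 j' else 0) := by
      intro j'
      rcases lt_trichotomy (j' : ℕ) (j.2 : ℕ) with h | h | h
      · simp [h, h.trans (Nat.lt_succ_self _), (Fin.lt_def.2 h).ne]
      · obtain rfl : j' = j.2 := Fin.ext h
        simp
      · have h1 : ¬ (j' : ℕ) < (j.2 : ℕ) + 1 := by omega
        simp [h.not_gt, h1, (Fin.lt_def.2 h).ne']
    rw [Finset.sum_congr rfl fun j' _ => h j', Finset.sum_add_distrib]
    simp

end Comp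

/-! ## Arithmetic in the extension field -/

namespace RSCode

variable (C : RSCode)

noncomputable instance : Fintype C.F := Fintype.ofEquiv _ C.label.symm

theorem card_F : Fintype.card C.F = C.q := by
  rw [Fintype.card_congr C.label, Fintype.card_fin]

theorem two_le_q : 2 ≤ C.q := by
  rw [← C.card_F]
  exact Fintype.one_lt_card

theorem n_le_q : C.n ≤ C.q := by
  have := Fintype.card_le_of_embedding C.point
  rwa [Fintype.card_fin, C.card_F] at this

/-- The set that defines `ĝ` contains `n`, because `C(n, n) = 1 < q ^ (n - k)`; so the infimum is
attained. -/
theorem gHat_spec : (C.n.choose C.gHat : ℚ) / (C.q : ℚ) ^ ((C.gHat : ℤ) - (C.k : ℤ)) < 1 ∧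
    C.gHat ≤ C.n := by
  have hn : C.n ∈ {g : ℕ | (C.n.choose g : ℚ) / (C.q : ℚ) ^ ((g : ℤ) - (C.k : ℤ)) < 1} := by
    have h1 : (1 : ℚ) < C.q := by exact_mod_cast C.two_le_q
    have h2 := C.k_lt
    have h3 : (1 : ℚ) < (C.q : ℚ) ^ ((C.n : ℤ) - (C.k : ℤ)) := one_lt_zpow₀ h1 (by omega)
    simp only [Set.mem_ofPred_eq, Nat.choose_self, Nat.cast_one]
    rw [div_lt_one (by linarith)]
    exact h3
  exact ⟨Nat.sInf_mem ⟨_, hn⟩, Nat.sInf_le hn⟩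

end RSCode

namespace DLInst

variable {C : RSCode} (D : DLInst C)

/-- The field in which discrete logarithms are taken. -/
abbrev K : Type := AdjoinRoot D.h

instance : Fact (Irreducible D.h) := ⟨D.irreducible⟩

/-- The degree of the field extension. -/
noncomputable abbrev deg : ℕ := D.h.natDegree

theorem deg_pos : 0 < D.deg := D.irreducible.natDegree_pos

theorem deg_le_q : D.deg ≤ C.q := by
  have h1 := D.natDegree_h
  have h2 := C.gHat_spec.2
  have h3 := C.n_le_q
  simp only [deg]
  omega

/-- The reduced representative of an element of the extension field. -/
noncomputable def rep (z : D.K) : C.F[X] := AdjoinRoot.modByMonicHom D.monic z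

theorem mk_rep (z : D.K) : AdjoinRoot.mk D.h (D.rep z) = z :=
  AdjoinRoot.mk_leftInverse D.monic z

theorem rep_mk {p : C.F[X]} (hp : p.degree < D.h.degree) : D.rep (AdjoinRoot.mk D.h p) = p := by
  rw [rep, AdjoinRoot.modByMonicHom_mk, (Polynomial.modByMonic_eq_self_iff D.monic).2 hp]

theorem degree_rep_lt (z : D.K) : (D.rep z).degree < D.h.degree := by
  obtain ⟨p, rfl⟩ := AdjoinRoot.mk_surjective z
  rw [rep, AdjoinRoot.modByMonicHom_mk]
  exact Polynomial.degree_modByMonic_lt p D.monic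

theorem rep_injective : Function.Injective D.rep := fun z w h => by
  rw [← D.mk_rep z, h, D.mk_rep]

theorem natDegree_rep_lt (z : D.K) : (D.rep z).natDegree < D.deg :=
  natDegree_lt_natDegree_of_degree_lt D (D.degree_rep_lt z)
where
  natDegree_lt_natDegree_of_degree_lt (D : DLInst C) {p : C.F[X]} (h : p.degree < D.h.degree) :
      p.natDegree < D.deg := by
    by_cases hp : p = 0
    · rw [hp, natDegree_zero]; exact D.deg_pos
    · exact natDegree_lt_natDegree hp h

theorem degree_lt_of_natDegree_lt {p : C.F[X]} (h : p.natDegree < D.deg) :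
    p.degree < D.h.degree := by
  rw [degree_eq_natDegree D.monic.ne_zero]
  exact degree_le_natDegree.trans_lt (by exact_mod_cast h)

/-- An element of the extension field, written as the coefficient vector of its reduced
representative. -/
noncomputable def encK (z : D.K) : Val := C.vec fun j : Fin D.deg => (D.rep z).coeff j

theorem size_encK_le (z : D.K) : (D.encK z).size ≤ C.q * (C.q + 1) + 1 :=
  (C.size_vec_le _).trans (by have := D.deg_le_q; gcongr)

theorem eq_iff_coeff {z w : D.K} :
    z = w ↔ ∀ j : Fin D.deg, (D.rep z).coeff j = (D.rep w).coeff j := by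
  refine ⟨fun h j => by rw [h], fun h => D.rep_injective (Polynomial.ext fun j => ?_)⟩
  rcases lt_or_ge j D.deg with hj | hj
  · exact h ⟨j, hj⟩
  · rw [coeff_eq_zero_of_natDegree_lt ((D.natDegree_rep_lt z).trans_le hj),
      coeff_eq_zero_of_natDegree_lt ((D.natDegree_rep_lt w).trans_le hj)]

theorem rep_add (z w : D.K) : D.rep (z + w) = D.rep z + D.rep w := by
  rw [rep, map_add]; rfl

theorem rep_sub (z w : D.K) : D.rep (z - w) = D.rep z - D.rep w := by
  rw [rep, map_sub]; rfl

theorem rep_of_mul (a : C.F) (z : D.K) :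
    D.rep (AdjoinRoot.of D.h a * z) = Polynomial.C a * D.rep z := by
  conv_lhs => rw [← D.mk_rep z, ← AdjoinRoot.mk_C, ← map_mul]
  refine D.rep_mk (lt_of_le_of_lt ?_ (D.degree_rep_lt z))
  exact (degree_mul_le _ _).trans (by
    simpa using add_le_add_left (degree_C_le (a := a)) (D.rep z).degree)

theorem rep_one : D.rep 1 = 1 := by
  rw [← map_one (AdjoinRoot.mk D.h)]
  refine D.rep_mk (D.degree_lt_of_natDegree_lt ?_)
  rw [natDegree_one]
  exact D.deg_pos

/-- Multiplication by `x` produces at most a term of degree `deg h`, and one subtraction of a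
multiple of the monic `h` removes it. -/
theorem rep_root_mul (z : D.K) : D.rep (AdjoinRoot.root D.h * z) =
    X * D.rep z - Polynomial.C ((D.rep z).coeff (D.deg - 1)) * D.h := by
  have h1 := D.deg_pos
  have h2 : AdjoinRoot.mk D.h (X * D.rep z - Polynomial.C ((D.rep z).coeff (D.deg - 1)) * D.h) =
      AdjoinRoot.root D.h * z := by
    rw [map_sub, map_mul, map_mul, AdjoinRoot.mk_self, mul_zero, sub_zero, AdjoinRoot.mk_X, D.mk_rep]
  rw [← h2]
  refine D.rep_mk ?_
  rw [degree_eq_natDegree D.monic.ne_zero, degree_lt_iff_coeff_zero]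
  intro m hm
  rcases eq_or_lt_of_le hm with rfl | hm
  · rw [coeff_sub, coeff_C_mul, coeff_natDegree, D.monic.leadingCoeff, mul_one]
    obtain ⟨d, hd⟩ : ∃ d, D.deg = d + 1 := ⟨D.deg - 1, by omega⟩
    have hd' : D.h.natDegree = d + 1 := hd
    rw [hd', coeff_X_mul, hd, Nat.add_sub_cancel, sub_self]
  · obtain ⟨m, rfl⟩ : ∃ m', m = m' + 1 := ⟨m - 1, by omega⟩
    have := D.natDegree_rep_lt z
    rw [coeff_sub, coeff_C_mul, coeff_X_mul,
      coeff_eq_zero_of_natDegree_lt (show (D.rep z).natDegree < m by simp only [deg] at this; omega),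
      coeff_eq_zero_of_natDegree_lt hm, mul_zero, sub_zero]

theorem sum_coeff_mul_root_pow (z : D.K) :
    ∑ j ∈ Finset.range D.deg, AdjoinRoot.of D.h ((D.rep z).coeff j) * AdjoinRoot.root D.h ^ j = z := by
  conv_rhs => rw [← D.mk_rep z, (D.rep z).as_sum_range' D.deg (D.natDegree_rep_lt z)]
  rw [map_sum]
  refine Finset.sum_congr rfl fun j _ => ?_
  rw [← C_mul_X_pow_eq_monomial, map_mul, map_pow, AdjoinRoot.mk_C, AdjoinRoot.mk_X]

end DLInst

/-! ### Programs for the extension field. -/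

namespace Comp

universe u
variable {I : Type u} {x : I → Val} {C : I → RSCode} {D : ∀ i, DLInst (C i)}

/-- The code and the extension field are known in the context `x`. -/
structure KnowsExt (C : I → RSCode) (D : ∀ i, DLInst (C i)) (x : I → Val) : Prop where
  code : KnowsCode C x
  deg : Comp (fun i => (C i).q) x fun i => .num (D i).deg
  modulus : Comp (fun i => (C i).q) x fun i =>
    (C i).vec fun j : Fin ((D i).deg + 1) => (D i).h.coeff j

theorem KnowsExt.up {J : Type*} {π : J → I} {X : J → Val} (hD : KnowsExt C D x)
    (hX : Comp (fun j => (C (π j)).q) X (fun j => x (π j))) :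
    KnowsExt (fun j => C (π j)) (fun j => D (π j)) X :=
  ⟨Comp.up (π := π) hD.code hX, hD.deg.up (π := π) hX, hD.modulus.up (π := π) hX⟩

section

variable (hD : KnowsExt C D x) {z w : ∀ i, (D i).K} {a : ∀ i, (C i).F}

theorem bdd_deg : PolyBdd (fun i => (C i).q) fun i => (D i).deg :=
  PolyBdd.param.mono fun i => (D i).deg_le_q

theorem bdd_encK : PolyBdd (fun i => (C i).q) fun i => (C i).q * ((C i).q + 1) + 1 :=
  (PolyBdd.param.mul (PolyBdd.param.add (.const 1))).add (.const 1)

/-- The coefficients of the reduced representative. -/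
theorem ext_coeff (hz : Comp (fun i => (C i).q) x fun i => (D i).encK (z i))
    {j : I → ℕ} (hj : Comp (fun i => (C i).q) x fun i => .num (j i)) (hlt : ∀ i, j i < (D i).deg) :
    Comp (fun i => (C i).q) x fun i => (C i).elem (((D i).rep (z i)).coeff (j i)) :=
  arr_get (u := fun i (j : Fin (D i).deg) => (C i).elem (((D i).rep (z i)).coeff j))
    (j := fun i => ⟨j i, hlt i⟩) hz hj

theorem modulus_coeff (hD : KnowsExt C D x)
    {j : I → ℕ} (hj : Comp (fun i => (C i).q) x fun i => .num (j i)) (hlt : ∀ i, j i < (D i).deg + 1) :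
    Comp (fun i => (C i).q) x fun i => (C i).elem ((D i).h.coeff (j i)) :=
  arr_get (u := fun i (j : Fin ((D i).deg + 1)) => (C i).elem ((D i).h.coeff j))
    (j := fun i => ⟨j i, hlt i⟩) hD.modulus hj

include hD

theorem ext_build
    (body : ∀ X : Rounds (fun i => (D i).deg) → Val,
      Comp (fun j : Rounds (fun i => (D i).deg) => (C j.1).q) X (fun j => x j.1) →
      Comp (fun j : Rounds (fun i => (D i).deg) => (C j.1).q) X (fun j => .num j.2) →
      Comp (fun j : Rounds (fun i => (D i).deg) => (C j.1).q) X
        (fun j => (C j.1).elem (((D j.1).rep (z j.1)).coeff j.2))) :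
    Comp (fun i => (C i).q) x fun i => (D i).encK (z i) :=
  arr_build (u := fun i (j : Fin (D i).deg) => (C i).elem (((D i).rep (z i)).coeff j))
    hD.deg bdd_deg body

theorem ext_eq (hz : Comp (fun i => (C i).q) x fun i => (D i).encK (z i))
    (hw : Comp (fun i => (C i).q) x fun i => (D i).encK (w i)) :
    Decides (fun i => (C i).q) x fun i => z i = w i :=
  (decides_forall (P := fun i (j : Fin (D i).deg) =>
    ((D i).rep (z i)).coeff j = ((D i).rep (w i)).coeff j) hD.deg bdd_deg fun _ hX hj =>
      elem_eq (ext_coeff (hz.up (π := Sigma.fst) hX) hj fun j => j.2.2)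
        (ext_coeff (hw.up (π := Sigma.fst) hX) hj fun j => j.2.2)).congr
    fun i => (D i).eq_iff_coeff.symm

theorem ext_one : Comp (fun i => (C i).q) x fun i => (D i).encK 1 := by
  classical
  refine ext_build hD fun X hX hj => ?_
  have hC := (hD.up (π := Sigma.fst) hX).code
  refine (ite (hj.eq (hj.const 0)) (elem_one hC) (elem_zero hC)).congr fun j => ?_
  rw [DLInst.rep_one, coeff_one]
  split_ifs <;> rfl

theorem ext_zero : Comp (fun i => (C i).q) x fun i => (D i).encK 0 := by
  refine ext_build hD fun X hX hj => (elem_zero (hD.up (π := Sigma.fst) hX).code).congr fun j => ?_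
  simp [DLInst.rep]

theorem ext_add (hz : Comp (fun i => (C i).q) x fun i => (D i).encK (z i))
    (hw : Comp (fun i => (C i).q) x fun i => (D i).encK (w i)) :
    Comp (fun i => (C i).q) x fun i => (D i).encK (z i + w i) :=
  ext_build hD fun X hX hj => (elem_add (hD.up (π := Sigma.fst) hX).code
    (ext_coeff (hz.up (π := Sigma.fst) hX) hj fun j => j.2.2)
    (ext_coeff (hw.up (π := Sigma.fst) hX) hj fun j => j.2.2)).congr
      fun j => by rw [DLInst.rep_add, coeff_add]

theorem ext_sub (hz : Comp (fun i => (C i).q) x fun i => (D i).encK (z i))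
    (hw : Comp (fun i => (C i).q) x fun i => (D i).encK (w i)) :
    Comp (fun i => (C i).q) x fun i => (D i).encK (z i - w i) :=
  ext_build hD fun X hX hj => (elem_sub (hD.up (π := Sigma.fst) hX).code
    (ext_coeff (hz.up (π := Sigma.fst) hX) hj fun j => j.2.2)
    (ext_coeff (hw.up (π := Sigma.fst) hX) hj fun j => j.2.2)).congr
      fun j => by rw [DLInst.rep_sub, coeff_sub]

theorem ext_of_mul (ha : Comp (fun i => (C i).q) x fun i => (C i).elem (a i))
    (hz : Comp (fun i => (C i).q) x fun i => (D i).encK (z i)) :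
    Comp (fun i => (C i).q) x fun i => (D i).encK (AdjoinRoot.of (D i).h (a i) * z i) :=
  ext_build hD fun _ hX hj => (elem_mul (hD.up (π := Sigma.fst) hX).code (ha.up (π := Sigma.fst) hX)
    (ext_coeff (hz.up (π := Sigma.fst) hX) hj fun j => j.2.2)).congr
      fun j => by rw [DLInst.rep_of_mul, coeff_C_mul]

theorem ext_root_mul (hz : Comp (fun i => (C i).q) x fun i => (D i).encK (z i)) :
    Comp (fun i => (C i).q) x fun i => (D i).encK (AdjoinRoot.root (D i).h * z i) := by
  classical
  refine ext_build hD fun X hX hj => ?_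
  have hD' := hD.up (π := Sigma.fst) hX
  have hz' := hz.up (π := Sigma.fst) hX
  have hpred : Comp (fun j : Rounds (fun i => (D i).deg) => (C j.1).q) X
      fun j => .num ((j.2 : ℕ) - 1) := hj.sub (hj.const 1)
  have hlast : Comp (fun j : Rounds (fun i => (D i).deg) => (C j.1).q) X
      fun j => .num ((D j.1).deg - 1) := hD'.deg.sub (hj.const 1)
  have h1 := ite (hj.eq (hj.const 0)) (elem_zero hD'.code)
    (ext_coeff hz' hpred fun j => (Nat.sub_le _ _).trans_lt j.2.2)
  have h2 := ext_coeff hz' hlast fun j => Nat.sub_lt (D j.1).deg_pos one_pos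
  have h3 := modulus_coeff hD' hj fun j => j.2.2.trans (Nat.lt_succ_self _)
  have h1' : Comp (fun j : Rounds (fun i => (D i).deg) => (C j.1).q) X
      fun j => (C j.1).elem (if (j.2 : ℕ) = 0 then 0 else ((D j.1).rep (z j.1)).coeff ((j.2 : ℕ) - 1)) :=
    h1.congr fun j => by split_ifs <;> rfl
  refine (elem_sub hD'.code h1' (elem_mul hD'.code h2 h3)).congr fun j => ?_
  rw [DLInst.rep_root_mul, coeff_sub, coeff_C_mul]
  congr 2
  rcases hj0 : (j.2 : ℕ) with _ | m
  · simp
  · simp [coeff_X_mul]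

/-- The loop carries `α ^ k * w` and the partial sum of the `z_j * α ^ j * w`, so only
multiplications by `α` and by scalars occur. -/
theorem ext_mul (hz : Comp (fun i => (C i).q) x fun i => (D i).encK (z i))
    (hw : Comp (fun i => (C i).q) x fun i => (D i).encK (w i)) :
    Comp (fun i => (C i).q) x fun i => (D i).encK (z i * w i) := by
  have := for_loop (q := fun i => (C i).q) (x := x)
    (s := fun i k => .pair ((D i).encK (AdjoinRoot.root (D i).h ^ k * w i))
      ((D i).encK (∑ j ∈ Finset.range k, AdjoinRoot.of (D i).h (((D i).rep (z i)).coeff j) *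
        (AdjoinRoot.root (D i).h ^ j * w i)))) hD.deg bdd_deg
    ((bdd_encK.add bdd_encK).add (.const 1))
    (fun i j _ => Nat.succ_le_succ (add_le_add ((D i).size_encK_le _) ((D i).size_encK_le _)))
    ((hw.pair (ext_zero hD)).congr fun i => by simp) fun X hX hj hs => ?_
  · exact this.snd.congr fun i => by
      conv_rhs => rw [← (D i).sum_coeff_mul_root_pow (z i), Finset.sum_mul]
      simp only [mul_assoc]
  · have hD' := hD.up (π := Sigma.fst) hX
    have hz' := hz.up (π := Sigma.fst) hX
    refine ((ext_root_mul hD' hs.fst).pair (ext_add hD' hs.snd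
      (ext_of_mul hD' (ext_coeff hz' hj fun j => j.2.2) hs.fst))).congr fun j => ?_
    rw [Finset.sum_range_succ, pow_succ', mul_assoc]

/-- Powers with exponents of exponential size. -/
theorem ext_pow (hz : Comp (fun i => (C i).q) x fun i => (D i).encK (z i)) {e : I → ℕ}
    (he : Comp (fun i => (C i).q) x fun i => .num (e i)) :
    Comp (fun i => (C i).q) x fun i => (D i).encK (z i ^ e i) := by
  classical
  obtain ⟨c, hc⟩ := he.bdd
  have hT := poly_num (code_q hD.code) c
  have he' : ∀ i, e i < 2 ^ ((C i).q + 2) ^ c := fun i =>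
    (lt_two_pow_size _).trans_le (Nat.pow_le_pow_right (by norm_num) (hc i))
  -- Square and multiply from the top bit: with `T` a polynomial bound on the bit length, the
  -- exponent after `k` rounds is `e / 2 ^ (T - k)`.
  have := for_loop (q := fun i => (C i).q) (x := x)
    (s := fun i k => (D i).encK (z i ^ (e i / 2 ^ (((C i).q + 2) ^ c - k)))) hT (bdd_pow c)
    bdd_encK (fun i j _ => (D i).size_encK_le _)
    ((ext_one hD).congr fun i => by
      rw [Nat.sub_zero, Nat.div_eq_of_lt (he' i), pow_zero]) fun X hX hj hs => ?_
  · exact this.congr fun i => by rw [Nat.sub_self, pow_zero, Nat.div_one]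
  · have hD' := hD.up (π := Sigma.fst) hX
    have hz' := hz.up (π := Sigma.fst) hX
    have hT' := hT.up (π := Sigma.fst) hX
    have h1 := ((he.up (π := Sigma.fst) hX).div ((hT'.const 2).pow_num
      ((hT'.sub hj).sub (hT'.const 1)) (((bdd_pow c).reindex _).mono fun j => by
        exact (Nat.sub_le _ _).trans (Nat.sub_le _ _)))).mod (hT'.const 2)
    refine (ext_mul hD' (ext_mul hD' hs hs)
      (branch h1 (P := fun j => _ ≠ 0) (fun j => Iff.rfl) hz' (ext_one hD') |>.congr
        (z := fun j => (D j.1).encK (if e j.1 / 2 ^ (((C j.1).q + 2) ^ c - j.2 - 1) % 2 ≠ 0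
          then z j.1 else 1)) fun j => by split_ifs <;> rfl)).congr fun j => ?_
    obtain ⟨i, j⟩ := j
    have hj : (j : ℕ) < ((C i).q + 2) ^ c := j.2
    have e1 : ((C i).q + 2) ^ c - j = (((C i).q + 2) ^ c - (j + 1)) + 1 := by omega
    simp only [Nat.sub_sub]
    rw [e1, pow_succ, ← Nat.div_div_eq_div_mul]
    generalize e i / 2 ^ (((C i).q + 2) ^ c - (↑j + 1)) = m
    rw [← pow_add, ← two_mul]
    congr 1
    conv_rhs => rw [← Nat.div_add_mod m 2]
    rcases Nat.mod_two_eq_zero_or_one m with h | h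
    · simp [h]
    · simp [h, pow_succ]

/-- The value of the reduced representative at a point. -/
theorem eval_rep (hz : Comp (fun i => (C i).q) x fun i => (D i).encK (z i))
    (ha : Comp (fun i => (C i).q) x fun i => (C i).elem (a i)) :
    Comp (fun i => (C i).q) x fun i => (C i).elem (((D i).rep (z i)).eval (a i)) :=
  (elem_sum (u := fun i (j : Fin (D i).deg) => ((D i).rep (z i)).coeff j * a i ^ (j : ℕ))
    hD.code hD.deg bdd_deg fun X hX hj =>
      elem_mul (hD.up (π := Sigma.fst) hX).code
        (ext_coeff (hz.up (π := Sigma.fst) hX) hj fun j => j.2.2)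
        (elem_pow (hD.up (π := Sigma.fst) hX).code (ha.up (π := Sigma.fst) hX) hj
          ((bdd_deg.reindex _).mono fun j => j.2.2.le))).congr fun i => by
    rw [eval_eq_sum_range' ((D i).natDegree_rep_lt (z i)), Finset.sum_range]

/-- The value of the modulus at a point. -/
theorem eval_modulus (ha : Comp (fun i => (C i).q) x fun i => (C i).elem (a i)) :
    Comp (fun i => (C i).q) x fun i => (C i).elem ((D i).h.eval (a i)) :=
  (elem_sum (u := fun i (j : Fin ((D i).deg + 1)) => (D i).h.coeff j * a i ^ (j : ℕ))
    hD.code (hD.deg.add (hD.deg.const 1)) (bdd_deg.add (.const 1)) fun X hX hj =>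
      elem_mul (hD.up (π := Sigma.fst) hX).code
        (modulus_coeff (hD.up (π := Sigma.fst) hX) hj fun j => j.2.2)
        (elem_pow (hD.up (π := Sigma.fst) hX).code (ha.up (π := Sigma.fst) hX) hj
          (((bdd_deg.add (.const 1)).reindex _).mono fun j => j.2.2.le))).congr fun i => by
    rw [eval_eq_sum_range, Finset.sum_range]

end

end Comp

/-! ## Elimination by Euclid's algorithm -/

section Euclid

variable {R : Type*} [AddCommGroup R]

/-- One division step of Euclid's algorithm on two numbers, with the same row operation on two
elements of a group. -/
def euclidStep (s : (ℕ × R) × (ℕ × R)) : (ℕ × R) × (ℕ × R) :=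
  if s.2.1 = 0 then s else (s.2, (s.1.1 % s.2.1, s.1.2 - (s.1.1 / s.2.1) • s.2.2))

/-- Euclid's algorithm for numbers below `2 ^ L`. -/
def euclid (L : ℕ) (s : (ℕ × R) × (ℕ × R)) : (ℕ × R) × (ℕ × R) := euclidStep^[2 * L] s

theorem euclidStep_heads_le {s : (ℕ × R) × (ℕ × R)} {M : ℕ} (h1 : s.1.1 ≤ M) (h2 : s.2.1 ≤ M) :
    (euclidStep s).1.1 ≤ M ∧ (euclidStep s).2.1 ≤ M := by
  unfold euclidStep
  split_ifs with h
  · exact ⟨h1, h2⟩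
  · exact ⟨h2, (Nat.mod_le _ _).trans h1⟩

theorem iterate_euclidStep_heads_le {s : (ℕ × R) × (ℕ × R)} {M : ℕ} (h1 : s.1.1 ≤ M)
    (h2 : s.2.1 ≤ M) (k : ℕ) : (euclidStep^[k] s).1.1 ≤ M ∧ (euclidStep^[k] s).2.1 ≤ M := by
  induction k with
  | zero => exact ⟨h1, h2⟩
  | succ k ih =>
    rw [Function.iterate_succ_apply']
    exact euclidStep_heads_le ih.1 ih.2

theorem euclidStep_of_eq_zero {s : (ℕ × R) × (ℕ × R)} (h : s.2.1 = 0) : euclidStep s = s := by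
  rw [euclidStep, if_pos h]

/-- Two steps at least halve the second head `b`: if `r = a % b` is nonzero, then `r < b`, so `b ≥ r
+ b % r > 2 * (b % r)`. Once the second head is `0`, nothing changes any more. -/
theorem euclid_snd_fst (L : ℕ) (s : (ℕ × R) × (ℕ × R)) (h : s.2.1 < 2 ^ L) :
    (euclid L s).2.1 = 0 := by
  unfold euclid
  induction L generalizing s with
  | zero =>
    have : s.2.1 = 0 := by simpa using h
    exact this
  | succ L ih =>
    have e : 2 * (L + 1) = 2 * L + 1 + 1 := by ring
    rw [e, Function.iterate_succ_apply, Function.iterate_succ_apply]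
    apply ih
    by_cases h0 : s.2.1 = 0
    · rw [euclidStep_of_eq_zero h0, euclidStep_of_eq_zero h0, h0]
      positivity
    · have e1 : euclidStep s = (s.2, (s.1.1 % s.2.1, s.1.2 - (s.1.1 / s.2.1) • s.2.2)) := if_neg h0
      by_cases h1 : s.1.1 % s.2.1 = 0
      · rw [e1, euclidStep_of_eq_zero h1, h1]
        positivity
      · rw [e1, euclidStep, if_neg h1]
        change s.2.1 % (s.1.1 % s.2.1) < 2 ^ L
        have h2 : s.1.1 % s.2.1 < s.2.1 := Nat.mod_lt _ (Nat.pos_of_ne_zero h0)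
        have h3 := Nat.mod_lt s.2.1 (Nat.pos_of_ne_zero h1)
        have h4 := Nat.div_add_mod s.2.1 (s.1.1 % s.2.1)
        have h5 : 1 ≤ s.2.1 / (s.1.1 % s.2.1) := Nat.div_pos h2.le (Nat.pos_of_ne_zero h1)
        have h6 : s.1.1 % s.2.1 ≤ (s.1.1 % s.2.1) * (s.2.1 / (s.1.1 % s.2.1)) :=
          Nat.le_mul_of_pos_right _ h5
        rw [pow_succ] at h
        omega

/-- A property of pairs that division steps preserve holds after Euclid's algorithm. -/
theorem euclid_induction {p : (ℕ × R) × (ℕ × R) → Prop} (hp : ∀ s, p s → p (euclidStep s)) (L : ℕ)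
    {s : (ℕ × R) × (ℕ × R)} (hs : p s) : p (euclid L s) := by
  unfold euclid
  induction 2 * L with
  | zero => exact hs
  | succ k ih => rw [Function.iterate_succ_apply']; exact hp _ ih

theorem euclid_fst_fst (L : ℕ) (s : (ℕ × R) × (ℕ × R)) (h : s.2.1 < 2 ^ L) :
    (euclid L s).1.1 = Nat.gcd s.1.1 s.2.1 := by
  have h1 := euclid_induction (p := fun s' => Nat.gcd s'.1.1 s'.2.1 = Nat.gcd s.1.1 s.2.1)
    (fun s' h' => by
      rw [← h', euclidStep]
      split_ifs
      · rfl
      · exact (Nat.gcd_comm _ _).trans ((Nat.gcd_rec _ _).symm.trans (Nat.gcd_comm _ _))) L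
    (s := s) rfl
  rw [euclid_snd_fst L s h, Nat.gcd_zero_right] at h1
  exact h1

theorem euclid_mem (H : AddSubgroup R) (L : ℕ) {s : (ℕ × R) × (ℕ × R)} (h1 : s.1.2 ∈ H)
    (h2 : s.2.2 ∈ H) : (euclid L s).1.2 ∈ H ∧ (euclid L s).2.2 ∈ H := by
  refine euclid_induction (p := fun s => s.1.2 ∈ H ∧ s.2.2 ∈ H) (fun s h => ?_) L ⟨h1, h2⟩
  rw [euclidStep]
  split_ifs
  · exact h
  · exact ⟨h.2, H.sub_mem h.1 (H.nsmul_mem h.2 _)⟩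

/-- A head is a natural number representing the value of `φ` on its row. A division step treats head
and row alike, since `a % b = a - (a / b) * b` survives the cast. -/
theorem euclid_map {S : Type*} [Ring S] (φ : R →+ S) (L : ℕ) {s : (ℕ × R) × (ℕ × R)}
    (h1 : φ s.1.2 = s.1.1) (h2 : φ s.2.2 = s.2.1) :
    φ (euclid L s).1.2 = (euclid L s).1.1 ∧ φ (euclid L s).2.2 = (euclid L s).2.1 := by
  refine euclid_induction (p := fun s => φ s.1.2 = s.1.1 ∧ φ s.2.2 = s.2.1) (fun s h => ?_) L ⟨h1, h2⟩
  rw [euclidStep]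
  split_ifs
  · exact h
  · refine ⟨h.2, ?_⟩
    simp only [map_sub, map_nsmul, h.1, h.2, nsmul_eq_mul]
    rw [sub_eq_iff_eq_add, ← Nat.cast_mul, ← Nat.cast_add, Nat.mod_add_div']

/-- Adding group elements to the two rows. -/
def shift (s : (ℕ × R) × (ℕ × R)) (d e : R) : (ℕ × R) × (ℕ × R) :=
  ((s.1.1, s.1.2 + d), (s.2.1, s.2.2 + e))

/-- The steps are invertible integral row operations determined by the heads alone. So a prescribed
shift of the result can be pulled back, with the same preimage for all rows `A`, `B`. -/
theorem exists_iterate_shift (W : AddSubgroup R) (k a b : ℕ) {d' e' : R} (hd : d' ∈ W) (he : e' ∈ W) :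
    ∃ d ∈ W, ∃ e ∈ W, ∀ A B : R,
      euclidStep^[k] (shift ((a, A), (b, B)) d e) = shift (euclidStep^[k] ((a, A), (b, B))) d' e' := by
  induction k generalizing a b with
  | zero => exact ⟨d', hd, e', he, fun A B => rfl⟩
  | succ k ih =>
    by_cases hb : b = 0
    · obtain ⟨d, hd, e, he, h⟩ := ih a b
      refine ⟨d, hd, e, he, fun A B => ?_⟩
      rw [Function.iterate_succ_apply, Function.iterate_succ_apply, euclidStep_of_eq_zero hb,
        euclidStep_of_eq_zero hb, h]
    · obtain ⟨d, hd, e, he, h⟩ := ih b (a % b)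
      -- The preimage of the shift `(d, e)` under the step `(A, B) ↦ (B, A - (a / b) • B)`.
      refine ⟨e + (a / b) • d, W.add_mem he (W.nsmul_mem hd _), d, hd, fun A B => ?_⟩
      rw [Function.iterate_succ_apply, Function.iterate_succ_apply]
      have e1 : euclidStep ((a, A), (b, B)) = ((b, B), (a % b, A - (a / b) • B)) := if_neg hb
      have e2 : euclidStep (shift ((a, A), (b, B)) (e + (a / b) • d) d) =
          shift ((b, B), (a % b, A - (a / b) • B)) d e := by
        refine (if_neg hb).trans ?_
        simp only [shift, Prod.mk.injEq, true_and]
        rw [smul_add]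
        abel
      rw [e1, e2, h]

theorem iterate_congr (W : AddSubgroup R) (k a b : ℕ) {A B A' B' : R} (hA : A' - A ∈ W)
    (hB : B' - B ∈ W) :
    ∃ d ∈ W, ∃ e ∈ W, euclidStep^[k] ((a, A'), (b, B')) =
      shift (euclidStep^[k] ((a, A), (b, B))) d e := by
  induction k generalizing a b A B A' B' with
  | zero => exact ⟨_, hA, _, hB, by simp [shift]⟩
  | succ k ih =>
    rw [Function.iterate_succ_apply, Function.iterate_succ_apply]
    by_cases hb : b = 0
    · rw [euclidStep_of_eq_zero hb, euclidStep_of_eq_zero hb]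
      exact ih _ _ hA hB
    · rw [euclidStep, if_neg hb, euclidStep, if_neg hb]
      refine ih _ _ hB ?_
      have : A' - (a / b) • B' - (A - (a / b) • B) = (A' - A) - (a / b) • (B' - B) := by
        rw [smul_sub]; abel
      simp only [this]
      exact W.sub_mem hA (W.nsmul_mem hB _)

end Euclid

/-! ### Clearing a column, and its compatibility with shifts by a subgroup. -/

section Eliminate

variable {R : Type*} [AddCommGroup R] (L : ℕ) (hd : R → ℕ)

/-- Euclid's algorithm on two rows with prescribed heads: the first row gets the greatest common
divisor as its head, the second row the head `0`. -/
def reducePair (A B : R) : R × R :=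
  ((euclid L ((hd A, A), (hd B, B))).1.2, (euclid L ((hd A, A), (hd B, B))).2.2)

/-- Clearing the heads of all rows of a list by means of one further row `A`. -/
def sweep : R → List R → List R
  | _, [] => []
  | A, B :: rs => (reducePair L hd A B).2 :: sweep (reducePair L hd A B).1 rs

/-- Clearing the heads of all rows but one, which is dropped. -/
def elimCol : List R → List R
  | [] => []
  | A :: rs => (sweep L hd A rs).reverse

/-- The program folds over the list and pushes results at the front; this is the reason for the
`reverse` in `elimCol`. -/
theorem foldl_sweep (A : R) (rs outs : List R) :
    (rs.foldl (fun (s : R × List R) B =>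
      ((reducePair L hd s.1 B).1, (reducePair L hd s.1 B).2 :: s.2)) (A, outs)).2 =
      (sweep L hd A rs).reverse ++ outs := by
  induction rs generalizing A outs with
  | nil => rfl
  | cons B rs ih => rw [List.foldl_cons, ih, sweep, List.reverse_cons, List.append_assoc]; rfl

theorem length_sweep (A : R) (rs : List R) : (sweep L hd A rs).length = rs.length := by
  induction rs generalizing A with
  | nil => rfl
  | cons B rs ih => rw [sweep, List.length_cons, ih, List.length_cons]

theorem length_elimCol (rs : List R) : (elimCol L hd rs).length = rs.length - 1 := by
  cases rs with
  | nil => rfl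
  | cons A rs => rw [elimCol, List.length_reverse, length_sweep]; rfl

theorem sweep_mem (H : AddSubgroup R) {A : R} (hA : A ∈ H) {rs : List R} (h : ∀ B ∈ rs, B ∈ H) :
    ∀ B ∈ sweep L hd A rs, B ∈ H := by
  induction rs generalizing A with
  | nil => simp [sweep]
  | cons B rs ih =>
    have hB := h B (by simp)
    have h2 := euclid_mem H L (s := ((hd A, A), (hd B, B))) hA hB
    intro B' hB'
    rw [sweep, List.mem_cons] at hB'
    rcases hB' with rfl | hB'
    · exact h2.2
    · exact ih h2.1 (fun B hB => h B (by simp [hB])) B' hB'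

theorem elimCol_mem (H : AddSubgroup R) {rs : List R} (h : ∀ B ∈ rs, B ∈ H) :
    ∀ B ∈ elimCol L hd rs, B ∈ H := by
  cases rs with
  | nil => simp [elimCol]
  | cons A rs =>
    intro B hB
    rw [elimCol, List.mem_reverse] at hB
    exact sweep_mem L hd H (h A (by simp)) (fun B hB => h B (by simp [hB])) B hB

theorem elimCol_head {S : Type*} [Ring S] (φ : R →+ S) (hφ : ∀ v, φ v = hd v)
    (hL : ∀ v, hd v < 2 ^ L) (rs : List R) : ∀ B ∈ elimCol L hd rs, φ B = 0 := by
  have key : ∀ (rs : List R) (A : R), ∀ B ∈ sweep L hd A rs, φ B = 0 := by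
    intro rs
    induction rs with
    | nil => simp [sweep]
    | cons B rs ih =>
      intro A B' hB'
      rw [sweep, List.mem_cons] at hB'
      rcases hB' with rfl | hB'
      · have := (euclid_map φ L (s := ((hd A, A), (hd B, B))) (hφ A) (hφ B)).2
        rw [reducePair, this, euclid_snd_fst L _ (hL B), Nat.cast_zero]
      · exact ih _ B' hB'
  cases rs with
  | nil => simp [elimCol]
  | cons A rs =>
    intro B hB
    rw [elimCol, List.mem_reverse] at hB
    exact key rs A B hB

/-- Two lists of rows agree modulo the subgroup `W`. -/
def CongrMod (W : AddSubgroup R) (l l' : List R) : Prop := List.Forall₂ (fun a b => b - a ∈ W) l l'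

/-- A list of elements of the subgroup `W`, as long as `l`. -/
def ShiftFor (W : AddSubgroup R) (l d : List R) : Prop := d.length = l.length ∧ ∀ v ∈ d, v ∈ W

/-- The transformation `f` of lists can undo shifts: every shift of the result for lists congruent
to `l` is achieved by a shift of these lists. -/
def Shiftable (W : AddSubgroup R) (f : List R → List R) (l : List R) : Prop :=
  (∀ l', CongrMod W l l' → CongrMod W (f l) (f l')) ∧
  ∀ d', ShiftFor W (f l) d' → ∃ d, ShiftFor W l d ∧
    ∀ l', CongrMod W l l' → f (List.zipWith (· + ·) l' d) = List.zipWith (· + ·) (f l') d'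

theorem CongrMod.length_eq {W : AddSubgroup R} {l l' : List R} (h : CongrMod W l l') :
    l.length = l'.length := List.Forall₂.length_eq h

theorem Shiftable.comp {W : AddSubgroup R} {f g : List R → List R} {l : List R}
    (hf : Shiftable W f l) (hg : Shiftable W g (f l)) : Shiftable W (fun l => g (f l)) l := by
  refine ⟨fun l' h => hg.1 _ (hf.1 _ h), fun d'' hd'' => ?_⟩
  obtain ⟨d', hd', h1⟩ := hg.2 d'' hd''
  obtain ⟨d, hd, h2⟩ := hf.2 d' hd'
  exact ⟨d, hd, fun l' h => by
    simp only [h2 l' h, h1 _ (hf.1 _ h)]⟩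

theorem Shiftable.id {W : AddSubgroup R} {l : List R} : Shiftable W (fun l => l) l :=
  ⟨fun _ h => h, fun d' hd' => ⟨d', hd', fun _ _ => rfl⟩⟩

variable {L hd} {W : AddSubgroup R} (hW : ∀ v, ∀ w ∈ W, hd (v + w) = hd v)

include hW

theorem hd_congr {A A' : R} (h : A' - A ∈ W) : hd A' = hd A := by
  rw [← hW A _ h, add_sub_cancel]

theorem reducePair_congr {A B A' B' : R} (hA : A' - A ∈ W) (hB : B' - B ∈ W) :
    (reducePair L hd A' B').1 - (reducePair L hd A B).1 ∈ W ∧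
    (reducePair L hd A' B').2 - (reducePair L hd A B).2 ∈ W := by
  obtain ⟨d, hd', e, he, h⟩ := iterate_congr W (2 * L) (hd A) (hd B) hA hB
  unfold reducePair euclid
  rw [hd_congr hW hA, hd_congr hW hB, h]
  simpa [shift] using ⟨hd', he⟩

theorem sweep_congr {A A' : R} (hA : A' - A ∈ W) {rs rs' : List R} (h : CongrMod W rs rs') :
    CongrMod W (sweep L hd A rs) (sweep L hd A' rs') := by
  induction h generalizing A A' with
  | nil => exact .nil
  | cons h1 _ ih =>
    have h3 := reducePair_congr (L := L) hW hA h1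
    exact .cons h3.2 (ih h3.1)

theorem elimCol_congr {rs rs' : List R} (h : CongrMod W rs rs') :
    CongrMod W (elimCol L hd rs) (elimCol L hd rs') := by
  cases h with
  | nil => exact .nil
  | cons h1 h2 => exact List.rel_reverse (sweep_congr hW h1 h2)

theorem reducePair_shift (A B : R) {d' e' : R} (hd' : d' ∈ W) (he' : e' ∈ W) :
    ∃ d ∈ W, ∃ e ∈ W, ∀ A' B', A' - A ∈ W → B' - B ∈ W →
      reducePair L hd (A' + d) (B' + e) =
        ((reducePair L hd A' B').1 + d', (reducePair L hd A' B').2 + e') := by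
  obtain ⟨d, hd1, e, he, h⟩ := exists_iterate_shift W (2 * L) (hd A) (hd B) hd' he'
  refine ⟨d, hd1, e, he, fun A' B' hA hB => ?_⟩
  unfold reducePair euclid
  rw [hW _ _ hd1, hW _ _ he, hd_congr hW hA, hd_congr hW hB]
  have := h A' B'
  simp only [shift] at this
  rw [this]

/-- Shifts are pulled back from the end of the list: the shift of the pivot that the later rows
require becomes the prescribed shift of the first output of `reducePair` at the current row. -/
theorem sweep_shift (A : R) (rs : List R) {d' : List R} (hd' : ShiftFor W rs d') :
    ∃ c ∈ W, ∃ d, ShiftFor W rs d ∧ ∀ A' rs', A' - A ∈ W → CongrMod W rs rs' →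
      sweep L hd (A' + c) (List.zipWith (· + ·) rs' d) =
        List.zipWith (· + ·) (sweep L hd A' rs') d' := by
  induction rs generalizing A d' with
  | nil =>
    -- The final pivot is dropped, so its shift is free.
    refine ⟨0, W.zero_mem, [], ⟨rfl, by simp⟩, fun A' rs' _ h => ?_⟩
    cases h
    rfl
  | cons B rs ih =>
    obtain ⟨hlen, hmem⟩ := hd'
    cases d' with
    | nil => simp at hlen
    | cons e' d' =>
      obtain ⟨c1, hc1, d, hd2, h⟩ := ih (reducePair L hd A B).1 (d' := d')
        ⟨by simpa using hlen, fun v hv => hmem v (by simp [hv])⟩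
      obtain ⟨c, hc, e, he, h2⟩ := reducePair_shift (L := L) hW A B hc1 (hmem e' (by simp))
      refine ⟨c, hc, e :: d, ⟨by simp [hd2.1], fun v hv => ?_⟩, fun A' rs' hA hrs => ?_⟩
      · rcases List.mem_cons.1 hv with rfl | hv
        · exact he
        · exact hd2.2 v hv
      · cases hrs with
        | @cons _ B' _ rs' hB hrs =>
          rw [List.zipWith_cons_cons, sweep, h2 A' B' hA hB, sweep, List.zipWith_cons_cons,
            h _ _ (reducePair_congr hW hA hB).1 hrs]

theorem elimCol_shiftable (l : List R) : Shiftable W (elimCol L hd) l := by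
  refine ⟨fun l' h => elimCol_congr hW h, fun d' hd' => ?_⟩
  cases l with
  | nil =>
    refine ⟨[], ⟨rfl, by simp⟩, fun l' h => ?_⟩
    cases h
    rfl
  | cons A rs =>
    have hlen : d'.length = rs.length := by
      rw [hd'.1, length_elimCol]; rfl
    obtain ⟨c, hc, d, hd2, h⟩ := sweep_shift (L := L) hW A rs (d' := d'.reverse)
      ⟨by rw [List.length_reverse, hlen], fun v hv => hd'.2 v (List.mem_reverse.1 hv)⟩
    refine ⟨c :: d, ⟨by simp [hd2.1], fun v hv => ?_⟩, fun l' hl' => ?_⟩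
    · rcases List.mem_cons.1 hv with rfl | hv
      · exact hc
      · exact hd2.2 v hv
    · cases hl' with
      | @cons _ A' _ rs' hA hrs =>
        rw [List.zipWith_cons_cons, elimCol, h _ _ hA hrs, elimCol,
          List.reverse_zipWith, List.reverse_reverse]
        rw [length_sweep, List.length_reverse, hlen, CongrMod.length_eq hrs]

end Eliminate

/-! ## Exponent vectors -/

namespace DLInst

variable {C : RSCode} (D : DLInst C)

/-- The order of the multiplicative group of the extension field. -/
noncomputable def ord : ℕ := C.q ^ D.deg - 1

theorem ord_pos : 0 < D.ord := by
  have := Nat.one_lt_pow D.deg_pos.ne' C.two_le_q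
  unfold ord
  omega

instance : NeZero D.ord := ⟨D.ord_pos.ne'⟩

/-- Bounds the bit length of the group order by `q ^ 2`; this is the parameter with which Euclid's
algorithm is run throughout. -/
theorem ord_lt : D.ord < 2 ^ (C.q ^ 2) := by
  have h1 : C.q ^ D.deg ≤ C.q ^ C.q := Nat.pow_le_pow_right (by have := C.two_le_q; omega) D.deg_le_q
  have h2 : C.q ^ C.q ≤ (2 ^ C.q) ^ C.q := Nat.pow_le_pow_left Nat.lt_two_pow_self.le _
  have h3 : 0 < C.q ^ D.deg := by have := C.two_le_q; positivity
  rw [sq, pow_mul]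
  unfold ord
  omega

/-- Vectors of exponents for the elements `root - a` (`a` an evaluation point), `b` and `t`. -/
abbrev Row : Type := Fin (C.n + 2) → ZMod D.ord

/-- An exponent vector, written as the list of its entries. -/
noncomputable def encRow (v : D.Row) : Val := Val.arr fun l => .num (v l).val

theorem size_num_le_of_lt {m B : ℕ} (h : m < 2 ^ B) : (Val.num m).size ≤ B + 1 :=
  Nat.succ_le_succ (Nat.size_le.2 h)

theorem size_encRow_le (v : D.Row) : (D.encRow v).size ≤ (C.q + 2) * (C.q ^ 2 + 2) + 1 := by
  refine (Val.size_arr_le (B := C.q ^ 2 + 1) fun l =>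
    size_num_le_of_lt ((ZMod.val_lt _).trans D.ord_lt)).trans ?_
  have := C.n_le_q
  gcongr

/-- Two rows with their heads. -/
noncomputable def encPair (s : (ℕ × D.Row) × (ℕ × D.Row)) : Val :=
  .pair (.pair (.num s.1.1) (D.encRow s.1.2)) (.pair (.num s.2.1) (D.encRow s.2.2))

/-- The entry of a row that belongs to an evaluation point. -/
noncomputable def head (k : Fin C.n) (v : D.Row) : ℕ := (v (Fin.castAdd 2 k)).val

/-- Clearing the first `k` columns of a list of rows. -/
noncomputable def elimRows (rs : List D.Row) : ℕ → List D.Row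
  | 0 => rs
  | k + 1 => if h : k < C.n then elimCol (C.q ^ 2) (D.head ⟨k, h⟩) (elimRows rs k)
      else elimRows rs k

/-- Each column costs one row, so `n + 1` relations leave at least one row after all `n` columns. -/
theorem length_elimRows (rs : List D.Row) {k : ℕ} (hk : k ≤ C.n) :
    (D.elimRows rs k).length = rs.length - k := by
  induction k with
  | zero => rfl
  | succ k ih =>
    rw [elimRows, dif_pos (show k < C.n from hk), length_elimCol, ih (Nat.le_of_succ_le hk), Nat.sub_sub]

end DLInst

/-! ### Programs for exponent vectors and elimination. -/

namespace Comp

universe u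
variable {I : Type u} {x : I → Val} {C : I → RSCode} {D : ∀ i, DLInst (C i)}

theorem bdd_n : PolyBdd (fun i => (C i).q) fun i => (C i).n := PolyBdd.param.mono fun i => (C i).n_le_q

theorem bdd_encRow : PolyBdd (fun i => (C i).q) fun i => ((C i).q + 2) * ((C i).q ^ 2 + 2) + 1 :=
  ((PolyBdd.param.add (.const 2)).mul ((PolyBdd.param.pow 2).add (.const 2))).add (.const 1)

theorem code_n (hC : KnowsCode C x) : Comp (fun i => (C i).q) x fun i => .num (C i).n :=
  (length (code_points hC) (code_q hC)).congr fun i => by rw [List.length_ofFn]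

section

variable {v w : ∀ i, (D i).Row} {c : I → ℕ}

theorem row_get (hv : Comp (fun i => (C i).q) x fun i => (D i).encRow (v i))
    {l : ∀ i, Fin ((C i).n + 2)} (hl : Comp (fun i => (C i).q) x fun i => .num (l i)) :
    Comp (fun i => (C i).q) x fun i => .num (v i (l i)).val :=
  arr_get (u := fun i l => .num (v i l).val) hv hl

variable (hD : KnowsExt C D x)
include hD

theorem ext_ord : Comp (fun i => (C i).q) x fun i => .num (D i).ord :=
  ((code_q hD.code).pow_num hD.deg bdd_deg).sub (hD.deg.const 1)

theorem row_build
    (body : ∀ X : Rounds (fun i => (C i).n + 2) → Val,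
      Comp (fun j : Rounds (fun i => (C i).n + 2) => (C j.1).q) X (fun j => x j.1) →
      Comp (fun j : Rounds (fun i => (C i).n + 2) => (C j.1).q) X (fun j => .num j.2) →
      Comp (fun j : Rounds (fun i => (C i).n + 2) => (C j.1).q) X (fun j => .num (v j.1 j.2).val)) :
    Comp (fun i => (C i).q) x fun i => (D i).encRow (v i) :=
  arr_build (u := fun i l => .num (v i l).val) ((code_n hD.code).add (hD.deg.const 2))
    (bdd_n.add (.const 2)) body

theorem row_zero : Comp (fun i => (C i).q) x fun i => (D i).encRow 0 :=
  row_build hD fun X hX hj => (hj.const 0).congr fun j => by rw [Pi.zero_apply, ZMod.val_zero]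

theorem row_sub_nsmul (hv : Comp (fun i => (C i).q) x fun i => (D i).encRow (v i))
    (hc : Comp (fun i => (C i).q) x fun i => .num (c i))
    (hw : Comp (fun i => (C i).q) x fun i => (D i).encRow (w i)) :
    Comp (fun i => (C i).q) x fun i => (D i).encRow (v i - c i • w i) := by
  refine row_build hD fun X hX hj => ?_
  have hN := ext_ord (hD.up (π := Sigma.fst) hX)
  have h1 := ((hc.up (π := Sigma.fst) hX).mul (row_get (hw.up (π := Sigma.fst) hX) hj)).mod hN
  -- Subtraction modulo `N` on representatives adds `N - (c * w) % N`, which avoids truncation.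
  refine (((row_get (hv.up (π := Sigma.fst) hX) hj).add (hN.sub h1)).mod hN).congr fun j => ?_
  obtain ⟨i, j⟩ := j
  congr 1
  have hlt : c i * (w i j).val % (D i).ord < (D i).ord := Nat.mod_lt _ (D i).ord_pos
  rw [← ZMod.val_natCast]
  congr 1
  push_cast [Nat.cast_sub hlt.le]
  simp [sub_eq_add_neg]

end

section

variable (hD : KnowsExt C D x)
include hD

/-- Heads equal to `N` are admitted because `logOf` starts with the head `N` itself. -/
theorem euclid_comp {s : ∀ i, (ℕ × (D i).Row) × (ℕ × (D i).Row)}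
    (hs : Comp (fun i => (C i).q) x fun i => (D i).encPair (s i))
    (h1 : ∀ i, (s i).1.1 ≤ (D i).ord) (h2 : ∀ i, (s i).2.1 ≤ (D i).ord) :
    Comp (fun i => (C i).q) x fun i => (D i).encPair (euclid ((C i).q ^ 2) (s i)) := by
  have hT := ((code_q hD.code).const 2).mul ((code_q hD.code).pow_const 2)
  have hTb : PolyBdd (fun i => (C i).q) fun i => 2 * (C i).q ^ 2 :=
    (PolyBdd.const 2).mul (PolyBdd.param.pow 2)
  have hb : PolyBdd (fun i => (C i).q) fun i =>
      2 * ((C i).q ^ 2 + 1 + (((C i).q + 2) * ((C i).q ^ 2 + 2) + 1) + 1) + 1 :=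
    ((PolyBdd.const 2).mul ((((PolyBdd.param.pow 2).add (.const 1)).add bdd_encRow).add
      (.const 1))).add (.const 1)
  refine for_loop (s := fun i k => (D i).encPair (euclidStep^[k] (s i))) hT hTb hb
    (fun i j _ => ?_) hs fun X hX hj hs => ?_
  · have h := iterate_euclidStep_heads_le (h1 i) (h2 i) j
    have h3 := DLInst.size_num_le_of_lt (h.1.trans_lt (D i).ord_lt)
    have h4 := DLInst.size_num_le_of_lt (h.2.trans_lt (D i).ord_lt)
    have h5 := (D i).size_encRow_le (euclidStep^[j] (s i)).1.2
    have h6 := (D i).size_encRow_le (euclidStep^[j] (s i)).2.2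
    simp only [DLInst.encPair, Val.size] at h3 h4 ⊢
    omega
  · have hD' := hD.up (π := Sigma.fst) hX
    have h0 := hs.snd.fst
    have hA := hs.fst
    have step := hs.snd.pair ((hA.fst.mod h0).pair
      (row_sub_nsmul hD' hA.snd (hA.fst.div h0) hs.snd.snd))
    refine (branch h0 (P := fun j : Rounds (fun i => 2 * (C i).q ^ 2) =>
      (euclidStep^[j.2] (s j.1)).2.1 ≠ 0) (fun j => Iff.rfl) step hs).congr fun j => ?_
    rw [Function.iterate_succ_apply', euclidStep]
    by_cases h : (euclidStep^[j.2] (s j.1)).2.1 = 0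
    · rw [if_neg (not_not.2 h), if_pos h]
    · rw [if_pos h, if_neg h]
      rfl

variable {k : ∀ i, Fin (C i).n}

theorem reducePair_comp {A B : ∀ i, (D i).Row}
    (hk : Comp (fun i => (C i).q) x fun i => .num (k i))
    (hA : Comp (fun i => (C i).q) x fun i => (D i).encRow (A i))
    (hB : Comp (fun i => (C i).q) x fun i => (D i).encRow (B i)) :
    Comp (fun i => (C i).q) x fun i => .pair
      ((D i).encRow (reducePair ((C i).q ^ 2) ((D i).head (k i)) (A i) (B i)).1)
      ((D i).encRow (reducePair ((C i).q ^ 2) ((D i).head (k i)) (A i) (B i)).2) := by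
  have h1 : Comp (fun i => (C i).q) x fun i => .num ((D i).head (k i) (A i)) :=
    row_get (l := fun i => Fin.castAdd 2 (k i)) hA hk
  have h2 : Comp (fun i => (C i).q) x fun i => .num ((D i).head (k i) (B i)) :=
    row_get (l := fun i => Fin.castAdd 2 (k i)) hB hk
  have h := euclid_comp hD (s := fun i => (((D i).head (k i) (A i), A i),
    ((D i).head (k i) (B i), B i))) ((h1.pair hA).pair (h2.pair hB))
    (fun i => (ZMod.val_lt _).le) (fun i => (ZMod.val_lt _).le)
  exact h.fst.snd.pair h.snd.snd

/-- Lists of rows. -/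
noncomputable abbrev _root_.RSDlog.DLInst.encRows {C : RSCode} (D : DLInst C) (rs : List D.Row) : Val :=
  .ofList (rs.map D.encRow)

omit hD in
theorem bdd_length_rows {rs : ∀ i, List (D i).Row}
    (h : Comp (fun i => (C i).q) x fun i => (D i).encRows (rs i)) :
    PolyBdd (fun i => (C i).q) fun i => (rs i).length :=
  h.bdd.mono fun i => by
    have := Val.length_lt_size_ofList ((rs i).map (D i).encRow)
    rw [List.length_map] at this
    exact this.le

omit hD in
theorem _root_.RSDlog.DLInst.size_encRows_le {C : RSCode} (D : DLInst C) (rs : List D.Row) :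
    (D.encRows rs).size ≤ rs.length * ((C.q + 2) * (C.q ^ 2 + 2) + 1 + 1) + 1 := by
  have := Val.size_ofList_le (l := rs.map D.encRow) (B := (C.q + 2) * (C.q ^ 2 + 2) + 1)
    fun v hv => by
      obtain ⟨r, -, rfl⟩ := List.mem_map.1 hv
      exact D.size_encRow_le r
  rwa [List.length_map] at this

theorem rows_headD {rs : ∀ i, List (D i).Row}
    (h : Comp (fun i => (C i).q) x fun i => (D i).encRows (rs i)) :
    Comp (fun i => (C i).q) x fun i => (D i).encRow ((rs i).headD 0) := by
  classical
  have h1 : Comp (fun i => (C i).q) x fun i => .num (((D i).encRows (rs i)).pairBit) :=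
    (h.app .isPair).congr fun i => by
      cases (D i).encRows (rs i) <;> rfl
  refine (branch h1 (P := fun i => rs i ≠ []) (fun i => ?_) (h.app .fst) (row_zero hD)).congr
    fun i => ?_
  · cases rs i <;> simp [DLInst.encRows, Val.ofList, Val.pairBit]
  · cases rs i <;> simp [DLInst.encRows, Val.ofList, Atom.apply]

theorem elimCol_comp {rs : ∀ i, List (D i).Row}
    (hk : Comp (fun i => (C i).q) x fun i => .num (k i))
    (h : Comp (fun i => (C i).q) x fun i => (D i).encRows (rs i)) :
    Comp (fun i => (C i).q) x fun i =>
      (D i).encRows (elimCol ((C i).q ^ 2) ((D i).head (k i)) (rs i)) := by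
  have htail : Comp (fun i => (C i).q) x fun i => (D i).encRows (rs i).tail :=
    (h.app .snd).congr fun i => by cases rs i <;> rfl
  have hlen := bdd_length_rows h
  have := foldl (q := fun i => (C i).q) (x := x) (l := fun i => (rs i).tail)
    (eα := fun i => (D i).encRow)
    (eβ := fun i (s : (D i).Row × List (D i).Row) => .pair ((D i).encRow s.1) ((D i).encRows s.2))
    (b₀ := fun i => ((rs i).headD 0, []))
    (f := fun i s B => ((reducePair ((C i).q ^ 2) ((D i).head (k i)) s.1 B).1,
      (reducePair ((C i).q ^ 2) ((D i).head (k i)) s.1 B).2 :: s.2))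
    htail ((rows_headD hD h).pair (hD.deg.const 0)) (code_q hD.code)
    ((bdd_encRow.add ((hlen.mul (bdd_encRow.add (.const 1))).add (.const 1))).add (.const 1))
    (fun i m => ?_) fun X hX hs hB => ?_
  · refine this.snd.congr fun i => ?_
    rw [foldl_sweep]
    cases rs i with
    | nil => simp [elimCol, sweep]
    | cons A rs => simp [elimCol]
  · refine Nat.succ_le_succ (add_le_add ((D i).size_encRow_le _) (((D i).size_encRows_le _).trans ?_))
    rw [foldl_sweep, List.append_nil, List.length_reverse, length_sweep]
    gcongr
    rw [List.length_take, List.length_tail]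
    exact (min_le_right _ _).trans (Nat.sub_le _ _)
  · have hr := reducePair_comp (hD.up (π := Sigma.fst) hX) (k := fun j => k j.1)
      (hk.up (π := Sigma.fst) hX) hs.fst hB
    exact hr.fst.pair (hr.snd.pair hs.snd)

theorem elimRows_comp {rs : ∀ i, List (D i).Row}
    (h : Comp (fun i => (C i).q) x fun i => (D i).encRows (rs i)) :
    Comp (fun i => (C i).q) x fun i => (D i).encRows ((D i).elimRows (rs i) (C i).n) := by
  have hlen := bdd_length_rows h
  refine for_loop (s := fun i k => (D i).encRows ((D i).elimRows (rs i) k)) (code_n hD.code) bdd_n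
    ((hlen.mul (bdd_encRow.add (.const 1))).add (.const 1)) (fun i j hj => ?_) h
    fun X hX hj hs => ?_
  · refine ((D i).size_encRows_le _).trans ?_
    rw [(D i).length_elimRows _ hj]
    gcongr
    exact Nat.sub_le _ _
  · refine (elimCol_comp (hD.up (π := Sigma.fst) hX) (k := fun j => j.2) hj hs).congr fun j => ?_
    rw [DLInst.elimRows, dif_pos j.2.2]

end

end Comp

/-! ## The algorithm -/

open Classical in
/-- A list decoding algorithm for the codes in `𝒞`, with its coin tosses as a number. -/
structure Decoder (𝒞 : Set RSCode) where
  coins : ℕ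
  run : (C : RSCode) → (Fin C.n → C.F) → ℕ → Val
  prog : Prog
  exponent : ℕ
  runs : ∀ C ∈ 𝒞, ∀ y, ∀ r < 2 ^ (C.q ^ coins), ∃ t ≤ C.q ^ exponent,
    prog.Runs (.pair (.pair C.enc (C.vec y)) (.num r)) (run C y r) t
  correct : ∀ C ∈ 𝒞, ∀ y, ∃ G ⊆ Finset.range (2 ^ (C.q ^ coins)),
    2 * 2 ^ (C.q ^ coins) ≤ 3 * G.card ∧ ∀ r ∈ G, ∃ L : List (Fin C.n → C.F),
      run C y r = .ofList (L.map C.vec) ∧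
      ∀ w, w ∈ L ↔ C.IsCodeword w ∧ hammingDist w y ≤ C.n - C.gHat

theorem exists_decoder {𝒞 : Set RSCode} (h : (listDecoding 𝒞).SolvableInPolyTime) :
    Nonempty (Decoder 𝒞) := by
  classical
  obtain ⟨p, c, d, h⟩ := h
  have hrun : ∀ (C : RSCode) (y : Fin C.n → C.F) (r : ℕ), ∃ v : Val, C ∈ 𝒞 → r < 2 ^ (C.q ^ d) →
      ∃ t ≤ C.q ^ c, p.Runs (.pair (.pair C.enc (C.vec y)) (.num r)) v t := by
    intro C y r
    by_cases hC : C ∈ 𝒞 ∧ r < 2 ^ (C.q ^ d)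
    · obtain ⟨v, t, h1, h2⟩ := (h ⟨⟨C, hC.1⟩, y⟩).1 r hC.2
      exact ⟨v, fun _ _ => ⟨t, h2, h1⟩⟩
    · exact ⟨.num 0, fun h1 h2 => absurd ⟨h1, h2⟩ hC⟩
  choose run hrun using hrun
  refine ⟨⟨d, run, p, c, fun C hC y r hr => hrun C y r hC hr, fun C hC y => ?_⟩⟩
  refine ⟨_, Finset.filter_subset _ _, (h ⟨⟨C, hC⟩, y⟩).2, fun r hr => ?_⟩
  obtain ⟨h1, v, t, hv, L, rfl, hL⟩ := Finset.mem_filter.1 hr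
  obtain ⟨t', -, h2⟩ := hrun C y r hC (Finset.mem_range.1 h1)
  exact ⟨L, h2.det hv, hL⟩

/-- An optional value, as a value. -/
def encOpt : Option Val → Val
  | none => .num 0
  | some v => .pair (.num 1) v

namespace DLInst

variable {C : RSCode} (D : DLInst C)

/-- The element `root - a` of the factor base. -/
noncomputable def lin (l : Fin C.n) : D.K := AdjoinRoot.root D.h - AdjoinRoot.of D.h (C.point l)

/-- The positions of the exponents of `b` and of `t`. -/
abbrev posB (C : RSCode) : Fin (C.n + 2) := Fin.natAdd C.n 0

/-- The position of the exponent of `t`. -/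
abbrev posT (C : RSCode) : Fin (C.n + 2) := Fin.natAdd C.n 1

/-- The product of powers with the given exponents. -/
noncomputable def power (v : D.Row) : D.K :=
  (∏ l, D.lin l ^ (v (Fin.castAdd 2 l)).val) * AdjoinRoot.mk D.h D.b ^ (v (posB C)).val *
    AdjoinRoot.mk D.h D.t ^ (v (posT C)).val

/-- The received word that is decoded in order to factor the element `f`. -/
noncomputable def received (f : D.K) (l : Fin C.n) : C.F :=
  -((D.rep f).eval (C.point l) / D.h.eval (C.point l)) - C.point l ^ C.k

/-- The candidate word agrees with the received word at the position `l`. -/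
def Agrees (f : D.K) (cand : Val) (l : Fin C.n) : Prop := cand.entry l = C.elem (D.received f l)

open Classical in
/-- The candidate word yields a factorization of `f` over the factor base. -/
def Good (f : D.K) (cand : Val) : Prop := ∏ l, (if D.Agrees f cand l then D.lin l else 1) = f

open Classical in
/-- The first of the `k` first entries of `out` that yields a factorization of `f`. -/
noncomputable def search (f : D.K) (out : Val) : ℕ → Option Val
  | 0 => none
  | k + 1 => if search f out k ≠ none then search f out k
      else if D.Good f (out.entry k) then some (out.entry k) else none

/-- The exponents of a factorization over the factor base. -/
noncomputable def mask (f : D.K) (cand : Val) : D.Row := fun l =>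
  ((bit (∃ h : (l : ℕ) < C.n, D.Agrees f cand ⟨l, h⟩) : ℕ) : ZMod D.ord)

variable {𝒞 : Set RSCode} (Δ : Decoder 𝒞)

/-- One attempt at finding a relation, with the exponents `v` and the coin tosses `r`. -/
noncomputable def attempt (r : ℕ) (v : D.Row) : Option D.Row :=
  (D.search (D.power v) (Δ.run C (D.received (D.power v)) r) ((C.q + 2) ^ Δ.exponent)).map
    fun cand => v - D.mask (D.power v) cand

/-- The relations that are found in the first `k` attempts. -/
noncomputable def relations (s : ℕ → ℕ × D.Row) : ℕ → List D.Row
  | 0 => []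
  | k + 1 => (D.attempt Δ (s k).1 (s k).2).elim (relations s k) fun r => r :: relations s k

/-- The candidate for the discrete logarithm, computed from a list of relations. -/
noncomputable def logOf (rs : List D.Row) : ℕ :=
  let v := (D.elimRows rs C.n).headD 0
  (-(euclid (C.q ^ 2) ((D.ord, 0), ((v (posT C)).val, v))).1.2 (posB C)).val

/-- Coin tosses and exponents from a random number. -/
noncomputable def sample (d : ℕ) (c : ℕ) : ℕ × D.Row :=
  (c % 2 ^ (C.q ^ d), fun l => ((c / 2 ^ (C.q ^ d) / D.ord ^ (l : ℕ) : ℕ) : ZMod D.ord))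

/-- The candidate of the trial with number `j`. -/
noncomputable def trial (e m : ℕ) (R j : ℕ) : ℕ :=
  if D.deg = 1 then j else
    D.logOf (D.relations Δ (fun i => D.sample Δ.coins
      (R / (2 ^ (C.q ^ e)) ^ (j * C.q ^ m + i) % 2 ^ (C.q ^ e))) (C.q ^ m))

/-- The number `x` is a solution. -/
def IsLog (x : ℕ) : Prop := x < D.ord ∧ AdjoinRoot.mk D.h D.b ^ x = AdjoinRoot.mk D.h D.t

open Classical in
/-- The result of the first `j` trials. -/
noncomputable def answer (e m : ℕ) (R : ℕ) : ℕ → ℕ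
  | 0 => 0
  | j + 1 => if D.IsLog (D.trial Δ e m R j) then D.trial Δ e m R j else answer e m R j

theorem size_search_le (f : D.K) (out : Val) (k : ℕ) :
    (encOpt (D.search f out k)).size ≤ out.size + 4 := by
  induction k with
  | zero => simp [search, encOpt, Val.size]
  | succ k ih =>
    rw [search]
    split_ifs
    · exact ih
    · have h1 := out.size_rest_le k
      have h2 : (out.entry k).size ≤ (out.rest k).size := by
        rw [Val.entry]
        cases out.rest k <;> simp only [Atom.apply, Val.size, Nat.size_zero] <;> omega
      simp only [encOpt, Val.size, Nat.size_one]
      omega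
    · simp [encOpt, Val.size]

theorem answer_lt (e m R j : ℕ) : D.answer Δ e m R j < D.ord := by
  induction j with
  | zero => exact D.ord_pos
  | succ j ih =>
    rw [answer]
    split_ifs with h
    · exact h.1
    · exact ih

theorem length_relations_le (s : ℕ → ℕ × D.Row) (k : ℕ) : (D.relations Δ s k).length ≤ k := by
  induction k with
  | zero => simp [relations]
  | succ k ih =>
    rw [relations]
    cases D.attempt Δ (s k).1 (s k).2 with
    | none => exact ih.trans (Nat.le_succ k)
    | some r => exact Nat.succ_le_succ ih

end DLInst

/-! ### Running time of the index calculus. -/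

namespace Comp

universe u
variable {I : Type u} {x : I → Val} {C : I → RSCode} {D : ∀ i, DLInst (C i)}

/-- The instance of the discrete logarithm problem is known in the context `x`. -/
structure KnowsInst (C : I → RSCode) (D : ∀ i, DLInst (C i)) (x : I → Val) : Prop
    extends KnowsExt C D x where
  base : Comp (fun i => (C i).q) x fun i => (D i).encK (AdjoinRoot.mk (D i).h (D i).b)
  target : Comp (fun i => (C i).q) x fun i => (D i).encK (AdjoinRoot.mk (D i).h (D i).t)

theorem KnowsInst.up {J : Type*} {π : J → I} {X : J → Val} (hD : KnowsInst C D x)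
    (hX : Comp (fun j => (C (π j)).q) X (fun j => x (π j))) :
    KnowsInst (fun j => C (π j)) (fun j => D (π j)) X :=
  ⟨KnowsExt.up (π := π) hD.toKnowsExt hX, hD.base.up (π := π) hX, hD.target.up (π := π) hX⟩

theorem ext_prod {m : I → ℕ} {u : ∀ i, Fin (m i) → (D i).K} (hD : KnowsExt C D x)
    (hm : Comp (fun i => (C i).q) x fun i => .num (m i)) (hmb : PolyBdd (fun i => (C i).q) m)
    (body : ∀ X : Rounds m → Val,
      Comp (fun j : Rounds m => (C j.1).q) X (fun j => x j.1) →
      Comp (fun j : Rounds m => (C j.1).q) X (fun j => .num j.2) →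
      Comp (fun j : Rounds m => (C j.1).q) X (fun j => (D j.1).encK (u j.1 j.2))) :
    Comp (fun i => (C i).q) x fun i => (D i).encK (∏ j, u i j) := by
  classical
  have := for_loop (q := fun i => (C i).q) (x := x)
    (s := fun i k => (D i).encK (∏ j : Fin (m i), if j < k then u i j else 1)) hm hmb bdd_encK
    (fun i j _ => (D i).size_encK_le _) ((ext_one hD).congr fun i => by simp)
    fun X hX hj hs => (ext_mul (hD.up (π := Sigma.fst) hX) hs (body X hX hj)).congr fun j => ?_
  · exact this.congr fun i => by simp
  · congr 1
    have h : ∀ j' : Fin (m j.1), (if (j' : ℕ) < (j.2 : ℕ) + 1 then u j.1 j' else 1) =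
        (if (j' : ℕ) < (j.2 : ℕ) then u j.1 j' else 1) * (if j' = j.2 then u j.1 j' else 1) := by
      intro j'
      rcases lt_trichotomy (j' : ℕ) (j.2 : ℕ) with h | h | h
      · simp [h, h.trans (Nat.lt_succ_self _), (Fin.lt_def.2 h).ne]
      · obtain rfl : j' = j.2 := Fin.ext h
        simp
      · have h1 : ¬ (j' : ℕ) < (j.2 : ℕ) + 1 := by omega
        simp [h.not_gt, h1, (Fin.lt_def.2 h).ne']
    rw [Finset.prod_congr rfl fun j' _ => h j', Finset.prod_mul_distrib]
    simp

/-- The place where the assumed decoding program becomes a subroutine of the constructed one. -/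
theorem decoder_comp {𝒞 : Set RSCode} (Δ : Decoder 𝒞) (hC : ∀ i, C i ∈ 𝒞) {y : ∀ i, Fin (C i).n → (C i).F}
    {r : I → ℕ} (hr : ∀ i, r i < 2 ^ ((C i).q ^ Δ.coins)) (hCx : KnowsCode C x)
    (hy : Comp (fun i => (C i).q) x fun i => (C i).vec (y i))
    (hrx : Comp (fun i => (C i).q) x fun i => .num (r i)) :
    Comp (fun i => (C i).q) x fun i => Δ.run (C i) (y i) (r i) :=
  ((hCx.pair hy).pair hrx).trans (of_exists_le (PolyBdd.param.pow Δ.exponent)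
    fun i => Δ.runs (C i) (hC i) (y i) (r i) (hr i))

section

variable (hD : KnowsExt C D x) {f : ∀ i, (D i).K}
include hD

theorem lin_comp {l : ∀ i, Fin (C i).n} (hl : Comp (fun i => (C i).q) x fun i => .num (l i)) :
    Comp (fun i => (C i).q) x fun i => (D i).encK ((D i).lin (l i)) := by
  have h1 := arr_get (u := fun i l => (C i).elem ((C i).point l)) (j := l) (code_points hD.code) hl
  exact (ext_sub hD (ext_root_mul hD (ext_one hD)) (ext_of_mul hD h1 (ext_one hD))).congr fun i => by
    rw [mul_one, mul_one, DLInst.lin]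

theorem received_comp (hf : Comp (fun i => (C i).q) x fun i => (D i).encK (f i)) :
    Comp (fun i => (C i).q) x fun i => (C i).vec ((D i).received (f i)) := by
  refine arr_build (u := fun i l => (C i).elem ((D i).received (f i) l)) (code_n hD.code) bdd_n
    fun X hX hj => ?_
  have hD' := hD.up (π := Sigma.fst) hX
  have hC := hD'.code
  have h1 := arr_get (u := fun j l => (C j.1).elem ((C j.1).point l))
    (j := fun j : Rounds (fun i => (C i).n) => j.2) (code_points hC) hj
  exact elem_sub hC (elem_neg hC (elem_div hC (eval_rep hD' (hf.up (π := Sigma.fst) hX) h1)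
    (eval_modulus hD' h1))) (elem_pow hC h1 (code_k hC)
      (PolyBdd.param.mono fun j => ((C j.1).k_lt.le.trans (C j.1).n_le_q)))

variable {cand out : I → Val}

theorem agrees_comp (hf : Comp (fun i => (C i).q) x fun i => (D i).encK (f i))
    (hc : Comp (fun i => (C i).q) x cand) {l : ∀ i, Fin (C i).n}
    (hl : Comp (fun i => (C i).q) x fun i => .num (l i)) :
    Decides (fun i => (C i).q) x fun i => (D i).Agrees (f i) (cand i) (l i) :=
  (hc.entry hl (bdd_n.mono fun i => (l i).2.le)).eq_num
    (arr_get (u := fun i l => (C i).elem ((D i).received (f i) l)) (received_comp hD hf) hl)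

theorem good_comp (hf : Comp (fun i => (C i).q) x fun i => (D i).encK (f i))
    (hc : Comp (fun i => (C i).q) x cand) :
    Decides (fun i => (C i).q) x fun i => (D i).Good (f i) (cand i) := by
  classical
  have h1 := ext_prod (u := fun i l => if (D i).Agrees (f i) (cand i) l then (D i).lin l else 1)
    hD (code_n hD.code) bdd_n fun X hX hj => by
      have hD' := hD.up (π := Sigma.fst) hX
      refine (ite (agrees_comp hD' (hf.up (π := Sigma.fst) hX) (hc.up (π := Sigma.fst) hX)
        (l := fun j => j.2) hj) (lin_comp hD' hj) (ext_one hD')).congr fun j => ?_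
      split_ifs <;> rfl
  refine (ext_eq hD h1 hf).congr fun i => ?_
  unfold DLInst.Good
  congr!

omit hD in
theorem opt_ne_none {o : I → Option Val} (h : Comp (fun i => (C i).q) x fun i => encOpt (o i)) :
    Decides (fun i => (C i).q) x fun i => o i ≠ none := by
  have h1 : Comp (fun i => (C i).q) x fun i => .num ((encOpt (o i)).pairBit) :=
    (h.app .isPair).congr fun i => by cases o i <;> rfl
  exact h1.decides fun i => by cases o i <;> simp [encOpt, Val.pairBit]

theorem search_comp (hf : Comp (fun i => (C i).q) x fun i => (D i).encK (f i))
    (ho : Comp (fun i => (C i).q) x out) (c : ℕ) :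
    Comp (fun i => (C i).q) x fun i =>
      encOpt ((D i).search (f i) (out i) (((C i).q + 2) ^ c)) := by
  classical
  refine for_loop (s := fun i k => encOpt ((D i).search (f i) (out i) k))
    (poly_num (code_q hD.code) c) (bdd_pow c) (ho.bdd.add (.const 4))
    (fun i j _ => (D i).size_search_le _ _ _) (hD.deg.const 0) fun X hX hj hs => ?_
  have hD' := hD.up (π := Sigma.fst) hX
  have h1 := (ho.up (π := Sigma.fst) hX).entry hj (((bdd_pow c).reindex _).mono fun j => j.2.2.le)
  refine (ite (opt_ne_none hs) hs (ite (good_comp hD' (hf.up (π := Sigma.fst) hX) h1)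
    ((hj.const 1).pair h1) (hj.const 0))).congr fun j => ?_
  rw [DLInst.search]
  split_ifs <;> rfl

theorem mask_comp (hf : Comp (fun i => (C i).q) x fun i => (D i).encK (f i))
    (hc : Comp (fun i => (C i).q) x cand) :
    Comp (fun i => (C i).q) x fun i => (D i).encRow ((D i).mask (f i) (cand i)) := by
  classical
  refine row_build hD fun X hX hj => ?_
  have hD' := hD.up (π := Sigma.fst) hX
  have hlt := hj.lt (code_n hD'.code)
  -- The two positions of `b` and `t` do not index evaluation points. The legal index `0` is
  -- substituted there, and the result is discarded by `hlt`.
  have hpos : ∀ j : Rounds (fun i => (C i).n + 2),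
      (if (j.2 : ℕ) < (C j.1).n then (j.2 : ℕ) else 0) < (C j.1).n := fun j => by
    have := (C j.1).k_lt
    split_ifs <;> omega
  have hidx : Comp (fun j : Rounds (fun i => (C i).n + 2) => (C j.1).q) X
      fun j => .num ((⟨_, hpos j⟩ : Fin (C j.1).n) : ℕ) :=
    (ite hlt hj (hj.const 0)).congr fun j => by split_ifs <;> rfl
  have hag := hlt.and (agrees_comp hD' (hf.up (π := Sigma.fst) hX) (hc.up (π := Sigma.fst) hX) hidx)
  have hbit : Comp (fun j : Rounds (fun i => (C i).n + 2) => (C j.1).q) X fun j =>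
      .num (bit (∃ h : (j.2 : ℕ) < (C j.1).n, (D j.1).Agrees (f j.1) (cand j.1) ⟨j.2, h⟩)) := by
    refine hag.congr fun j => ?_
    constructor
    · rintro ⟨h, h'⟩
      refine ⟨h, ?_⟩
      simpa only [if_pos h] using h'
    · rintro ⟨h, h'⟩
      refine ⟨h, ?_⟩
      simpa only [if_pos h] using h'
  refine (hbit.mod (ext_ord hD')).congr fun j => ?_
  rw [DLInst.mask, ZMod.val_natCast]

end

section

variable (hD : KnowsInst C D x) {v : ∀ i, (D i).Row}
include hD

theorem power_comp (hv : Comp (fun i => (C i).q) x fun i => (D i).encRow (v i)) :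
    Comp (fun i => (C i).q) x fun i => (D i).encK ((D i).power (v i)) := by
  have hE := hD.toKnowsExt
  have hn := code_n hE.code
  refine ext_mul hE (ext_mul hE (ext_prod hE hn bdd_n fun X hX hj => ?_)
    (ext_pow hE hD.base (row_get hv (l := fun i => DLInst.posB (C i)) ?_)))
    (ext_pow hE hD.target (row_get hv (l := fun i => DLInst.posT (C i)) ?_))
  · have hE' := hE.up (π := Sigma.fst) hX
    exact ext_pow hE' (lin_comp hE' hj) (row_get (hv.up (π := Sigma.fst) hX)
      (l := fun j => Fin.castAdd 2 j.2) hj)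
  · exact hn.congr fun i => by simp
  · exact (hn.add (hn.const 1)).congr fun i => by simp

variable {𝒞 : Set RSCode} (Δ : Decoder 𝒞) (hC : ∀ i, C i ∈ 𝒞)
include hC

theorem attempt_comp {r : I → ℕ} (hr : ∀ i, r i < 2 ^ ((C i).q ^ Δ.coins))
    (hrx : Comp (fun i => (C i).q) x fun i => .num (r i))
    (hv : Comp (fun i => (C i).q) x fun i => (D i).encRow (v i)) :
    Comp (fun i => (C i).q) x fun i =>
      encOpt (((D i).attempt Δ (r i) (v i)).map (D i).encRow) := by
  classical
  have hE := hD.toKnowsExt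
  have hf := power_comp hD hv
  have hs := search_comp hE hf
    (decoder_comp Δ hC hr hE.code (received_comp hE hf) hrx) Δ.exponent
  have hrow := row_sub_nsmul hE hv (hrx.const 1) (mask_comp hE hf (hs.app .snd))
  refine (ite (opt_ne_none hs) ((hrx.const 1).pair hrow) (hrx.const 0)).congr fun i => ?_
  rw [DLInst.attempt]
  cases (D i).search ((D i).power (v i)) (Δ.run (C i) ((D i).received ((D i).power (v i))) (r i))
    (((C i).q + 2) ^ Δ.exponent) with
  | none => rfl
  | some c => simp [encOpt, Atom.apply]

theorem relations_comp {s : ∀ i, ℕ → ℕ × (D i).Row} {m : ℕ}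
    (hs : ∀ i k, (s i k).1 < 2 ^ ((C i).q ^ Δ.coins))
    (body : ∀ X : Rounds (fun i => (C i).q ^ m) → Val,
      Comp (fun j : Rounds (fun i => (C i).q ^ m) => (C j.1).q) X (fun j => x j.1) →
      Comp (fun j : Rounds (fun i => (C i).q ^ m) => (C j.1).q) X (fun j => .num j.2) →
      Comp (fun j : Rounds (fun i => (C i).q ^ m) => (C j.1).q) X
        (fun j => .pair (.num (s j.1 j.2).1) ((D j.1).encRow (s j.1 j.2).2))) :
    Comp (fun i => (C i).q) x fun i => (D i).encRows ((D i).relations Δ (s i) ((C i).q ^ m)) := by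
  classical
  have hq := code_q hD.code
  refine for_loop (s := fun i k => (D i).encRows ((D i).relations Δ (s i) k)) (hq.pow_const m)
    (PolyBdd.param.pow m) (((PolyBdd.param.pow m).mul (bdd_encRow.add (.const 1))).add (.const 1))
    (fun i j hj => ?_) (hq.const 0) fun X hX hj hr => ?_
  · refine ((D i).size_encRows_le _).trans ?_
    gcongr
    exact ((D i).length_relations_le Δ _ _).trans hj
  · have h1 := body X hX hj
    have h2 := attempt_comp (hD.up (π := Sigma.fst) hX) Δ (fun j => hC j.1)
      (fun j => hs j.1 j.2) h1.fst h1.snd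
    refine (ite (opt_ne_none h2) ((h2.app .snd).pair hr)
      hr).congr fun j => ?_
    rw [DLInst.relations]
    cases (D j.1).attempt Δ (s j.1 j.2).1 (s j.1 j.2).2 with
    | none => rfl
    | some r => rfl

omit hC in
theorem logOf_comp {rs : ∀ i, List (D i).Row}
    (h : Comp (fun i => (C i).q) x fun i => (D i).encRows (rs i)) :
    Comp (fun i => (C i).q) x fun i => .num ((D i).logOf (rs i)) := by
  have hE := hD.toKnowsExt
  have hn := code_n hE.code
  have hv := rows_headD hE (elimRows_comp hE h)
  have hT : Comp (fun i => (C i).q) x fun i => .num (DLInst.posT (C i)) :=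
    (hn.add (hn.const 1)).congr fun i => by simp
  have hB : Comp (fun i => (C i).q) x fun i => .num (DLInst.posB (C i)) := hn.congr fun i => by simp
  have he := euclid_comp hE (s := fun i => (((D i).ord, 0),
    ((((D i).elimRows (rs i) (C i).n).headD 0 (DLInst.posT (C i))).val,
      ((D i).elimRows (rs i) (C i).n).headD 0)))
    (((ext_ord hE).pair (row_zero hE)).pair ((row_get hv hT).pair hv)) (fun i => le_rfl)
    (fun i => (ZMod.val_lt _).le)
  refine (row_get (row_sub_nsmul hE (row_zero hE) (hn.const 1) he.fst.snd) hB).congr fun i => ?_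
  simp [DLInst.logOf]

theorem trial_comp (e m : ℕ) {R j : I → ℕ}
    (hR : Comp (fun i => (C i).q) x fun i => .num (R i))
    (hj : Comp (fun i => (C i).q) x fun i => .num (j i)) (hjb : PolyBdd (fun i => (C i).q) j) :
    Comp (fun i => (C i).q) x fun i => .num ((D i).trial Δ e m (R i) (j i)) := by
  classical
  have hE := hD.toKnowsExt
  have hrel := relations_comp hD Δ hC (m := m) (s := fun i k => (D i).sample Δ.coins
      (R i / (2 ^ ((C i).q ^ e)) ^ (j i * (C i).q ^ m + k) % 2 ^ ((C i).q ^ e)))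
    (fun i k => Nat.mod_lt _ (by positivity)) fun X hX hk => ?_
  · refine (ite (hE.deg.eq (hE.deg.const 1)) hj (logOf_comp hD hrel)).congr fun i => ?_
    rw [DLInst.trial]
    split_ifs <;> rfl
  · have hE' := hE.up (π := Sigma.fst) hX
    have hq := code_q hE'.code
    have hQ := (hk.const 2).pow_num (hq.pow_const e) (PolyBdd.param.pow e)
    have hP := (hk.const 2).pow_num (hq.pow_const Δ.coins) (PolyBdd.param.pow Δ.coins)
    have hkb : PolyBdd (fun j : Rounds (fun i => (C i).q ^ m) => (C j.1).q) fun k =>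
        j k.1 * (C k.1).q ^ m + k.2 :=
      ((hjb.reindex _).mul (PolyBdd.param.pow m)).add
        ((PolyBdd.param.pow m).mono fun k => k.2.2.le)
    have hc := ((hR.up (π := Sigma.fst) hX).div (hQ.pow_num
      (((hj.up (π := Sigma.fst) hX).mul (hq.pow_const m)).add hk) hkb)).mod hQ
    refine (hc.mod hP).pair (row_build hE' fun Y hY hl => ?_)
    have hN := ext_ord (hE'.up (π := Sigma.fst) hY)
    refine ((((hc.div hP).up (π := Sigma.fst) hY).div (hN.pow_num hl
      ((bdd_n.add (.const 2)).mono fun k => k.2.2.le))).mod hN).congr fun k => ?_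
    rw [DLInst.sample, ZMod.val_natCast]

theorem answer_comp (e m a : ℕ) {R : I → ℕ}
    (hR : Comp (fun i => (C i).q) x fun i => .num (R i)) :
    Comp (fun i => (C i).q) x fun i => .num ((D i).answer Δ e m (R i) ((C i).q ^ a)) := by
  classical
  have hq := code_q hD.code
  refine for_loop (s := fun i k => .num ((D i).answer Δ e m (R i) k)) (hq.pow_const a)
    (PolyBdd.param.pow a) ((PolyBdd.param.pow 2).add (.const 1))
    (fun i j _ => DLInst.size_num_le_of_lt (((D i).answer_lt Δ _ _ _ _).trans (D i).ord_lt))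
    (hq.const 0) fun X hX hj hs => ?_
  have hD' := hD.up (π := Sigma.fst) hX
  have hE' := hD'.toKnowsExt
  have ht := trial_comp hD' Δ (fun j => hC j.1) e m (hR.up (π := Sigma.fst) hX) hj
    ((PolyBdd.param.pow a).mono fun j => j.2.2.le)
  have hlog : Decides (fun j : Rounds (fun i => (C i).q ^ a) => (C j.1).q) X
      fun j => (D j.1).IsLog ((D j.1).trial Δ e m (R j.1) j.2) :=
    (ht.lt (ext_ord hE')).and (ext_eq hE' (ext_pow hE' hD'.base ht) hD'.target)
  refine (ite hlog ht hs).congr fun j => ?_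
  rw [DLInst.answer]
  split_ifs <;> rfl

end

end Comp

/-! ## Instances as inputs -/

theorem RSCode.size_enc_le (C : RSCode) :
    C.enc.size ≤ 2 * (C.q * (C.q * (C.q + 1) + 2) + 1) + C.q * (C.q + 1) + 2 * C.q + 10 := by
  have htab : ∀ op : C.F → C.F → C.F, (C.table op).size ≤ C.q * (C.q * (C.q + 1) + 2) + 1 :=
    fun op => Val.size_arr_le (u := fun i : Fin C.q =>
      C.vec fun j : Fin C.q => op (C.label.symm i) (C.label.symm j)) (B := C.q * (C.q + 1) + 1)
      fun j => C.size_vec_le _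
  have h1 := htab (· + ·)
  have h2 := htab (· * ·)
  have h3 : (C.vec C.point).size ≤ C.q * (C.q + 1) + 1 :=
    (C.size_vec_le _).trans (by have := C.n_le_q; gcongr)
  have h4 := Comp.size_num_le C.q
  have h5 : (Val.num C.k).size ≤ C.q + 1 :=
    (Comp.size_num_le C.k).trans (Nat.succ_le_succ (C.k_lt.le.trans C.n_le_q))
  simp only [RSCode.enc, Val.size] at h4 h5 ⊢
  omega

namespace Comp

theorem bdd_enc : PolyBdd RSCode.q fun C => C.enc.size := by
  refine PolyBdd.mono ?_ fun C => C.size_enc_le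
  have hq : PolyBdd RSCode.q RSCode.q := .param
  exact ((((PolyBdd.const 2).mul ((hq.mul ((hq.mul (hq.add (.const 1))).add (.const 2))).add
    (.const 1))).add (hq.mul (hq.add (.const 1)))).add ((PolyBdd.const 2).mul hq)).add (.const 10)

end Comp

/-- The instances of the discrete logarithm problem. -/
abbrev DLFamily (𝒞 : Set RSCode) := (C : 𝒞) × DLInst C.1

/-- The encoding of an instance. -/
noncomputable abbrev dlInput {C : RSCode} (D : DLInst C) : Val :=
  .pair C.enc (.pair (C.vec fun j : Fin (D.h.natDegree + 1) => D.h.coeff j)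
    (.pair (C.vec fun j : Fin D.h.natDegree => D.b.coeff j)
      (C.vec fun j : Fin D.h.natDegree => D.t.coeff j)))

theorem Comp.knowsInst {I : Type*} {C : I → RSCode} {D : ∀ i, DLInst (C i)} {x : I → Val}
    (hx : Comp (fun i => (C i).q) x fun i => dlInput (D i)) : KnowsInst C D x := by
  have hC : KnowsCode C x := hx.fst
  refine ⟨⟨hC, ?_, hx.snd.fst⟩, hx.snd.snd.fst.congr fun i => ?_, hx.snd.snd.snd.congr fun i => ?_⟩
  · exact (length hx.snd.snd.fst (code_q hC)).congr fun i => by rw [List.length_ofFn]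
  · rw [DLInst.encK, (D i).rep_mk (D i).degree_b]
  · rw [DLInst.encK, (D i).rep_mk (D i).degree_t]

theorem Comp.size_vec_le_of_deg {C : RSCode} (D : DLInst C) {m : ℕ} (hm : m ≤ D.deg + 1)
    (w : Fin m → C.F) : (C.vec w).size ≤ (C.q + 1) * (C.q + 1) + 1 :=
  (C.size_vec_le w).trans (by have := D.deg_le_q; gcongr; omega)

/-- The algorithm runs in polynomial time; only the probability of success has to be bounded. -/
theorem solvable_of_card {𝒞 : Set RSCode} (Δ : Decoder 𝒞) (e m a : ℕ)
    (hcount : ∀ C ∈ 𝒞, ∀ D : DLInst C, ∃ G ⊆ Finset.range (2 ^ (C.q ^ (e + m + a))),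
      2 * 2 ^ (C.q ^ (e + m + a)) ≤ 3 * G.card ∧
        ∀ R ∈ G, D.IsLog (D.answer Δ e m R (C.q ^ a))) :
    (discreteLog 𝒞).SolvableInPolyTime := by
  classical
  -- The coins are `q ^ a` trials, each of `q ^ m` attempts with `q ^ e` coins. A family indexed by
  -- instances and coin strings together yields one program with a time bound for every outcome.
  let J := (i : DLFamily 𝒞) × Fin (2 ^ (i.1.1.q ^ (e + m + a)))
  let C : J → RSCode := fun j => j.1.1.1
  let D : ∀ j : J, DLInst (C j) := fun j => j.1.2
  let x : J → Val := fun j => .pair (dlInput (D j)) (.num j.2)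
  have hx : Comp (fun j => (C j).q) x x := by
    have hv : PolyBdd (fun j => (C j).q) fun j => ((C j).q + 1) * ((C j).q + 1) + 1 :=
      ((PolyBdd.param.add (.const 1)).mul (PolyBdd.param.add (.const 1))).add (.const 1)
    refine Comp.refl (Comp.bdd_pair (Comp.bdd_pair (Comp.bdd_enc.reindex C) (Comp.bdd_pair
      (hv.mono fun j => Comp.size_vec_le_of_deg (D j) le_rfl _)
      (Comp.bdd_pair (hv.mono fun j => Comp.size_vec_le_of_deg (D j) (Nat.le_succ _) _)
        (hv.mono fun j => Comp.size_vec_le_of_deg (D j) (Nat.le_succ _) _)))) ?_)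
    exact ((PolyBdd.param.pow (e + m + a)).add (.const 1)).mono fun j =>
      DLInst.size_num_le_of_lt j.2.2
  obtain ⟨p, t, ⟨c, ht⟩, h⟩ := Comp.answer_comp (Comp.knowsInst hx.fst) Δ (fun j => j.1.1.2) e m a
    hx.snd
  -- The exponent doubles because `q + 2 ≤ q ^ 2` for `q ≥ 2`.
  refine ⟨p, 2 * c, e + m + a, fun i => ⟨fun r hr => ?_, ?_⟩⟩
  · refine ⟨_, _, h ⟨i, ⟨r, hr⟩⟩, (ht _).trans ?_⟩
    rw [pow_mul]
    refine Nat.pow_le_pow_left ?_ c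
    have h2 := i.1.1.two_le_q
    change i.1.1.q + 2 ≤ i.1.1.q ^ 2
    nlinarith
  · obtain ⟨G, hG, hcard, hlog⟩ := hcount i.1.1 i.1.2 i.2
    refine hcard.trans (Nat.mul_le_mul_left 3 (Finset.card_le_card fun R hR => ?_))
    have hR' := Finset.mem_range.1 (hG hR)
    refine Finset.mem_filter.2 ⟨hG hR, _, _, h ⟨i, ⟨R, hR'⟩⟩, _, rfl, ?_, (hlog R hR).2⟩
    have h3 := (hlog R hR).1
    have h4 := i.2.natDegree_h
    change _ < i.1.1.q ^ (i.1.1.gHat - i.1.1.k) - 1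
    rw [← h4]
    exact h3


namespace DLInst

variable {C : RSCode} (D : DLInst C)

/-! ## The multiplicative group -/

theorem natCard_K : Nat.card D.K = C.q ^ D.deg := by
  have := (AdjoinRoot.powerBasis' D.monic).finite
  rw [Module.natCard_eq_pow_finrank (K := C.F) (V := D.K), (AdjoinRoot.powerBasis' D.monic).finrank, AdjoinRoot.powerBasis'_dim, Nat.card_eq_fintype_card, C.card_F]

instance : Finite D.K := Nat.finite_of_card_ne_zero (by
  rw [D.natCard_K]
  have := C.two_le_q
  positivity)

theorem natCard_units : Nat.card D.Kˣ = D.ord := by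
  rw [Nat.card_units, D.natCard_K, ord]

theorem pow_ord (u : D.Kˣ) : u ^ D.ord = 1 := by
  rw [← D.natCard_units, pow_card_eq_one']

theorem mk_ne_zero {p : C.F[X]} (hp : p.degree < D.h.degree) (h0 : p ≠ 0) :
    AdjoinRoot.mk D.h p ≠ 0 := fun h => h0 (by rw [← D.rep_mk hp, h]; simp [rep])

theorem base_ne_zero : AdjoinRoot.mk D.h D.b ≠ 0 := D.mk_ne_zero D.degree_b D.b_ne_zero

theorem target_ne_zero : AdjoinRoot.mk D.h D.t ≠ 0 := by
  obtain ⟨x, hx⟩ := D.exists_log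
  rw [← hx]
  exact pow_ne_zero _ D.base_ne_zero

theorem lin_eq_mk (l : Fin C.n) : D.lin l = AdjoinRoot.mk D.h (X - Polynomial.C (C.point l)) := by
  rw [map_sub, AdjoinRoot.mk_X, AdjoinRoot.mk_C, lin]

/-- In degree one the root of `h` lies in the base field and may be an evaluation point. -/
theorem lin_ne_zero (hdeg : 2 ≤ D.deg) (l : Fin C.n) : D.lin l ≠ 0 := by
  rw [lin_eq_mk]
  refine D.mk_ne_zero (D.degree_lt_of_natDegree_lt ?_) (X_sub_C_ne_zero _)
  rw [natDegree_X_sub_C]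
  exact hdeg

theorem eval_modulus_ne_zero (hdeg : 2 ≤ D.deg) (a : C.F) : D.h.eval a ≠ 0 := fun h => by
  have h1 := degree_eq_one_of_irreducible_of_root D.irreducible h
  have h2 := (degree_eq_iff_natDegree_eq_of_pos one_pos).1 h1
  simp only [deg] at hdeg
  omega

/-- The base of the logarithm, as a unit. -/
noncomputable def base : D.Kˣ := Units.mk0 _ D.base_ne_zero

/-- The element whose logarithm is sought, as a unit. -/
noncomputable def target : D.Kˣ := Units.mk0 _ D.target_ne_zero

theorem exists_log_lt : ∃ x < D.ord, D.base ^ x = D.target := by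
  obtain ⟨x, hx⟩ := D.exists_log
  refine ⟨x % D.ord, Nat.mod_lt _ D.ord_pos, ?_⟩
  have h : D.base ^ x = D.target := Units.ext (by simpa [base, target] using hx)
  rw [← h]
  conv_rhs => rw [← Nat.div_add_mod x D.ord, pow_add, pow_mul, pow_ord, one_pow, one_mul]

theorem isLog_of_pow_eq {x : ℕ} (hx : x < D.ord) (h : D.base ^ x = D.target) : D.IsLog x :=
  ⟨hx, by simpa [base, target] using congrArg Units.val h⟩

/-- Powers of a unit with exponents modulo the group order. -/
noncomputable def powHom (u : D.Kˣ) : ZMod D.ord →+ Additive D.Kˣ :=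
  ZMod.lift D.ord ⟨zmultiplesHom _ (Additive.ofMul u), by
    rw [zmultiplesHom_apply, natCast_zsmul, ← ofMul_pow, pow_ord, ofMul_one]⟩

theorem powHom_natCast (u : D.Kˣ) (k : ℕ) :
    D.powHom u (k : ZMod D.ord) = Additive.ofMul (u ^ k) := by
  have := ZMod.lift_coe D.ord ⟨zmultiplesHom _ (Additive.ofMul u), by
    rw [zmultiplesHom_apply, natCast_zsmul, ← ofMul_pow, pow_ord, ofMul_one]⟩ (k : ℤ)
  rw [Int.cast_natCast] at this
  rw [powHom, this]
  simp

theorem powHom_apply (u : D.Kˣ) (z : ZMod D.ord) :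
    D.powHom u z = Additive.ofMul (u ^ z.val) := by
  rw [← powHom_natCast, ZMod.natCast_zmod_val]

variable (hdeg : 2 ≤ D.deg)

/-- The factor base, together with `b` and `t`. -/
noncomputable def gen : Fin (C.n + 2) → D.Kˣ :=
  Fin.append (fun l => Units.mk0 (D.lin l) (D.lin_ne_zero hdeg l)) ![D.base, D.target]

theorem gen_castAdd (l : Fin C.n) :
    D.gen hdeg (Fin.castAdd 2 l) = Units.mk0 (D.lin l) (D.lin_ne_zero hdeg l) := by
  rw [gen, Fin.append_left]

theorem gen_posB : D.gen hdeg (posB C) = D.base := by rw [gen, posB, Fin.append_right]; rfl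

theorem gen_posT : D.gen hdeg (posT C) = D.target := by rw [gen, posT, Fin.append_right]; rfl

/-- The product of powers with the given exponents, as a homomorphism. -/
noncomputable def theta : D.Row →+ Additive D.Kˣ :=
  ∑ l, (D.powHom (D.gen hdeg l)).comp (Pi.evalAddMonoidHom _ l)

theorem theta_apply (v : D.Row) :
    D.theta hdeg v = ∑ l, D.powHom (D.gen hdeg (Fin.castAdd 2 l)) (v (Fin.castAdd 2 l)) +
      (D.powHom D.base (v (posB C)) + D.powHom D.target (v (posT C))) := by
  rw [theta, AddMonoidHom.finsetSum_apply, Fin.sum_univ_add, Fin.sum_univ_two,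
    ← gen_posB D hdeg, ← gen_posT D hdeg]
  rfl

theorem power_eq (v : D.Row) : D.power v = (Additive.toMul (D.theta hdeg v) : D.Kˣ) := by
  rw [theta_apply, toMul_add, toMul_add, toMul_sum, Units.val_mul, Units.val_mul,
    Units.coe_prod, power, mul_assoc]
  congr 1
  · refine Finset.prod_congr rfl fun l _ => ?_
    rw [powHom_apply, gen_castAdd, toMul_ofMul, Units.val_pow_eq_pow_val, Units.val_mk0]
  · rw [powHom_apply, powHom_apply, toMul_ofMul, toMul_ofMul, Units.val_pow_eq_pow_val,
      Units.val_pow_eq_pow_val]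
    rfl

theorem theta_mask (f : D.K) (cand : Val) :
    ((Additive.toMul (D.theta hdeg (D.mask f cand)) : D.Kˣ) : D.K) =
      ∏ l, (open Classical in if D.Agrees f cand l then D.lin l else 1) := by
  have h0 : ∀ i : Fin 2, D.mask f cand (Fin.natAdd C.n i) = 0 := fun i => by
    have : ¬ ∃ h : ((Fin.natAdd C.n i : Fin (C.n + 2)) : ℕ) < C.n,
        D.Agrees f cand ⟨(Fin.natAdd C.n i : Fin (C.n + 2)), h⟩ := by
      rintro ⟨h, -⟩
      simp at h
    rw [mask, bit, if_neg this, Nat.cast_zero]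
  rw [theta_apply, h0, h0, map_zero, map_zero, add_zero, add_zero, toMul_sum, Units.coe_prod]
  refine Finset.prod_congr rfl fun l _ => ?_
  rw [mask, powHom_natCast, gen_castAdd, toMul_ofMul, Units.val_pow_eq_pow_val, Units.val_mk0]
  have : (∃ h : ((Fin.castAdd 2 l : Fin (C.n + 2)) : ℕ) < C.n,
      D.Agrees f cand ⟨(Fin.castAdd 2 l : Fin (C.n + 2)), h⟩) ↔ D.Agrees f cand l :=
    ⟨fun ⟨_, h⟩ => h, fun h => ⟨l.2, h⟩⟩
  rw [bit, propext this]
  split_ifs <;> simp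

theorem good_of_search {f : D.K} {out cand : Val} {k : ℕ} (h : D.search f out k = some cand) :
    D.Good f cand := by
  induction k with
  | zero => simp [search] at h
  | succ k ih =>
    rw [search] at h
    split_ifs at h with h1 h2
    · exact ih h
    · rwa [← Option.some.inj h]

theorem search_ne_none {f : D.K} {out : Val} {j k : ℕ} (hj : j < k) (h : D.Good f (out.entry j)) :
    D.search f out k ≠ none := by
  induction k with
  | zero => omega
  | succ k ih =>
    rw [search]
    rcases Nat.lt_succ_iff_lt_or_eq.1 hj with h1 | rfl
    · rw [if_pos (ih h1)]
      exact ih h1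
    · by_cases h2 : D.search f out j ≠ none
      · rwa [if_pos h2]
      · rw [if_neg h2, if_pos h]
        simp

variable {𝒞 : Set RSCode} (Δ : Decoder 𝒞)

/-- Holds for every output of the decoder, correct or not, because `search` returns only candidates
whose product has been compared with `f`. -/
theorem attempt_mem {r : ℕ} {v w : D.Row} (h : D.attempt Δ r v = some w) :
    w ∈ (D.theta hdeg).ker := by
  rw [attempt, Option.map_eq_some_iff] at h
  obtain ⟨cand, h1, rfl⟩ := h
  rw [AddMonoidHom.mem_ker, map_sub, sub_eq_zero]
  refine Additive.toMul.injective (Units.ext ?_)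
  rw [theta_mask, ← power_eq]
  exact (D.good_of_search h1).symm

theorem relations_mem (s : ℕ → ℕ × D.Row) (k : ℕ) :
    ∀ w ∈ D.relations Δ s k, w ∈ (D.theta hdeg).ker := by
  induction k with
  | zero => simp [relations]
  | succ k ih =>
    rw [relations]
    cases h : D.attempt Δ (s k).1 (s k).2 with
    | none => exact ih
    | some r =>
      intro w hw
      rcases List.mem_cons.1 hw with rfl | hw
      · exact D.attempt_mem hdeg Δ h
      · exact ih w hw

/-! ## Correctness of the result of the elimination -/

/-- The rows with vanishing entry at `l`. -/
noncomputable def vanish (l : Fin (C.n + 2)) : AddSubgroup D.Row :=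
  (Pi.evalAddMonoidHom (fun _ => ZMod D.ord) l).ker

theorem elimRows_mem (H : AddSubgroup D.Row) {rs : List D.Row} (h : ∀ v ∈ rs, v ∈ H) (k : ℕ) :
    ∀ v ∈ D.elimRows rs k, v ∈ H := by
  induction k with
  | zero => exact h
  | succ k ih =>
    rw [elimRows]
    split_ifs
    · exact elimCol_mem _ _ H ih
    · exact ih

/-- A cleared column stays clear, since later row operations preserve the subgroup of rows that
vanish there. -/
theorem elimRows_vanish (rs : List D.Row) (k : ℕ) (l : Fin C.n) (hl : (l : ℕ) < k) :
    ∀ v ∈ D.elimRows rs k, v (Fin.castAdd 2 l) = 0 := by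
  induction k with
  | zero => omega
  | succ k ih =>
    rw [elimRows]
    split_ifs with hk
    · rcases Nat.lt_succ_iff_lt_or_eq.1 hl with h1 | rfl
      · exact elimCol_mem _ _ (D.vanish (Fin.castAdd 2 l)) (ih h1)
      · exact elimCol_head (C.q ^ 2) (D.head l)
          (Pi.evalAddMonoidHom (fun _ => ZMod D.ord) (Fin.castAdd 2 l))
          (fun v => (ZMod.natCast_zmod_val (v (Fin.castAdd 2 l))).symm)
          (fun v => (ZMod.val_lt _).trans D.ord_lt) _
    · have := l.2
      exact ih (by omega)

/-- The row that remains after the elimination. -/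
noncomputable def lastRow (rs : List D.Row) : D.Row := (D.elimRows rs C.n).headD 0

theorem lastRow_mem (H : AddSubgroup D.Row) {rs : List D.Row} (h : ∀ v ∈ D.elimRows rs C.n, v ∈ H) :
    D.lastRow rs ∈ H := by
  rw [lastRow]
  cases h1 : D.elimRows rs C.n with
  | nil => exact H.zero_mem
  | cons a l => exact h a (by simp [h1])

/-- Euclid's algorithm pairs the last row `v` with the zero row, whose entry `0` is represented by
`N`. The head becomes `gcd(N, v_t) = 1`, so the resulting row `A` is still a relation without factor
base, now with exponent `1` at `t`. Thus `t = b ^ (-A_b)`. -/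
theorem isLog_logOf {rs : List D.Row} (hrs : ∀ w ∈ rs, w ∈ (D.theta hdeg).ker)
    (hu : IsUnit (D.lastRow rs (posT C))) : D.IsLog (D.logOf rs) := by
  set v := D.lastRow rs with hv
  set A := (euclid (C.q ^ 2) ((D.ord, (0 : D.Row)), ((v (posT C)).val, v))).1.2 with hA
  have hlt : (v (posT C)).val < 2 ^ (C.q ^ 2) := (ZMod.val_lt _).trans D.ord_lt
  have hmem : ∀ H : AddSubgroup D.Row, v ∈ H → A ∈ H := fun H h =>
    (euclid_mem H (C.q ^ 2) (s := ((D.ord, (0 : D.Row)), ((v (posT C)).val, v))) H.zero_mem h).1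
  have h1 : A ∈ (D.theta hdeg).ker := hmem _ (D.lastRow_mem _ (D.elimRows_mem _ hrs _))
  have h2 : ∀ l, A (Fin.castAdd 2 l) = 0 := fun l =>
    hmem (D.vanish _) (D.lastRow_mem _ (D.elimRows_vanish rs C.n l l.2))
  have h3 : A (posT C) = 1 := by
    have h4 := (euclid_map (Pi.evalAddMonoidHom (fun _ => ZMod D.ord) (posT C)) (C.q ^ 2)
      (s := ((D.ord, (0 : D.Row)), ((v (posT C)).val, v))) (by simp)
      (ZMod.natCast_zmod_val (v (posT C))).symm).1
    rw [euclid_fst_fst _ _ hlt] at h4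
    have h5 : Nat.gcd D.ord (v (posT C)).val = 1 :=
      Nat.Coprime.symm ((ZMod.isUnit_iff_coprime _ _).1 (by rwa [ZMod.natCast_zmod_val]))
    simp only [h5, Nat.cast_one] at h4
    exact h4
  rw [AddMonoidHom.mem_ker, theta_apply, h3] at h1
  simp only [h2, map_zero, Finset.sum_const_zero, zero_add] at h1
  have h6 : D.powHom D.base (-A (posB C)) = D.powHom D.target 1 := by
    rw [map_neg]
    exact neg_eq_of_add_eq_zero_right h1
  have h7 := D.powHom_natCast D.target 1
  rw [Nat.cast_one, pow_one] at h7
  rw [h7, powHom_apply] at h6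
  exact D.isLog_of_pow_eq (ZMod.val_lt _) (Additive.ofMul.injective h6)

/-! ## Equidistribution of the exponent of `t` -/

/-- The discrete logarithm. -/
noncomputable def log : ℕ := D.exists_log_lt.choose

theorem base_pow_log : D.base ^ D.log = D.target := D.exists_log_lt.choose_spec.2

/-- The relation `t = b ^ log`. -/
noncomputable def relW : D.Row := Pi.single (posT C) 1 - Pi.single (posB C) (D.log : ZMod D.ord)

theorem posB_ne_posT : posB C ≠ posT C := by simp [posB, posT, Fin.ext_iff]

theorem relW_posT : D.relW (posT C) = 1 := by
  rw [relW, Pi.sub_apply, Pi.single_eq_same, Pi.single_eq_of_ne posB_ne_posT.symm, sub_zero]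

theorem relW_castAdd (l : Fin C.n) : D.relW (Fin.castAdd 2 l) = 0 := by
  have h : ∀ i, Fin.castAdd 2 l ≠ Fin.natAdd C.n i := fun i h => by
    have := congrArg Fin.val h
    simp at this
    omega
  rw [relW, Pi.sub_apply, Pi.single_eq_of_ne (h _), Pi.single_eq_of_ne (h _), sub_zero]

theorem relW_mem : D.relW ∈ (D.theta hdeg).ker := by
  have h7 := D.powHom_natCast D.target 1
  rw [Nat.cast_one, pow_one] at h7
  have hB : D.relW (posB C) = -(D.log : ZMod D.ord) := by
    rw [relW, Pi.sub_apply, Pi.single_eq_of_ne posB_ne_posT, Pi.single_eq_same, zero_sub]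
  rw [AddMonoidHom.mem_ker, theta_apply, hB, relW_posT, h7, map_neg, powHom_natCast, base_pow_log]
  simp [relW_castAdd]

/-- The multiples of the relation `t = b ^ log`. -/
noncomputable def trivialRel : AddSubgroup D.Row := AddSubgroup.zmultiples D.relW

theorem trivialRel_le : D.trivialRel ≤ (D.theta hdeg).ker := by
  rw [trivialRel, AddSubgroup.zmultiples_le]
  exact D.relW_mem hdeg

theorem trivialRel_le_vanish (l : Fin C.n) : D.trivialRel ≤ D.vanish (Fin.castAdd 2 l) := by
  rw [trivialRel, AddSubgroup.zmultiples_le]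
  exact D.relW_castAdd l

theorem head_add (l : Fin C.n) (v : D.Row) {w : D.Row} (hw : w ∈ D.trivialRel) :
    D.head l (v + w) = D.head l v := by
  have : w (Fin.castAdd 2 l) = 0 := D.trivialRel_le_vanish l hw
  rw [head, head, Pi.add_apply, this, add_zero]

/-- The trivial relation has zero entries in the factor base columns, so shifts by its multiples
leave all heads, and hence all quotients of the elimination, unchanged. -/
theorem elimRows_shiftable (rs : List D.Row) (k : ℕ) :
    Shiftable D.trivialRel (fun rs => D.elimRows rs k) rs := by
  induction k with
  | zero => exact Shiftable.id
  | succ k ih =>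
    by_cases hk : k < C.n
    · have h : (fun rs => D.elimRows rs (k + 1)) =
          fun rs => elimCol (C.q ^ 2) (D.head ⟨k, hk⟩) (D.elimRows rs k) := by
        funext rs
        rw [elimRows, dif_pos hk]
      rw [h]
      exact ih.comp (elimCol_shiftable (fun v w hw => D.head_add _ v hw) _)
    · have h : (fun rs => D.elimRows rs (k + 1)) = fun rs => D.elimRows rs k := by
        funext rs
        rw [elimRows, dif_neg hk]
      rw [h]
      exact ih

include hdeg in
-- The value of a trivial relation is `1`, so the decoder receives the same word with the same coins
-- and the same candidate is found; only the recorded exponents move.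
theorem attempt_add {r : ℕ} {v w : D.Row} (hw : w ∈ D.trivialRel) :
    D.attempt Δ r (v + w) = (D.attempt Δ r v).map (· + w) := by
  have h : D.power (v + w) = D.power v := by
    rw [power_eq D hdeg, power_eq D hdeg, map_add, D.trivialRel_le hdeg hw, add_zero]
  rw [attempt, attempt, h, Option.map_map]
  congr 1
  funext cand
  simp only [Function.comp_apply]
  abel

/-- Two sequences of samples with the same coin tosses and with exponents that agree up to the
relation `t = b ^ log`. -/
def Sim (s s' : ℕ → ℕ × D.Row) : Prop := ∀ i, (s' i).1 = (s i).1 ∧ (s' i).2 - (s i).2 ∈ D.trivialRel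

/-- Adding exponents to a sequence of samples. -/
noncomputable def addExp (s : ℕ → ℕ × D.Row) (δ : ℕ → D.Row) : ℕ → ℕ × D.Row := fun i => ((s i).1, (s i).2 + δ i)

include hdeg in
theorem relations_congr {s s' : ℕ → ℕ × D.Row} (h : D.Sim s s') (k : ℕ) :
    CongrMod D.trivialRel (D.relations Δ s k) (D.relations Δ s' k) := by
  induction k with
  | zero => exact .nil
  | succ k ih =>
    have h1 := D.attempt_add hdeg Δ (r := (s k).1) (v := (s k).2) (h k).2
    rw [add_sub_cancel] at h1
    rw [relations, relations, (h k).1, h1]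
    cases D.attempt Δ (s k).1 (s k).2 with
    | none => exact ih
    | some r => exact .cons (by simpa using (h k).2) ih

include hdeg in
-- Relations correspond to successful attempts, and shifting the exponents of such an attempt shifts
-- its relation. At failed attempts any trivial shift will do.
theorem relations_shift (s : ℕ → ℕ × D.Row) (k : ℕ) {d : List D.Row}
    (hd : ShiftFor D.trivialRel (D.relations Δ s k) d) :
    ∃ δ : ℕ → D.Row, (∀ i, δ i ∈ D.trivialRel) ∧ ∀ s', D.Sim s s' →
      D.relations Δ (D.addExp s' δ) k = List.zipWith (· + ·) (D.relations Δ s' k) d := by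
  induction k generalizing d with
  | zero => exact ⟨0, fun i => D.trivialRel.zero_mem, fun s' _ => rfl⟩
  | succ k ih =>
    have hs : ∀ s', D.Sim s s' → D.attempt Δ (s' k).1 (s' k).2 =
        (D.attempt Δ (s k).1 (s k).2).map (· + ((s' k).2 - (s k).2)) := fun s' h => by
      rw [← D.attempt_add hdeg Δ (h k).2, add_sub_cancel, (h k).1]
    -- The first `k` attempts do not see `δ k`, which is overwritten below when attempt `k`
    -- succeeds.
    have hlocal : ∀ (s' : ℕ → ℕ × D.Row) (δ δ' : ℕ → D.Row), (∀ i < k, δ i = δ' i) →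
        D.relations Δ (D.addExp s' δ) k = D.relations Δ (D.addExp s' δ') k := by
      intro s' δ δ' h
      have : ∀ j ≤ k, D.relations Δ (D.addExp s' δ) j = D.relations Δ (D.addExp s' δ') j := by
        intro j
        induction j with
        | zero => exact fun _ => rfl
        | succ j ihj =>
          intro hj
          rw [relations, relations, ihj (by omega)]
          simp only [addExp, h j hj]
      exact this k le_rfl
    rw [relations] at hd
    cases h : D.attempt Δ (s k).1 (s k).2 with
    | none =>
      rw [h] at hd
      obtain ⟨δ, hδ, hδ'⟩ := ih hd
      refine ⟨δ, hδ, fun s' h' => ?_⟩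
      have h1 := hs s' h'
      rw [h] at h1
      have h2 := D.attempt_add hdeg Δ (r := (s' k).1) (v := (s' k).2) (hδ k)
      rw [h1] at h2
      rw [relations, relations, h1]
      simp only [addExp] at h2 ⊢
      rw [h2]
      exact hδ' s' h'
    | some r =>
      rw [h] at hd
      obtain ⟨hlen, hmem⟩ := hd
      cases d with
      | nil => simp at hlen
      | cons e d =>
        obtain ⟨δ, hδ, hδ'⟩ := ih (d := d) ⟨by simpa using hlen, fun v hv => hmem v (by simp [hv])⟩
        have he := hmem e (by simp)
        refine ⟨Function.update δ k e, fun i => ?_, fun s' h' => ?_⟩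
        · rcases eq_or_ne i k with rfl | hi
          · simpa using he
          · simpa [hi] using hδ i
        · have h1 := hs s' h'
          rw [h] at h1
          have h2 := D.attempt_add hdeg Δ (r := (s' k).1) (v := (s' k).2) he
          rw [h1] at h2
          rw [relations, relations, h1,
            hlocal s' (Function.update δ k e) δ fun i hi => by simp [hi.ne], hδ' s' h']
          simp only [addExp, Function.update_self] at h2 ⊢
          rw [h2]
          rfl

/-- The exponent of `t` in the relation that remains after the elimination. -/
noncomputable def lastExp (s : ℕ → ℕ × D.Row) (k : ℕ) : ZMod D.ord :=
  D.lastRow (D.relations Δ s k) (posT C)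

include hdeg in
-- The first surviving row is to be shifted by `relW`, whose entry at `t` is `1`, and the other rows
-- by `0`; this is pulled back through the elimination and then to the samples. That one `δ` serves
-- all `s'` similar to `s` is what makes the induced map on samples injective.
theorem exists_shift_lastExp (s : ℕ → ℕ × D.Row) (k : ℕ)
    (hlen : C.n < (D.relations Δ s k).length) :
    ∃ δ : ℕ → D.Row, (∀ i, δ i ∈ D.trivialRel) ∧ ∀ s', D.Sim s s' →
      D.lastExp Δ (D.addExp s' δ) k = D.lastExp Δ s' k + 1 := by
  have hsh := D.elimRows_shiftable (D.relations Δ s k) C.n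
  have hpos : (D.elimRows (D.relations Δ s k) C.n).length ≠ 0 := by
    rw [length_elimRows _ _ le_rfl]
    omega
  obtain ⟨d, hd, h⟩ := hsh.2 (D.relW ::
      List.replicate ((D.elimRows (D.relations Δ s k) C.n).length - 1) 0) ⟨by simp; omega, fun v hv => by
    rcases List.mem_cons.1 hv with rfl | hv
    · exact AddSubgroup.mem_zmultiples _
    · rw [List.eq_of_mem_replicate hv]
      exact D.trivialRel.zero_mem⟩
  obtain ⟨δ, hδ, h'⟩ := D.relations_shift hdeg Δ s k hd
  refine ⟨δ, hδ, fun s' hs => ?_⟩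
  have h1 := D.relations_congr hdeg Δ hs k
  have h2 := (hsh.1 _ h1).length_eq
  have h4 := h _ h1
  simp only at h2 h4
  rw [lastExp, lastExp, h' s' hs, lastRow, lastRow, h4]
  cases h3 : D.elimRows (D.relations Δ s' k) C.n with
  | nil =>
    rw [h3] at h2
    exact absurd h2 hpos
  | cons a l =>
    simp [relW_posT]

end DLInst

theorem Decoder.size_run_le {𝒞 : Set RSCode} (Δ : Decoder 𝒞) {C : RSCode} (hC : C ∈ 𝒞)
    (y : Fin C.n → C.F) {r : ℕ} (hr : r < 2 ^ (C.q ^ Δ.coins)) :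
    (Δ.run C y r).size ≤ C.q ^ Δ.exponent := by
  obtain ⟨t, ht, h⟩ := Δ.runs C hC y r hr
  exact h.size_le.2.trans ht

namespace DLInst

variable {C : RSCode} (D : DLInst C)

/-! ## Codewords from factorizations -/

/-- The polynomial whose roots are the points in `A`. -/
noncomputable def rootPoly (C : RSCode) (A : Finset (Fin C.n)) : C.F[X] :=
  ∏ l ∈ A, (X - Polynomial.C (C.point l))

theorem rootPoly_monic (A : Finset (Fin C.n)) : (rootPoly C A).Monic :=
  monic_prod_of_monic _ _ fun _ _ => monic_X_sub_C _

theorem natDegree_rootPoly (A : Finset (Fin C.n)) : (rootPoly C A).natDegree = A.card := by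
  rw [rootPoly, natDegree_prod_of_monic _ _ fun _ _ => monic_X_sub_C _]
  simp

theorem eval_rootPoly_eq_zero_iff (A : Finset (Fin C.n)) (l : Fin C.n) :
    (rootPoly C A).eval (C.point l) = 0 ↔ l ∈ A := by
  rw [rootPoly, eval_prod, Finset.prod_eq_zero_iff]
  simp [sub_eq_zero]

/-- The product of the elements of the factor base that belong to the points in `A`. -/
noncomputable def smooth (A : Finset (Fin C.n)) : D.K := ∏ l ∈ A, D.lin l

theorem smooth_eq_mk (A : Finset (Fin C.n)) : D.smooth A = AdjoinRoot.mk D.h (rootPoly C A) := by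
  rw [smooth, rootPoly, map_prod]
  exact Finset.prod_congr rfl fun l _ => D.lin_eq_mk l

theorem rep_smooth (A : Finset (Fin C.n)) : D.rep (D.smooth A) = rootPoly C A %ₘ D.h := by
  rw [smooth_eq_mk, rep, AdjoinRoot.modByMonicHom_mk]

/-- The codeword that reveals the factorization of `D.smooth A`. -/
noncomputable def wordOf (A : Finset (Fin C.n)) (l : Fin C.n) : C.F :=
  (rootPoly C A /ₘ D.h - X ^ C.k).eval (C.point l)

theorem gHat_eq : C.gHat = C.k + D.deg := by
  have h1 := D.natDegree_h
  have h2 := D.deg_pos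
  simp only [deg] at h2 ⊢
  omega

/-- As `ĝ = k + deg h`, the quotient of `rootPoly C A` by `h` is monic of degree exactly `k`, and
subtracting `X ^ k` brings the degree below `k`. -/
theorem isCodeword_wordOf {A : Finset (Fin C.n)} (hA : A.card = C.gHat) :
    C.IsCodeword (D.wordOf A) := by
  refine ⟨rootPoly C A /ₘ D.h - X ^ C.k, ?_, fun l => rfl⟩
  have hle : D.h.degree ≤ (rootPoly C A).degree := by
    rw [degree_eq_natDegree D.monic.ne_zero, degree_eq_natDegree (rootPoly_monic A).ne_zero,
      natDegree_rootPoly, hA, D.gHat_eq]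
    exact_mod_cast Nat.le_add_left _ _
  have hmonic : (rootPoly C A /ₘ D.h).Monic := by
    rw [Monic, leadingCoeff_divByMonic_of_monic D.monic hle, (rootPoly_monic A).leadingCoeff]
  have hnat : (rootPoly C A /ₘ D.h).natDegree = C.k := by
    rw [natDegree_divByMonic _ D.monic, natDegree_rootPoly, hA, D.gHat_eq]
    simp [deg]
  have hdegree : (rootPoly C A /ₘ D.h).degree = C.k := by
    rw [degree_eq_natDegree hmonic.ne_zero, hnat]
  have h1 := degree_sub_lt_left (p := rootPoly C A /ₘ D.h) (q := X ^ C.k) (by rw [hdegree, degree_X_pow])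
    hmonic.ne_zero (by rw [hmonic.leadingCoeff, leadingCoeff_X_pow])
  rwa [hdegree] at h1

/-- Evaluate `rootPoly C A = r + h * Q` at the point and divide by the nonzero value of `h`:
agreement means that `rootPoly C A` vanishes. Agreement exactly on `A` gives the distance `n - ĝ`,
and also shows that the codeword determines `A` once `f` is fixed. -/
theorem wordOf_eq_received_iff (hdeg : 2 ≤ D.deg) (A : Finset (Fin C.n)) (l : Fin C.n) :
    D.wordOf A l = D.received (D.smooth A) l ↔ l ∈ A := by
  have h0 := D.eval_modulus_ne_zero hdeg (C.point l)
  have h1 := congrArg (eval (C.point l)) (modByMonic_add_div (rootPoly C A) D.h)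
  rw [eval_add, eval_mul] at h1
  rw [← eval_rootPoly_eq_zero_iff A l, wordOf, received, rep_smooth, eval_sub, eval_pow, eval_X,
    sub_left_inj, ← h1, eq_neg_iff_add_eq_zero, eq_comm, eq_comm (b := (0 : C.F))]
  constructor
  · intro h
    field_simp at h
    linear_combination h
  · intro h
    field_simp
    linear_combination h

open Classical in
theorem hammingDist_wordOf_le (hdeg : 2 ≤ D.deg) {A : Finset (Fin C.n)} (hA : A.card = C.gHat) :
    hammingDist (D.wordOf A) (D.received (D.smooth A)) ≤ C.n - C.gHat := by
  have h : (Finset.univ.filter fun l => D.wordOf A l ≠ D.received (D.smooth A) l) = Aᶜ := by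
    ext l
    rw [Finset.mem_filter, Finset.mem_compl, ← D.wordOf_eq_received_iff hdeg A l]
    simp
  rw [hammingDist, h, Finset.card_compl, hA, Fintype.card_fin]

variable {𝒞 : Set RSCode} (Δ : Decoder 𝒞)

/-- The element `f` is a product of `ĝ` elements of the factor base. -/
def IsSmooth (f : D.K) : Prop := ∃ A : Finset (Fin C.n), A.card = C.gHat ∧ D.smooth A = f

theorem good_vec_wordOf (hdeg : 2 ≤ D.deg) (A : Finset (Fin C.n)) :
    D.Good (D.smooth A) (C.vec (D.wordOf A)) := by
  classical
  have h : ∀ l, D.Agrees (D.smooth A) (C.vec (D.wordOf A)) l ↔ l ∈ A := fun l => by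
    rw [Agrees, RSCode.vec_eq_arr, Val.entry_arr, RSCode.elem, RSCode.elem, Val.num.injEq,
      Fin.val_inj, C.label.injective.eq_iff, D.wordOf_eq_received_iff hdeg]
  unfold Good
  simp only [h]
  rw [smooth, Finset.prod_ite_mem, Finset.univ_inter]

/-- For a smooth element, the correct runs of the decoder lead to a factorization. -/
theorem exists_good_coins (hC : C ∈ 𝒞) (hdeg : 2 ≤ D.deg) {f : D.K} (hf : D.IsSmooth f) :
    ∃ G ⊆ Finset.range (2 ^ (C.q ^ Δ.coins)), 2 * 2 ^ (C.q ^ Δ.coins) ≤ 3 * G.card ∧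
      ∀ r ∈ G, ∀ v : D.Row, D.power v = f → D.attempt Δ r v ≠ none := by
  classical
  obtain ⟨A, hA, rfl⟩ := hf
  obtain ⟨G, hG, hcard, h⟩ := Δ.correct C hC (D.received (D.smooth A))
  refine ⟨G, hG, hcard, fun r hr v hv => ?_⟩
  obtain ⟨L, hL, hmem⟩ := h r hr
  have hw : D.wordOf A ∈ L := (hmem _).2 ⟨D.isCodeword_wordOf hA, by
    convert D.hammingDist_wordOf_le hdeg hA⟩
  obtain ⟨j, hj, hjw⟩ := List.mem_iff_getElem.1 hw
  have hsize := Δ.size_run_le hC (D.received (D.smooth A)) (Finset.mem_range.1 (hG hr))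
  have hlen := Val.length_lt_size_ofList (L.map C.vec)
  rw [← hL, List.length_map] at hlen
  rw [attempt, hv, Ne, Option.map_eq_none_iff]
  refine D.search_ne_none (j := j) ?_ ?_
  · have : C.q ^ Δ.exponent ≤ (C.q + 2) ^ Δ.exponent := Nat.pow_le_pow_left (by omega) _
    omega
  · rw [hL, Val.entry_ofList _ _ (by simpa using hj), List.getElem_map, hjw]
    exact D.good_vec_wordOf hdeg A

/-- An element has few factorizations, since the decoder finds all of them. -/
theorem card_factorizations_le (hC : C ∈ 𝒞) (hdeg : 2 ≤ D.deg) (f : D.K) [DecidableEq D.K] :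
    ((Finset.univ.powersetCard C.gHat).filter fun A => D.smooth A = f).card ≤ C.q ^ Δ.exponent := by
  classical
  obtain ⟨G, hG, hcard, h⟩ := Δ.correct C hC (D.received f)
  have hne : G.Nonempty := by
    rw [← Finset.card_pos]
    have : 0 < 2 ^ (C.q ^ Δ.coins) := by positivity
    omega
  obtain ⟨r, hr⟩ := hne
  obtain ⟨L, hL, hmem⟩ := h r hr
  have hsize := Δ.size_run_le hC (D.received f) (Finset.mem_range.1 (hG hr))
  have hlen := Val.length_lt_size_ofList (L.map C.vec)
  rw [← hL, List.length_map] at hlen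
  refine le_trans ?_ ((hlen.le).trans hsize)
  refine le_trans ?_ (List.toFinset_card_le L)
  refine Finset.card_le_card_of_injOn D.wordOf (fun A hA => ?_) fun A hA B hB hAB => ?_
  · obtain ⟨hA1, rfl⟩ := Finset.mem_filter.1 hA
    have hA' := (Finset.mem_powersetCard.1 hA1).2
    rw [List.coe_toFinset]
    exact (hmem _).2 ⟨D.isCodeword_wordOf hA', by
      convert D.hammingDist_wordOf_le hdeg hA'⟩
  · obtain ⟨-, hA⟩ := Finset.mem_filter.1 hA
    obtain ⟨-, hB⟩ := Finset.mem_filter.1 hB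
    ext l
    rw [← D.wordOf_eq_received_iff hdeg, ← D.wordOf_eq_received_iff hdeg, hA, hB, hAB]

/-- By minimality `ĝ - 1` violates the defining inequality, so `C(n, ĝ - 1) ≥ q ^ (ĝ - 1 - k)`. One
factor `q` is lost in the exponent; the other bounds the ratio `C(n, ĝ - 1) / C(n, ĝ) ≤ ĝ ≤ q`. -/
theorem _root_.RSDlog.RSCode.pow_le_choose (C : RSCode) :
    C.q ^ (C.gHat - C.k) ≤ C.n.choose C.gHat * C.q ^ 2 := by
  have hq := C.two_le_q
  have hle := C.gHat_spec.2
  rcases Nat.lt_or_ge C.k C.gHat with hk | hk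
  swap
  · rw [Nat.sub_eq_zero_of_le hk, pow_zero]
    exact Nat.mul_pos (Nat.choose_pos hle) (by positivity)
  obtain ⟨g, hg⟩ : ∃ g, C.gHat = g + 1 := ⟨C.gHat - 1, by omega⟩
  have hmin : g ∉ {g : ℕ | (C.n.choose g : ℚ) / (C.q : ℚ) ^ ((g : ℤ) - (C.k : ℤ)) < 1} :=
    Nat.notMem_of_lt_sInf (show g < C.gHat by omega)
  rw [Set.mem_ofPred_eq, not_lt, ← Nat.cast_sub (by omega), zpow_natCast] at hmin
  have hpos : (0 : ℚ) < (C.q : ℚ) ^ (g - C.k) := by positivity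
  rw [one_le_div hpos] at hmin
  have h1 : C.q ^ (g - C.k) ≤ C.n.choose g := by exact_mod_cast hmin
  have h2 := Nat.choose_succ_right_eq C.n g
  have h3 : C.n.choose g ≤ C.n.choose g * (C.n - g) := Nat.le_mul_of_pos_right _ (by omega)
  have h4 : g + 1 ≤ C.q := by have := C.n_le_q; omega
  rw [hg, show g + 1 - C.k = (g - C.k) + 1 by omega, pow_succ, sq, ← mul_assoc]
  refine Nat.mul_le_mul_right _ (h1.trans (h3.trans ?_))
  rw [← h2]
  exact Nat.mul_le_mul_left _ h4

/-- Many elements are smooth. -/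
theorem card_smooth (hC : C ∈ 𝒞) (hdeg : 2 ≤ D.deg) [DecidableEq D.K] :
    C.q ^ D.deg ≤ ((Finset.univ.powersetCard C.gHat).image D.smooth).card *
      C.q ^ (Δ.exponent + 2) := by
  have h1 := Finset.card_le_mul_card_image (f := D.smooth) (Finset.univ.powersetCard C.gHat)
    (C.q ^ Δ.exponent) fun f _ => D.card_factorizations_le Δ hC hdeg f
  rw [Finset.card_powersetCard, Finset.card_univ, Fintype.card_fin] at h1
  have h2 := C.pow_le_choose
  rw [← D.natDegree_h] at h2
  rw [pow_add]
  calc C.q ^ D.deg ≤ _ := h2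
    _ ≤ _ := Nat.mul_le_mul_right _ h1
    _ = _ := by ring

end DLInst

/-! ## Counting -/

/-- The `i`-th smallest element is at least `i + 1`, so `∏ p / (p - 1)` is at most the telescoping
product of the `(i + 1) / i`. -/
theorem prod_le_card_mul_prod_sub_one (s : Finset ℕ) (hs : ∀ p ∈ s, 2 ≤ p) :
    ∏ p ∈ s, p ≤ (s.card + 1) * ∏ p ∈ s, (p - 1) := by
  induction s using Finset.induction_on_max with
  | empty => simp
  | insert a s hlt ih =>
    have ha : a ∉ s := fun h => lt_irrefl _ (hlt a h)
    have hcard : s.card + 2 ≤ a := by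
      have h1 : s ⊆ Finset.Ico 2 a := fun p hp =>
        Finset.mem_Ico.2 ⟨hs p (Finset.mem_insert_of_mem hp), hlt p hp⟩
      have h2 := Finset.card_le_card h1
      have h3 := hs a (Finset.mem_insert_self _ _)
      rw [Nat.card_Ico] at h2
      omega
    rw [Finset.prod_insert ha, Finset.prod_insert ha, Finset.card_insert_of_notMem ha]
    have h1 := ih fun p hp => hs p (Finset.mem_insert_of_mem hp)
    obtain ⟨b, rfl⟩ : ∃ b, a = s.card + 2 + b := ⟨a - (s.card + 2), by omega⟩
    have e : s.card + 2 + b - 1 = s.card + 1 + b := by omega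
    rw [e]
    calc (s.card + 2 + b) * ∏ p ∈ s, p
        ≤ (s.card + 2 + b) * ((s.card + 1) * ∏ p ∈ s, (p - 1)) := Nat.mul_le_mul_left _ h1
      _ = ((s.card + 2 + b) * (s.card + 1)) * ∏ p ∈ s, (p - 1) := by ring
      _ ≤ ((s.card + 1 + 1) * (s.card + 1 + b)) * ∏ p ∈ s, (p - 1) := by
          refine Nat.mul_le_mul_right _ ?_
          nlinarith
      _ = _ := by ring

/-- `N / φ(N) = ∏ p / (p - 1)` is at most one more than the number of prime divisors, and that
number is less than `B` because their product is at least `2` to its power. -/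
theorem le_totient_mul {N B : ℕ} (h0 : 0 < N) (hB : N < 2 ^ B) : N ≤ N.totient * B := by
  have h1 := Nat.totient_mul_prod_primeFactors N
  have h2 := prod_le_card_mul_prod_sub_one N.primeFactors fun p hp =>
    (Nat.prime_of_mem_primeFactors hp).two_le
  have h3 : 2 ^ N.primeFactors.card ≤ ∏ p ∈ N.primeFactors, p :=
    Finset.pow_card_le_prod _ _ _ fun p hp => (Nat.prime_of_mem_primeFactors hp).two_le
  have h4 : ∏ p ∈ N.primeFactors, p ≤ N := Nat.le_of_dvd h0 (Nat.prod_primeFactors_dvd N)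
  have h5 : N.primeFactors.card < B :=
    (Nat.pow_lt_pow_iff_right (by norm_num)).1 ((h3.trans h4).trans_lt hB)
  have h6 : 0 < ∏ p ∈ N.primeFactors, (p - 1) := Finset.prod_pos fun p hp => by
    have := (Nat.prime_of_mem_primeFactors hp).two_le
    omega
  refine Nat.le_of_mul_le_mul_right ?_ h6
  rw [← h1, mul_assoc]
  exact Nat.mul_le_mul_left _ (h2.trans (Nat.mul_le_mul_right _ h5))

theorem card_le_card_fiber_mul {G H : Type*} [AddGroup G] [Fintype G] [AddGroup H] [Finite H]
    (φ : G →+ H) (v : G) [DecidableEq H] :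
    Fintype.card G ≤ (Finset.univ.filter fun w => φ w = φ v).card * Nat.card H := by
  have := Fintype.ofFinite H
  have h := Finset.card_le_mul_card_image (f := φ) Finset.univ
    (Finset.univ.filter fun w => φ w = φ v).card fun y hy => by
      obtain ⟨w, -, rfl⟩ := Finset.mem_image.1 hy
      exact (AddMonoidHom.card_fiber_eq_of_mem_range φ ⟨w, rfl⟩ ⟨v, rfl⟩).le
  refine h.trans (Nat.mul_le_mul_left _ ?_)
  rw [Nat.card_eq_fintype_card]
  exact Finset.card_le_univ _

/-! ### Success probability of one attempt. -/

namespace DLInst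

variable {C : RSCode} (D : DLInst C) {𝒞 : Set RSCode} (Δ : Decoder 𝒞)

/-- The samples that the attempts use, with exactly uniform exponents. -/
abbrev Sample : Type := Fin (2 ^ (C.q ^ Δ.coins)) × D.Row

theorem card_sample : Fintype.card (D.Sample Δ) = 2 ^ (C.q ^ Δ.coins) * D.ord ^ (C.n + 2) := by
  rw [Fintype.card_prod, Fintype.card_fin, Fintype.card_fun, Fintype.card_fin, ZMod.card]

open Classical in
/-- The samples that lead to a relation. -/
noncomputable def hits : Finset (D.Sample Δ) :=
  Finset.univ.filter fun s => D.attempt Δ s.1 s.2 ≠ none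

/-- The value `f` is attained, at the exponent vector of its own factorization, so its fibre is a
coset of the kernel of `theta`. -/
theorem card_power_fiber (hdeg : 2 ≤ D.deg) {f : D.K} (hf : D.IsSmooth f) [DecidableEq D.K] :
    D.ord ^ (C.n + 2) ≤ (Finset.univ.filter fun v : D.Row => D.power v = f).card * D.ord := by
  classical
  obtain ⟨A, -, rfl⟩ := hf
  set v₀ := D.mask (D.smooth A) (C.vec (D.wordOf A))
  have h0 : D.power v₀ = D.smooth A := by
    rw [power_eq D hdeg, theta_mask]
    exact D.good_vec_wordOf hdeg A
  have h1 := card_le_card_fiber_mul (D.theta hdeg) v₀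
  rw [Fintype.card_fun, Fintype.card_fin, ZMod.card,
    Nat.card_congr (Additive.toMul : Additive D.Kˣ ≃ D.Kˣ), D.natCard_units] at h1
  refine h1.trans (Nat.mul_le_mul_right _ (Finset.card_le_card fun v hv => ?_))
  have hv := (Finset.mem_filter.1 hv).2
  refine Finset.mem_filter.2 ⟨Finset.mem_univ _, ?_⟩
  rw [← h0, power_eq D hdeg, power_eq D hdeg, hv]

/-- A random attempt leads to a relation with non-negligible probability. -/
theorem card_sample_le (hC : C ∈ 𝒞) (hdeg : 2 ≤ D.deg) :
    Fintype.card (D.Sample Δ) ≤ (D.hits Δ).card * C.q ^ (Δ.exponent + 3) := by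
  classical
  set P := 2 ^ (C.q ^ Δ.coins) with hP
  set Sm := (Finset.univ.powersetCard C.gHat).image D.smooth with hSm
  have hfib : ∀ f ∈ Sm, 2 * P * D.ord ^ (C.n + 2) ≤
      3 * D.ord * ((D.hits Δ).filter fun s => D.power s.2 = f).card := by
    intro f hf
    have hf' : D.IsSmooth f := by
      obtain ⟨A, hA, rfl⟩ := Finset.mem_image.1 hf
      exact ⟨A, (Finset.mem_powersetCard.1 hA).2, rfl⟩
    obtain ⟨G, hG, hcard, hgood⟩ := D.exists_good_coins Δ hC hdeg hf'
    set G' : Finset (Fin P) := Finset.univ.filter fun r => (r : ℕ) ∈ G with hG'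
    have hGG : G.card = G'.card := by
      have : G = G'.map Fin.valEmbedding := by
        ext r
        simp only [Finset.mem_map, Fin.valEmbedding_apply, hG', Finset.mem_filter,
          Finset.mem_univ, true_and]
        exact ⟨fun h => ⟨⟨r, Finset.mem_range.1 (hG h)⟩, h, rfl⟩, by rintro ⟨a, h, rfl⟩; exact h⟩
      rw [this, Finset.card_map]
    have hsub : G' ×ˢ (Finset.univ.filter fun v : D.Row => D.power v = f) ⊆
        (D.hits Δ).filter fun s => D.power s.2 = f := by
      rintro ⟨r, v⟩ h
      obtain ⟨h1, h2⟩ := Finset.mem_product.1 h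
      have h1 := (Finset.mem_filter.1 h1).2
      have h2 := (Finset.mem_filter.1 h2).2
      exact Finset.mem_filter.2 ⟨Finset.mem_filter.2 ⟨Finset.mem_univ _, hgood _ h1 _ h2⟩, h2⟩
    have h3 := Finset.card_le_card hsub
    rw [Finset.card_product, ← hGG] at h3
    have h4 := D.card_power_fiber hdeg hf'
    calc 2 * P * D.ord ^ (C.n + 2) ≤ (3 * G.card) * (_ * D.ord) := Nat.mul_le_mul hcard h4
      _ = 3 * D.ord * (G.card * _) := by ring
      _ ≤ _ := Nat.mul_le_mul_left _ h3
  have hsum : ∑ f ∈ Sm, ((D.hits Δ).filter fun s => D.power s.2 = f).card ≤ (D.hits Δ).card := by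
    rw [← Finset.card_biUnion]
    · exact Finset.card_le_card (Finset.biUnion_subset.2 fun f _ => Finset.filter_subset _ _)
    · intro f _ g _ hfg
      refine Finset.disjoint_left.2 fun s hs hs' => hfg ?_
      rw [← (Finset.mem_filter.1 hs).2, (Finset.mem_filter.1 hs').2]
  have h1 := Finset.sum_le_sum hfib
  rw [Finset.sum_const, smul_eq_mul, ← Finset.mul_sum] at h1
  have h2 := h1.trans (Nat.mul_le_mul_left _ hsum)
  have h3 := D.card_smooth Δ hC hdeg
  have h4 : D.ord ≤ Sm.card * C.q ^ (Δ.exponent + 2) := (Nat.sub_le _ _).trans h3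
  rw [card_sample, ← hP]
  have hq := C.two_le_q
  have key : D.ord * (2 * (P * D.ord ^ (C.n + 2))) ≤
      D.ord * (3 * (D.hits Δ).card * C.q ^ (Δ.exponent + 2)) := by
    calc D.ord * (2 * (P * D.ord ^ (C.n + 2)))
        ≤ (Sm.card * C.q ^ (Δ.exponent + 2)) * (2 * (P * D.ord ^ (C.n + 2))) :=
          Nat.mul_le_mul_right _ h4
      _ = (Sm.card * (2 * P * D.ord ^ (C.n + 2))) * C.q ^ (Δ.exponent + 2) := by ring
      _ ≤ (3 * D.ord * (D.hits Δ).card) * C.q ^ (Δ.exponent + 2) := Nat.mul_le_mul_right _ h2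
      _ = _ := by ring
  have key' := Nat.le_of_mul_le_mul_left key D.ord_pos
  -- One more factor `q ≥ 2` absorbs the `3 / 2` that comes from the decoder's success probability.
  have h5 : (D.hits Δ).card * C.q ^ (Δ.exponent + 2) * 2 ≤
      (D.hits Δ).card * C.q ^ (Δ.exponent + 3) := by
    rw [pow_succ C.q (Δ.exponent + 2), ← mul_assoc]
    exact Nat.mul_le_mul_left _ hq
  have h6 : 3 * (D.hits Δ).card * C.q ^ (Δ.exponent + 2) =
      3 * ((D.hits Δ).card * C.q ^ (Δ.exponent + 2)) := by ring
  omega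

end DLInst

/-- Coordinate `i` is uniform: exchanging it with an extra element of `α` is a bijection. -/
theorem card_pi_apply_mem {ι α : Type*} [Fintype ι] [DecidableEq ι] [Fintype α] [DecidableEq α]
    (S : Finset α) (i : ι) :
    (Finset.univ.filter fun ω : ι → α => ω i ∈ S).card * Fintype.card α =
      S.card * Fintype.card (ι → α) := by
  have e : ((Finset.univ.filter fun ω : ι → α => ω i ∈ S) ×ˢ (Finset.univ : Finset α)).card =
      (S ×ˢ (Finset.univ : Finset (ι → α))).card := by
    refine Finset.card_nbij' (fun p => (p.1 i, Function.update p.1 i p.2))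
      (fun p => (Function.update p.2 i p.1, p.2 i)) ?_ ?_ ?_ ?_
    · rintro ⟨ω, a⟩ h
      simpa using h
    · rintro ⟨a, ω⟩ h
      simpa using h
    · rintro ⟨ω, a⟩ _
      simp
    · rintro ⟨a, ω⟩ _
      simp
  rwa [Finset.card_product, Finset.card_product, Finset.card_univ, Finset.card_univ] at e

/-! ### Enough relations, and the distribution of the last exponent. -/

namespace DLInst

variable {C : RSCode} (D : DLInst C) {𝒞 : Set RSCode} (Δ : Decoder 𝒞) {M : ℕ}

/-- A finite sequence of samples, as an infinite one. -/
noncomputable def seqOf (ω : Fin M → D.Sample Δ) : ℕ → ℕ × D.Row := fun i =>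
  if h : i < M then ((ω ⟨i, h⟩).1, (ω ⟨i, h⟩).2) else (0, 0)

theorem relations_ext {s s' : ℕ → ℕ × D.Row} {k : ℕ} (h : ∀ i < k, s i = s' i) :
    D.relations Δ s k = D.relations Δ s' k := by
  induction k with
  | zero => rfl
  | succ k ih => rw [relations, relations, h k (Nat.lt_succ_self k),
      ih fun i hi => h i (Nat.lt_succ_of_lt hi)]

open Classical in
theorem length_relations (s : ℕ → ℕ × D.Row) (k : ℕ) : (D.relations Δ s k).length =
    ∑ i ∈ Finset.range k, if D.attempt Δ (s i).1 (s i).2 ≠ none then 1 else 0 := by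
  induction k with
  | zero => rfl
  | succ k ih =>
    rw [relations, Finset.sum_range_succ, ← ih]
    cases D.attempt Δ (s k).1 (s k).2 with
    | none => simp
    | some r => simp

open Classical in
theorem length_relations_seqOf (ω : Fin M → D.Sample Δ) :
    (D.relations Δ (D.seqOf Δ ω) M).length =
      ∑ i, if ω i ∈ D.hits Δ then 1 else 0 := by
  rw [length_relations, Finset.sum_range]
  refine Finset.sum_congr rfl fun i _ => ?_
  simp [seqOf, hits]

open Classical in
/-- The sample sequences that lead to sufficiently many relations. -/
noncomputable def enough (M : ℕ) : Finset (Fin M → D.Sample Δ) :=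
  Finset.univ.filter fun ω => C.n < (D.relations Δ (D.seqOf Δ ω) M).length

/-- Sufficiently many relations are found with non-negligible probability. -/
theorem card_le_card_enough {κ : ℕ} (hM : 0 < M) (hκ : 2 * C.n * κ ≤ M)
    (hhits : Fintype.card (D.Sample Δ) ≤ (D.hits Δ).card * κ) :
    Fintype.card (Fin M → D.Sample Δ) ≤ 2 * κ * (D.enough Δ M).card := by
  classical
  set Ω := Fintype.card (Fin M → D.Sample Δ) with hΩ
  have hpos : 0 < Fintype.card (D.Sample Δ) := Fintype.card_pos
  have h1 : ∀ i : Fin M, Ω ≤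
      (Finset.univ.filter fun ω : Fin M → D.Sample Δ => ω i ∈ D.hits Δ).card * κ := by
    intro i
    have h := card_pi_apply_mem (D.hits Δ) i
    refine Nat.le_of_mul_le_mul_right ?_ hpos
    calc Ω * Fintype.card (D.Sample Δ) ≤ Ω * ((D.hits Δ).card * κ) := Nat.mul_le_mul_left _ hhits
      _ = ((D.hits Δ).card * Ω) * κ := by ring
      _ = _ := by rw [← h]; ring
  have h2 : ∑ ω : Fin M → D.Sample Δ, (D.relations Δ (D.seqOf Δ ω) M).length =
      ∑ i : Fin M, (Finset.univ.filter fun ω : Fin M → D.Sample Δ => ω i ∈ D.hits Δ).card := by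
    simp only [length_relations_seqOf]
    rw [Finset.sum_comm]
    refine Finset.sum_congr rfl fun i _ => ?_
    rw [Finset.card_filter]
  -- A reverse Markov inequality: there are at most `M` relations on `enough` and at most `n`
  -- elsewhere, whereas the mean is at least `M / κ ≥ 2 * n`.
  have h3 : ∑ ω : Fin M → D.Sample Δ, (D.relations Δ (D.seqOf Δ ω) M).length ≤
      (D.enough Δ M).card * M + Ω * C.n := by
    calc _ ≤ ∑ ω : Fin M → D.Sample Δ, ((if ω ∈ D.enough Δ M then M else 0) + C.n) := by
          refine Finset.sum_le_sum fun ω _ => ?_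
          split_ifs with h
          · exact (D.length_relations_le Δ _ M).trans (Nat.le_add_right _ _)
          · rw [enough, Finset.mem_filter] at h
            simp only [Finset.mem_univ, true_and, not_lt] at h
            omega
      _ = _ := by
          rw [Finset.sum_add_distrib, Finset.sum_const, Finset.card_univ, ← Finset.sum_filter,
            Finset.sum_const, Finset.filter_mem_eq_inter, Finset.univ_inter, smul_eq_mul,
            smul_eq_mul]
  have h4 : M * Ω ≤ (∑ i : Fin M,
      (Finset.univ.filter fun ω : Fin M → D.Sample Δ => ω i ∈ D.hits Δ).card) * κ := by
    have := Finset.sum_le_sum fun i (_ : i ∈ Finset.univ) => h1 i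
    rwa [Finset.sum_const, Finset.card_univ, Fintype.card_fin, smul_eq_mul, ← Finset.sum_mul] at this
  rw [← h2] at h4
  have h5 := h4.trans (Nat.mul_le_mul_right κ h3)
  have h6 := Nat.mul_le_mul_left Ω hκ
  refine Nat.le_of_mul_le_mul_left ?_ hM
  nlinarith

/-- Sample sequences modulo the relation `t = b ^ log`. -/
noncomputable def norm (ω : Fin M → D.Sample Δ) : Fin M → D.Sample Δ :=
  fun i => ((ω i).1, (ω i).2 - ((ω i).2 (posT C)) • D.relW)

theorem smul_relW_mem (z : ZMod D.ord) : z • D.relW ∈ D.trivialRel := by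
  have : z • D.relW = z.val • D.relW := by
    ext l
    simp
  rw [this]
  exact AddSubgroup.nsmul_mem _ (AddSubgroup.mem_zmultiples _) _

theorem sub_smul_relW_add {w : D.Row} (hw : w ∈ D.trivialRel) (v : D.Row) :
    v + w - ((v + w) (posT C)) • D.relW = v - (v (posT C)) • D.relW := by
  obtain ⟨k, rfl⟩ := AddSubgroup.mem_zmultiples_iff.1 hw
  have h : k • D.relW = (k : ZMod D.ord) • D.relW := by
    ext l
    simp
  rw [h, Pi.add_apply, Pi.smul_apply, relW_posT, smul_eq_mul, mul_one, add_smul]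
  abel

theorem sim_norm (ω : Fin M → D.Sample Δ) : D.Sim (D.seqOf Δ (D.norm Δ ω)) (D.seqOf Δ ω) := by
  intro i
  simp only [seqOf]
  split_ifs with h
  · simp only [norm, sub_sub_cancel, true_and]
    exact D.smul_relW_mem _
  · simp

open Classical in
/-- The sample sequences for which the elimination ends with the exponent `u` of `t`. -/
noncomputable def endsWith (M : ℕ) (u : ZMod D.ord) : Finset (Fin M → D.Sample Δ) :=
  (D.enough Δ M).filter fun ω => D.lastExp Δ (D.seqOf Δ ω) M = u

/-- The map `τ` shifts a sample sequence by a `δ` chosen from its normal form. As `τ` preserves the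
normal form, `δ` can be recovered from the image, so `τ` is injective; it raises the last exponent
by `1`. -/
theorem card_endsWith_le_succ (hdeg : 2 ≤ D.deg) (u : ZMod D.ord) :
    (D.endsWith Δ M u).card ≤ (D.endsWith Δ M (u + 1)).card := by
  classical
  have hex : ∀ ω : Fin M → D.Sample Δ, ∃ δ : ℕ → D.Row, (∀ i, δ i ∈ D.trivialRel) ∧
      (C.n < (D.relations Δ (D.seqOf Δ ω) M).length → ∀ s', D.Sim (D.seqOf Δ ω) s' →
        D.lastExp Δ (D.addExp s' δ) M = D.lastExp Δ s' M + 1) := fun ω => by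
    by_cases h : C.n < (D.relations Δ (D.seqOf Δ ω) M).length
    · obtain ⟨δ, hδ, h'⟩ := D.exists_shift_lastExp hdeg Δ (D.seqOf Δ ω) M h
      exact ⟨δ, hδ, fun _ => h'⟩
    · exact ⟨0, fun i => D.trivialRel.zero_mem, fun h' => absurd h' h⟩
  choose δ hδ hδ' using hex
  let τ : (Fin M → D.Sample Δ) → (Fin M → D.Sample Δ) := fun ω i =>
    ((ω i).1, (ω i).2 + δ (D.norm Δ ω) i)
  have hnorm : ∀ ω, D.norm Δ (τ ω) = D.norm Δ ω := fun ω => by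
    funext i
    simp only [norm, τ]
    rw [D.sub_smul_relW_add (hδ _ _)]
  have hrel : ∀ ω, D.relations Δ (D.seqOf Δ (τ ω)) M =
      D.relations Δ (D.addExp (D.seqOf Δ ω) (δ (D.norm Δ ω))) M := fun ω => by
    refine D.relations_ext Δ fun i hi => ?_
    simp only [seqOf, addExp, dif_pos hi, τ]
  refine Finset.card_le_card_of_injOn τ (fun ω hω => ?_) fun ω _ ω' _ h => ?_
  · obtain ⟨h1, h2⟩ := Finset.mem_filter.1 hω
    have h1 := (Finset.mem_filter.1 h1).2
    have h3 : (D.relations Δ (D.seqOf Δ (D.norm Δ ω)) M).length =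
        (D.relations Δ (D.seqOf Δ ω) M).length :=
      (D.relations_congr hdeg Δ (D.sim_norm Δ ω) M).length_eq
    have h4 : (D.relations Δ (D.seqOf Δ (D.norm Δ (τ ω))) M).length =
        (D.relations Δ (D.seqOf Δ (τ ω)) M).length :=
      (D.relations_congr hdeg Δ (D.sim_norm Δ (τ ω)) M).length_eq
    rw [hnorm] at h4
    refine Finset.mem_filter.2 ⟨Finset.mem_filter.2 ⟨Finset.mem_univ _, by omega⟩, ?_⟩
    have h5 := hδ' (D.norm Δ ω) (by omega) _ (D.sim_norm Δ ω)
    rw [h2] at h5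
    rw [← h5, lastExp, lastExp, hrel]
  · have h1 : D.norm Δ ω = D.norm Δ ω' := by rw [← hnorm ω, h, hnorm]
    funext i
    have h2 := congrFun h i
    simp only [τ, h1, Prod.mk.injEq, add_left_inj] at h2
    exact Prod.ext h2.1 h2.2

/-- Adding `1` repeatedly leads from any residue to any other, so all classes have the same size. -/
theorem card_endsWith_le (hdeg : 2 ≤ D.deg) (u u' : ZMod D.ord) :
    (D.endsWith Δ M u).card ≤ (D.endsWith Δ M u').card := by
  have h : ∀ k : ℕ, (D.endsWith Δ M u).card ≤ (D.endsWith Δ M (u + k)).card := by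
    intro k
    induction k with
    | zero => simp
    | succ k ih =>
      rw [Nat.cast_succ, ← add_assoc]
      exact ih.trans (D.card_endsWith_le_succ Δ hdeg _)
  have := h (u' - u).val
  rwa [ZMod.natCast_zmod_val, add_sub_cancel] at this

open Classical in
/-- The sample sequences that lead to the discrete logarithm. -/
noncomputable def winning (M : ℕ) : Finset (Fin M → D.Sample Δ) :=
  Finset.univ.filter fun ω => D.IsLog (D.logOf (D.relations Δ (D.seqOf Δ ω) M))

theorem card_enough_mul_totient_le (hdeg : 2 ≤ D.deg) :
    (D.enough Δ M).card * D.ord.totient ≤ D.ord * (D.winning Δ M).card := by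
  classical
  have h1 : ∀ u : ZMod D.ord, (D.enough Δ M).card ≤ D.ord * (D.endsWith Δ M u).card := fun u => by
    have h := Finset.card_eq_sum_card_fiberwise (f := fun ω => D.lastExp Δ (D.seqOf Δ ω) M)
      (s := D.enough Δ M) (t := Finset.univ) fun _ _ => Finset.mem_univ _
    rw [h]
    refine (Finset.sum_le_sum fun u' _ => D.card_endsWith_le Δ hdeg u' u).trans ?_
    rw [Finset.sum_const, Finset.card_univ, ZMod.card, smul_eq_mul]
  have h2 : ∑ u : (ZMod D.ord)ˣ, (D.endsWith Δ M (u : ZMod D.ord)).card ≤ (D.winning Δ M).card := by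
    rw [← Finset.card_biUnion]
    · refine Finset.card_le_card (Finset.biUnion_subset.2 fun u _ ω hω => ?_)
      refine Finset.mem_filter.2 ⟨Finset.mem_univ _, ?_⟩
      refine D.isLog_logOf hdeg (D.relations_mem hdeg Δ _ _) ?_
      have h3 : D.lastExp Δ (D.seqOf Δ ω) M = u := (Finset.mem_filter.1 hω).2
      rw [lastExp] at h3
      rw [h3]
      exact u.isUnit
    · intro u _ u' _ huu
      refine Finset.disjoint_left.2 fun ω hω hω' => huu (Units.ext ?_)
      rw [← (Finset.mem_filter.1 hω).2, (Finset.mem_filter.1 hω').2]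
  have h3 := Finset.sum_le_sum fun (u : (ZMod D.ord)ˣ) (_ : u ∈ Finset.univ) => h1 u
  rw [Finset.sum_const, Finset.card_univ, ZMod.card_units_eq_totient, smul_eq_mul,
    ← Finset.mul_sum] at h3
  rw [mul_comm]
  exact h3.trans (Nat.mul_le_mul_left _ h2)

/-- A trial with exactly uniform samples succeeds with non-negligible probability. -/
theorem card_le_card_winning (hC : C ∈ 𝒞) (hdeg : 2 ≤ D.deg) :
    Fintype.card (Fin (C.q ^ (Δ.exponent + 5)) → D.Sample Δ) ≤
      C.q ^ (Δ.exponent + 6) * (D.winning Δ (C.q ^ (Δ.exponent + 5))).card := by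
  have hq := C.two_le_q
  have hn := C.n_le_q
  set M := C.q ^ (Δ.exponent + 5) with hM
  set κ := C.q ^ (Δ.exponent + 3) with hκ
  have h1 : 2 * C.n * κ ≤ M := by
    have e : M = (C.q * C.q) * κ := by rw [hM, hκ]; ring
    rw [e]
    exact Nat.mul_le_mul_right _ (Nat.mul_le_mul hq hn)
  have h2 := D.card_le_card_enough Δ (M := M) (by positivity) h1 (D.card_sample_le Δ hC hdeg)
  have h3 := D.card_enough_mul_totient_le Δ (M := M) hdeg
  have h4 := le_totient_mul D.ord_pos D.ord_lt
  have hφ : 0 < D.ord.totient := Nat.totient_pos.2 D.ord_pos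
  refine Nat.le_of_mul_le_mul_left ?_ hφ
  -- The exponent `+ 6` is `+ 3` from `κ`, `+ 1` for the factor `2 ≤ q`, and `+ 2` for the density
  -- of units.
  calc D.ord.totient * Fintype.card (Fin M → D.Sample Δ)
      ≤ D.ord.totient * (2 * κ * (D.enough Δ M).card) := Nat.mul_le_mul_left _ h2
    _ = 2 * κ * ((D.enough Δ M).card * D.ord.totient) := by ring
    _ ≤ 2 * κ * (D.ord * (D.winning Δ M).card) := Nat.mul_le_mul_left _ h3
    _ ≤ C.q * κ * ((D.ord.totient * C.q ^ 2) * (D.winning Δ M).card) := by gcongr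
    _ = D.ord.totient * (C.q ^ (Δ.exponent + 6) * (D.winning Δ M).card) := by rw [hκ]; ring

end DLInst

/-! ## Counting coin tosses -/

theorem exists_digits {N : ℕ} [NeZero N] {n : ℕ} (v : Fin n → ZMod N) :
    ∃ b < N ^ n, ∀ l : Fin n, ((b / N ^ (l : ℕ) : ℕ) : ZMod N) = v l := by
  let b := finFunctionFinEquiv fun l => (⟨(v l).val, ZMod.val_lt _⟩ : Fin N)
  refine ⟨b, b.2, fun l => ?_⟩
  have h : ((finFunctionFinEquiv.symm b l : Fin N) : ℕ) = (v l).val := by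
    simp only [b, Equiv.symm_apply_apply]
  rw [finFunctionFinEquiv_symm_apply_val] at h
  rw [← ZMod.natCast_mod, h, ZMod.natCast_zmod_val]

theorem eq_of_digits_eq {Q K R R' : ℕ} (hR : R < Q ^ K) (hR' : R' < Q ^ K)
    (h : ∀ i < K, R / Q ^ i % Q = R' / Q ^ i % Q) : R = R' := by
  have : finFunctionFinEquiv.symm (⟨R, hR⟩ : Fin (Q ^ K)) = finFunctionFinEquiv.symm ⟨R', hR'⟩ := by
    funext i
    refine Fin.ext ?_
    simpa only [finFunctionFinEquiv_symm_apply_val] using h i i.2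
  exact congrArg Fin.val (finFunctionFinEquiv.symm.injective this)

theorem card_mul_pow_le_card_preimage {α β : Type*} [Fintype α] [Fintype β] [DecidableEq β]
    (F : α → β) {w M : ℕ} (hF : ∀ y, w ≤ (Finset.univ.filter fun x => F x = y).card)
    (W : Finset (Fin M → β)) :
    W.card * w ^ M ≤ (Finset.univ.filter fun ξ : Fin M → α => F ∘ ξ ∈ W).card := by
  classical
  rw [Finset.card_eq_sum_card_fiberwise (f := fun ξ => F ∘ ξ)
    (s := Finset.univ.filter fun ξ : Fin M → α => F ∘ ξ ∈ W) (t := W)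
    (fun ξ hξ => (Finset.mem_filter.1 hξ).2), ← smul_eq_mul, ← Finset.sum_const]
  refine Finset.sum_le_sum fun ω hω => ?_
  calc w ^ M = ∏ _i : Fin M, w := by simp
    _ ≤ ∏ i, (Finset.univ.filter fun x => F x = ω i).card :=
        Finset.prod_le_prod' fun i _ => hF _
    _ = (Fintype.piFinset fun i => Finset.univ.filter fun x => F x = ω i).card :=
        (Fintype.card_piFinset _).symm
    _ ≤ _ := by
        refine Finset.card_le_card fun ξ hξ => ?_
        have h : F ∘ ξ = ω := by
          funext i
          simpa using Fintype.mem_piFinset.1 hξ i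
        simp [h, hω]

/-- Rounding `Q` down to a multiple of `s` loses at most the fraction `s / Q`; by Bernoulli's
inequality `M` coordinates lose at most `M * s / Q ≤ 1 / 2`. -/
theorem pow_le_two_mul_div_pow_mul_pow {Q M s : ℕ} (h : 2 * M * s ≤ Q) (h0 : 0 < s) (hs : s ≤ Q) :
    Q ^ M ≤ 2 * ((Q / s) ^ M * s ^ M) := by
  have h1 : Q ≤ Q / s * s + s := by
    have := Nat.div_add_mod' Q s
    have := Nat.mod_lt Q h0
    omega
  rw [← mul_pow]
  set x := Q / s * s
  have hQ' : (0 : ℝ) < Q := by exact_mod_cast h0.trans_le hs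
  have h2 : (1 : ℝ) + (-(s / Q : ℝ)) ≤ x / Q := by
    rw [← sub_eq_add_neg, sub_le_iff_le_add, ← add_div, le_div_iff₀ hQ', one_mul]
    exact_mod_cast h1
  have h3 : (s : ℝ) / Q ≤ 1 := by
    rw [div_le_one hQ']
    exact_mod_cast hs
  have h4 := one_add_mul_le_pow (a := -(s / Q : ℝ)) (by linarith) M
  have h5 : (1 + (-(s / Q : ℝ))) ^ M ≤ (x / Q : ℝ) ^ M := pow_le_pow_left₀ (by linarith) h2 M
  have h6 : 2 * ((M : ℝ) * (s / Q)) ≤ 1 := by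
    rw [← mul_div_assoc, ← mul_div_assoc, div_le_one hQ', ← mul_assoc]
    exact_mod_cast h
  have h7 : (1 : ℝ) ≤ 2 * (x / Q : ℝ) ^ M := by nlinarith
  rw [div_pow, ← mul_div_assoc, le_div_iff₀ (by positivity), one_mul] at h7
  exact_mod_cast h7

/-- Independent repetitions of an experiment that succeeds with probability at least `1 / c`. -/
theorem three_mul_sub_pow_le {X b c T : ℕ} (hX : 0 < X) (hb : b ≤ X) (h : X ≤ c * b)
    (hT : 2 * c ≤ T) : 3 * (X - b) ^ T ≤ X ^ T := by
  have hX' : (0 : ℝ) < X := by exact_mod_cast hX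
  set y : ℝ := b / X with hy
  have hy0 : 0 ≤ y := by positivity
  have hy1 : y ≤ 1 := by
    rw [hy, div_le_one hX']
    exact_mod_cast hb
  have h1 : (1 : ℝ) ≤ c * y := by
    rw [hy, ← mul_div_assoc, le_div_iff₀ hX', one_mul]
    exact_mod_cast h
  have h2 : (2 : ℝ) * c ≤ T := by exact_mod_cast hT
  -- With `y ≥ 1 / c`, Bernoulli gives `(1 + y) ^ T ≥ 3`, and `(1 - y) * (1 + y) ≤ 1` turns this
  -- into `(1 - y) ^ T ≤ 1 / 3`.
  have h3 := one_add_mul_le_pow (a := y) (by linarith) T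
  have h4 : (3 : ℝ) ≤ (1 + y) ^ T := by nlinarith
  have h5 : ((1 - y) * (1 + y)) ^ T ≤ 1 := pow_le_one₀ (by nlinarith) (by nlinarith)
  rw [mul_pow] at h5
  have h6 : (0 : ℝ) ≤ (1 - y) ^ T := pow_nonneg (by linarith) T
  have h7 : 3 * (1 - y) ^ T ≤ 1 := by nlinarith
  have h8 : (1 - y) = ((X - b : ℕ) : ℝ) / X := by
    rw [Nat.cast_sub hb, sub_div, div_self hX'.ne']
  rw [h8, div_pow, ← mul_div_assoc, div_le_iff₀ (by positivity), one_mul] at h7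
  exact_mod_cast h7

/-! ### From samples to coin strings, and repetition of trials. -/

namespace DLInst

variable {C : RSCode} (D : DLInst C) {𝒞 : Set RSCode} (Δ : Decoder 𝒞)

theorem isLog_answer {e m R J j : ℕ} (hj : j < J) (h : D.IsLog (D.trial Δ e m R j)) :
    D.IsLog (D.answer Δ e m R J) := by
  induction J with
  | zero => omega
  | succ J ih =>
    rw [answer]
    split_ifs with h'
    · exact h'
    · refine ih ?_
      rcases Nat.lt_succ_iff_lt_or_eq.1 hj with h1 | rfl
      · exact h1
      · exact absurd h h'

/-- The sample with code `c`. -/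
noncomputable def sampleOf (c : ℕ) : D.Sample Δ :=
  (⟨c % 2 ^ (C.q ^ Δ.coins), Nat.mod_lt _ (by positivity)⟩, (D.sample Δ.coins c).2)

theorem sample_eq (c : ℕ) :
    D.sample Δ.coins c = (((D.sampleOf Δ c).1 : ℕ), (D.sampleOf Δ c).2) := rfl

theorem sampleOf_add_mul_card (c k : ℕ) :
    D.sampleOf Δ (c + k * Fintype.card (D.Sample Δ)) = D.sampleOf Δ c := by
  have hP : 0 < 2 ^ (C.q ^ Δ.coins) := by positivity
  have e : c + k * Fintype.card (D.Sample Δ) =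
      c + 2 ^ (C.q ^ Δ.coins) * (k * D.ord ^ (C.n + 2)) := by
    rw [card_sample]; ring
  rw [e]
  refine Prod.ext (Fin.ext ?_) (funext fun l => ?_)
  · simp only [sampleOf, Nat.add_mul_mod_self_left]
  · simp only [sampleOf, sample, Nat.add_mul_div_left _ _ hP]
    have h : k * D.ord ^ (C.n + 2) =
        D.ord ^ (l : ℕ) * (k * D.ord ^ (C.n + 1 - l) * D.ord) := by
      have : C.n + 2 = l + (C.n + 1 - l) + 1 := by have := l.2; omega
      calc k * D.ord ^ (C.n + 2) = k * D.ord ^ ((l : ℕ) + (C.n + 1 - l) + 1) := by rw [← this]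
        _ = _ := by ring
    rw [h, Nat.add_mul_div_left _ _ (pow_pos D.ord_pos _)]
    simp

theorem exists_sampleOf_eq (s : D.Sample Δ) :
    ∃ c < Fintype.card (D.Sample Δ), D.sampleOf Δ c = s := by
  obtain ⟨b, hb, h⟩ := exists_digits s.2
  have hP : 0 < 2 ^ (C.q ^ Δ.coins) := by positivity
  refine ⟨s.1 + 2 ^ (C.q ^ Δ.coins) * b, ?_, ?_⟩
  · rw [card_sample]
    have h1 := s.1.2
    have h2 := Nat.mul_le_mul_left (2 ^ (C.q ^ Δ.coins)) (Nat.succ_le_of_lt hb)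
    rw [Nat.mul_succ] at h2
    omega
  · refine Prod.ext (Fin.ext ?_) (funext fun l => ?_)
    · simp only [sampleOf, Nat.add_mul_mod_self_left, Nat.mod_eq_of_lt s.1.2]
    · simp only [sampleOf, sample, Nat.add_mul_div_left _ _ hP, Nat.div_eq_of_lt s.1.2, zero_add, h]

/-- Decoding is periodic and each period contains a code of `s`, so every complete period below `Q`
contributes one. -/
theorem div_card_le_card_fiber [DecidableEq (D.Sample Δ)] (Q : ℕ) (s : D.Sample Δ) :
    Q / Fintype.card (D.Sample Δ) ≤
      (Finset.univ.filter fun c : Fin Q => D.sampleOf Δ c = s).card := by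
  obtain ⟨c, hc, rfl⟩ := D.exists_sampleOf_eq Δ s
  set S := Fintype.card (D.Sample Δ)
  have hlt : ∀ k : Fin (Q / S), c + k * S < Q := fun k => by
    have h1 := Nat.mul_le_mul_right S (Nat.succ_le_of_lt k.2)
    have h2 := Nat.div_mul_le_self Q S
    rw [Nat.succ_mul] at h1
    omega
  have h := Finset.card_le_card_of_injOn (s := (Finset.univ : Finset (Fin (Q / S))))
    (t := Finset.univ.filter fun x : Fin Q => D.sampleOf Δ x = D.sampleOf Δ c)
    (fun k => (⟨c + k * S, hlt k⟩ : Fin Q))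
    (fun k _ => by
      rw [Finset.mem_coe, Finset.mem_filter]
      exact ⟨Finset.mem_univ _, D.sampleOf_add_mul_card Δ c k⟩)
    (fun k _ k' _ h => by
      have h1 : c + (k : ℕ) * S = c + k' * S := congrArg Fin.val h
      exact Fin.ext (Nat.eq_of_mul_eq_mul_right (by omega) (Nat.add_left_cancel h1)))
  rwa [Finset.card_univ, Fintype.card_fin] at h

/-- Fixes the number of coins per attempt: enough that the uneven remainder costs `q ^ m` attempts
together at most a factor `2`. -/
theorem two_mul_card_sample_le (m : ℕ) :
    2 * C.q ^ m * Fintype.card (D.Sample Δ) ≤ 2 ^ (C.q ^ (Δ.coins + m + 6)) := by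
  have hq := C.two_le_q
  have hn := C.n_le_q
  have hq1 : 1 ≤ C.q := by omega
  have h1 : D.ord ^ (C.n + 2) ≤ 2 ^ (C.q ^ 4) := by
    refine (Nat.pow_le_pow_left D.ord_lt.le _).trans ?_
    rw [← pow_mul]
    refine Nat.pow_le_pow_right (by norm_num) ?_
    calc C.q ^ 2 * (C.n + 2) ≤ C.q ^ 2 * (C.q * C.q) := by
          refine Nat.mul_le_mul_left _ ?_
          nlinarith
      _ = C.q ^ 4 := by ring
  have hexp : 1 + C.q ^ m + (C.q ^ Δ.coins + C.q ^ 4) ≤ C.q ^ (Δ.coins + m + 6) := by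
    set t := Δ.coins + m + 4 with ht
    have h0 : 1 ≤ C.q ^ t := Nat.one_le_pow _ _ hq1
    have h2 : C.q ^ m ≤ C.q ^ t := Nat.pow_le_pow_right hq1 (by omega)
    have h3 : C.q ^ Δ.coins ≤ C.q ^ t := Nat.pow_le_pow_right hq1 (by omega)
    have h4 : C.q ^ 4 ≤ C.q ^ t := Nat.pow_le_pow_right hq1 (by omega)
    have h5 : C.q ^ (Δ.coins + m + 6) = C.q * C.q * C.q ^ t := by rw [ht]; ring
    rw [h5]
    nlinarith [Nat.mul_le_mul hq hq]
  rw [card_sample]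
  calc 2 * C.q ^ m * (2 ^ (C.q ^ Δ.coins) * D.ord ^ (C.n + 2))
      ≤ 2 * 2 ^ (C.q ^ m) * (2 ^ (C.q ^ Δ.coins) * 2 ^ (C.q ^ 4)) := by
        refine Nat.mul_le_mul (Nat.mul_le_mul_left _ Nat.lt_two_pow_self.le)
          (Nat.mul_le_mul_left _ h1)
    _ = 2 ^ (1 + C.q ^ m + (C.q ^ Δ.coins + C.q ^ 4)) := by rw [pow_add, pow_add, pow_add, pow_one]
    _ ≤ _ := Nat.pow_le_pow_right (by norm_num) hexp

open Classical in
/-- The blocks of `M` sample codes below `Q` that lead to the discrete logarithm. -/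
noncomputable def goodBlocks (Q M : ℕ) : Finset (Fin M → Fin Q) :=
  Finset.univ.filter fun ξ => (fun c : Fin Q => D.sampleOf Δ c) ∘ ξ ∈ D.winning Δ M

theorem pow_le_card_goodBlocks (hC : C ∈ 𝒞) (hdeg : 2 ≤ D.deg) :
    (2 ^ (C.q ^ (Δ.coins + (Δ.exponent + 5) + 6))) ^ (C.q ^ (Δ.exponent + 5)) ≤
      2 * C.q ^ (Δ.exponent + 6) *
        (D.goodBlocks Δ (2 ^ (C.q ^ (Δ.coins + (Δ.exponent + 5) + 6)))
          (C.q ^ (Δ.exponent + 5))).card := by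
  classical
  have hq := C.two_le_q
  have h1 := D.two_mul_card_sample_le Δ (Δ.exponent + 5)
  have h2 := D.card_le_card_winning Δ hC hdeg
  rw [Fintype.card_fun, Fintype.card_fin] at h2
  set Q := 2 ^ (C.q ^ (Δ.coins + (Δ.exponent + 5) + 6))
  set M := C.q ^ (Δ.exponent + 5) with hM
  set S := Fintype.card (D.Sample Δ)
  have hM0 : 0 < M := by positivity
  have h3 : Q ^ M ≤ 2 * ((Q / S) ^ M * S ^ M) :=
    pow_le_two_mul_div_pow_mul_pow h1 Fintype.card_pos (by nlinarith)
  have h4 := card_mul_pow_le_card_preimage (fun c : Fin Q => D.sampleOf Δ c)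
    (D.div_card_le_card_fiber Δ Q) (D.winning Δ M)
  calc Q ^ M ≤ 2 * ((Q / S) ^ M * S ^ M) := h3
    _ ≤ 2 * ((Q / S) ^ M * (C.q ^ (Δ.exponent + 6) * (D.winning Δ M).card)) := by gcongr
    _ = 2 * C.q ^ (Δ.exponent + 6) * ((D.winning Δ M).card * (Q / S) ^ M) := by ring
    _ ≤ _ := by
      refine Nat.mul_le_mul_left _ (h4.trans (le_of_eq ?_))
      congr

theorem isLog_trial (hdeg : 2 ≤ D.deg) {e m R j : ℕ} {ξ : Fin (C.q ^ m) → Fin (2 ^ (C.q ^ e))}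
    (hξ : ξ ∈ D.goodBlocks Δ _ _)
    (h : ∀ i, (ξ i : ℕ) = R / (2 ^ (C.q ^ e)) ^ (j * C.q ^ m + i) % 2 ^ (C.q ^ e)) :
    D.IsLog (D.trial Δ e m R j) := by
  classical
  have h1 := (Finset.mem_filter.1 (Finset.mem_filter.1 hξ).2).2
  rw [trial, if_neg (by omega)]
  rwa [D.relations_ext Δ (s' := D.seqOf Δ ((fun c : Fin _ => D.sampleOf Δ c) ∘ ξ))]
  intro i hi
  simp only [seqOf, dif_pos hi, Function.comp_apply]
  rw [← sample_eq, h ⟨i, hi⟩]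

open Classical in
/-- Most coin tosses lead to the discrete logarithm. -/
theorem two_mul_le_three_mul_card (hC : C ∈ 𝒞) (hdeg : 2 ≤ D.deg) {e m a K : ℕ}
    (he : e = Δ.coins + m + 6) (hm : m = Δ.exponent + 5) (ha : a = Δ.exponent + 9)
    (hK : K = 2 ^ (C.q ^ (e + m + a))) :
    2 * K ≤ 3 * ((Finset.range K).filter fun R =>
      D.IsLog (D.answer Δ e m R (C.q ^ a))).card := by
  have hq := C.two_le_q
  have hB := D.pow_le_card_goodBlocks Δ hC hdeg
  rw [← hm, ← he] at hB
  set M := C.q ^ m with hM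
  set Q := 2 ^ (C.q ^ e) with hQ
  set T := C.q ^ a with hT
  set B := D.goodBlocks Δ Q M
  have hM0 : 0 < M := by positivity
  have hQ0 : 0 < Q := by positivity
  have hKQ : K = Q ^ (T * M) := by
    rw [hK, hQ, ← pow_mul]
    congr 1
    rw [hT, hM]
    ring
  have hcard : Fintype.card (Fin M → Fin Q) = Q ^ M := by simp
  -- The base `Q` digits of `R` form `T` blocks of length `M` and determine `R < Q ^ (T * M)`. If
  -- the answer is wrong, none of the blocks is good.
  have hbad : ((Finset.range K).filter fun R => ¬ D.IsLog (D.answer Δ e m R T)).card ≤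
      (Q ^ M - B.card) ^ T := by
    let block : ℕ → Fin T → Fin M → Fin Q := fun R j i =>
      ⟨R / Q ^ ((j : ℕ) * M + i) % Q, Nat.mod_lt _ hQ0⟩
    have h1 : (Fintype.piFinset fun _ : Fin T => Bᶜ).card = (Q ^ M - B.card) ^ T := by
      rw [Fintype.card_piFinset, Finset.prod_const, Finset.card_univ, Fintype.card_fin,
        Finset.card_compl, hcard]
    rw [← h1]
    refine Finset.card_le_card_of_injOn block (fun R hR => ?_) fun R hR R' hR' h => ?_
    · rw [Finset.mem_coe, Fintype.mem_piFinset]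
      intro j
      rw [Finset.mem_compl]
      intro hj
      exact (Finset.mem_filter.1 hR).2 (D.isLog_answer Δ j.2
        (D.isLog_trial Δ hdeg (R := R) (j := j) hj fun i => rfl))
    · have hR := Finset.mem_range.1 (Finset.mem_filter.1 hR).1
      have hR' := Finset.mem_range.1 (Finset.mem_filter.1 hR').1
      rw [hKQ] at hR hR'
      refine eq_of_digits_eq hR hR' fun i hi => ?_
      have h2 := congrArg Fin.val (congrFun (congrFun h
        ⟨i / M, (Nat.div_lt_iff_lt_mul hM0).2 hi⟩) ⟨i % M, Nat.mod_lt _ hM0⟩)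
      simpa only [block, Nat.div_add_mod'] using h2
  have hsum := Finset.card_filter_add_card_filter_not (s := Finset.range K)
    fun R => D.IsLog (D.answer Δ e m R T)
  rw [Finset.card_range] at hsum
  -- A block is good with probability at least `1 / c` for `c = 2 * q ^ (exponent + 6)`, and `2 * c
  -- ≤ q ^ (exponent + 9) = T`.
  have h3 : 3 * (Q ^ M - B.card) ^ T ≤ (Q ^ M) ^ T := by
    refine three_mul_sub_pow_le (by positivity) (hcard ▸ Finset.card_le_univ B) hB ?_
    calc 2 * (2 * C.q ^ (Δ.exponent + 6)) = 2 * 2 * 1 * C.q ^ (Δ.exponent + 6) := by ring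
      _ ≤ C.q * C.q * C.q * C.q ^ (Δ.exponent + 6) := by gcongr; omega
      _ = T := by rw [hT, ha]; ring
  rw [← pow_mul Q M T, mul_comm M T, ← hKQ] at h3
  omega

/-- Here `N = q - 1`, and the trial numbers themselves run through all exponents. The index calculus
is unavailable: `h` has a root in the field, so `lin` may vanish and `received` may divide by `0`.
-/
theorem isLog_answer_of_deg_eq_one (hdeg : D.deg = 1) {e m R a : ℕ} (ha : 0 < a) :
    D.IsLog (D.answer Δ e m R (C.q ^ a)) := by
  obtain ⟨x, hx, h⟩ := D.exists_log_lt
  have h1 : x < C.q ^ a := by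
    have h2 : C.q ^ 1 ≤ C.q ^ a := Nat.pow_le_pow_right (by have := C.two_le_q; omega) ha
    rw [ord, hdeg] at hx
    omega
  refine D.isLog_answer Δ h1 ?_
  rw [trial, if_pos hdeg]
  exact D.isLog_of_pow_eq hx h

end DLInst

end RSDlog

/-- For every family of Reed-Solomon codes: if list decoding at radius `n - ĝ(n, k, q)` can be done
in time `q ^ O(1)` for the codes of the family, then discrete logarithms over the fields with
`q ^ (ĝ(n, k, q) - k)` elements can be computed in time `q ^ O(1)`. -/
theorem theorem1 (𝒞 : Set RSDlog.RSCode)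
    (hdec : (RSDlog.listDecoding 𝒞).SolvableInPolyTime) :
    (RSDlog.discreteLog 𝒞).SolvableInPolyTime := by
  classical
  obtain ⟨Δ⟩ := RSDlog.exists_decoder hdec
  refine RSDlog.solvable_of_card Δ (Δ.coins + (Δ.exponent + 5) + 6) (Δ.exponent + 5)
    (Δ.exponent + 9) fun C hC D => ⟨_, Finset.filter_subset (fun R => D.IsLog (D.answer Δ
      (Δ.coins + (Δ.exponent + 5) + 6) (Δ.exponent + 5) R (C.q ^ (Δ.exponent + 9)))) _, ?_,
      fun R hR => (Finset.mem_filter.1 hR).2⟩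
  rcases Nat.lt_or_ge 1 D.deg with hdeg | hdeg
  · exact D.two_mul_le_three_mul_card Δ hC hdeg rfl rfl rfl rfl
  · rw [Finset.filter_true_of_mem fun R _ => D.isLog_answer_of_deg_eq_one Δ
      (Nat.le_antisymm hdeg D.deg_pos) (Nat.succ_pos _), Finset.card_range]
    omega
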